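/- Let $M$ be a closed (compact, without boundary) smooth manifold of dimension $n$, foliated by an integrable subbundle $H\subset TM$ of rank $p$, i.e. around every point there are smooth coordinates (foliation coordinates) in which $H$ is spanned by $\partial_1,\dots,\partial_p$. For a multi-index $\alpha$ put $\|\alpha\|=\alpha_1+\cdots+\alpha_p+2(\alpha_{p+1}+\cdots+\alpha_n)$. Fix a smooth positive density $\mu$ on $M$; let $E,F$ be smooth Hermitian complex vector bundles over $M$ of equal rank $m$, and let $L^2(E),L^2(F)$ be the corresponding spaces of square-integrable sections. A linear operator $A\colon C^\infty(E)\to C^\infty(G)$, with $G$ a smooth Hermitian vector bundle, is a differential operator of weighted order $\le d$ if in foliation coordinates and local trivializations $A=\sum_{\|\alpha\|\le d}a_\alpha(x)\partial^\alpha$ with smooth matrix-valued coefficients. Let $P\colon C^\infty(E)\to C^\infty(F)$ be such an operator, of weighted order $d$, and suppose its weighted principal symbol $\sigma_H(P)(x,\xi)=\sum_{\|\alpha\|=d}a_\alpha(x)(i\xi)^\alpha$ is invertible for all $x$ and all $\xi\neq 0$. Choose a finite open cover $\{U_j\}$ of $M$; on each $U_j$ a smooth frame $X_j^1,\dots,X_j^n$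 of $TM$ such that $X_j^1,\dots,X_j^p$ span $H$, and a trivialization of $E$; and a smooth partition of unity $\{\phi_j\}$ subordinate to $\{U_j\}$. Let $X_j^\alpha=(X_j^1)^{\alpha_1}\cdots(X_j^n)^{\alpha_n}$ act on the components of sections, and let $W^d$ be the completion of $C^\infty(E)$ in the norm $$\|u\|_{W^d}^2=\sum_j\sum_{\|\alpha\|\le d}\|\phi_jX_j^\alpha u\|_{L^2}^2 .$$ Then for every such choice: 1. $P$, viewed as an unbounded operator $L^2(E)\to L^2(F)$ with domain $C^\infty(E)$, is closable. The identity of $C^\infty(E)$ extends to an injective bounded linear map $\iota\colon W^d\to L^2(E)$ whose range is exactly the domain of the closure $\bar P$; that is, $\operatorname{dom}\bar P=W^d$. 2. For every smooth Hermitian vector bundle $G$ and every differential operator $A\colon C^\infty(E)\to C^\infty(G)$ of weighted order $\le d$, $A$ extends by continuity to a bounded linear map $A\colon W^d\to L^2(G)$, and there is a constant $C>0$ such that $$\|Au\|\le C\,(\|\bar Pu\|+\|u\|)\qquad\text{for all }u\in W^d,$$ where the norms are $L^2$ norms and $W^d$ is regarded as a subspace of $L^2(E)$ through $\iota$. -/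

import Mathlib

open scoped Manifold ContDiff Topology

noncomputable section

set_option linter.unusedSectionVars false

namespace FoliatedSobolev

open MeasureTheory Set Bundle

/-! ### Multi-indices and monomial operators -/

/-- The weighted degree `‖α‖ = α₁ + ⋯ + αₚ + 2 (αₚ₊₁ + ⋯ + αₙ)` of a multi-index. -/
def weight {n : ℕ} (p : ℕ) (α : Fin n → ℕ) : ℕ :=
  ∑ i : Fin n, (if (i : ℕ) < p then 1 else 2) * α i

/-- The finite set of all multi-indices `α` with `‖α‖ ≤ d` (each entry is then at most `d`). -/
def multiIdx (n p d : ℕ) : Finset (Fin n → ℕ) :=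
  (Fintype.piFinset fun _ : Fin n => Finset.range (d + 1)).filter fun α => weight p α ≤ d

theorem mem_multiIdx {n p d : ℕ} {α : Fin n → ℕ} : α ∈ multiIdx n p d ↔ weight p α ≤ d := by
  refine ⟨fun h => (Finset.mem_filter.1 h).2, fun h => Finset.mem_filter.2 ⟨?_, h⟩⟩
  refine Fintype.mem_piFinset.2 fun i => Finset.mem_range.2 (Nat.lt_succ_of_le ?_)
  refine le_trans ?_ (le_trans (Finset.single_le_sum
    (f := fun i : Fin n => (if (i : ℕ) < p then 1 else 2) * α i) (fun _ _ => Nat.zero_le _)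
    (Finset.mem_univ i)) h)
  split_ifs <;> omega

/-- The ordered monomial `D₁^α₁ ∘ D₂^α₂ ∘ ⋯ ∘ Dₙ^αₙ` in operators `D₁, …, Dₙ`. -/
def monomialOp {n : ℕ} {W : Type*} (D : Fin n → W → W) (α : Fin n → ℕ) (w : W) : W :=
  (List.finRange n).foldr (fun i v => (D i)^[α i] v) w

/-- The `i`-th partial derivative of a function on `ℝⁿ`. -/
def partialDeriv {n : ℕ} {V : Type*} [NormedAddCommGroup V] [NormedSpace ℝ V] (i : Fin n)
    (f : EuclideanSpace ℝ (Fin n) → V) : EuclideanSpace ℝ (Fin n) → V :=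
  fun y => fderiv ℝ f y (EuclideanSpace.single i 1)

/-- The derivative `X f` of a vector-valued function `f` along a vector field `X`. -/
def fieldDeriv (n : ℕ) {M : Type*} [TopologicalSpace M] [ChartedSpace (EuclideanSpace ℝ (Fin n)) M]
    {V : Type*} [NormedAddCommGroup V] [NormedSpace ℝ V]
    (X : (x : M) → TangentSpace (𝓡 n) x) (f : M → V) : M → V :=
  fun x => (mfderiv (𝓡 n) 𝓘(ℝ, V) f x (X x) : V)

/-! ### Foliations and smooth densities -/

/-- The span of the first `p` coordinate vectors of `ℝⁿ`. -/
def coordSpan (n p : ℕ) : Submodule ℝ (EuclideanSpace ℝ (Fin n)) :=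
  Submodule.span ℝ {v | ∃ i : Fin n, (i : ℕ) < p ∧ v = EuclideanSpace.single i 1}

section Manifold

variable (n : ℕ) {M : Type*} [TopologicalSpace M] [ChartedSpace (EuclideanSpace ℝ (Fin n)) M]

/-- A foliation chart: a chart of the smooth structure in which the first `p` coordinate vector
fields span `H`. -/
def IsFoliationChart (p : ℕ) (H : (x : M) → Submodule ℝ (TangentSpace (𝓡 n) x))
    (φ : OpenPartialHomeomorph M (EuclideanSpace ℝ (Fin n))) : Prop :=
  φ ∈ IsManifold.maximalAtlas (𝓡 n) ∞ M ∧
  ∀ x ∈ φ.source, ∀ v : TangentSpace (𝓡 n) x,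
    v ∈ H x ↔ (mfderiv (𝓡 n) (𝓡 n) φ x v : EuclideanSpace ℝ (Fin n)) ∈ coordSpan n p

/-- `H` is an integrable subbundle of rank `p` of the tangent bundle: every point lies in a
foliation chart. -/
structure IsFoliation (p : ℕ) (H : (x : M) → Submodule ℝ (TangentSpace (𝓡 n) x)) : Prop where
  rank_le : p ≤ n
  exists_chart : ∀ x : M, ∃ φ, IsFoliationChart n p H φ ∧ x ∈ φ.source

/-- In every chart, `μ` has a smooth positive density with respect to Lebesgue measure. (On a
compact manifold such a measure is finite and is positive on nonempty open sets.) -/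
def IsSmoothDensity [MeasurableSpace M] (μ : Measure M) : Prop :=
  ∀ φ ∈ IsManifold.maximalAtlas (𝓡 n) ∞ M, ∃ ρ : EuclideanSpace ℝ (Fin n) → ℝ,
    ContDiffOn ℝ ∞ ρ φ.target ∧ (∀ y ∈ φ.target, 0 < ρ y) ∧
    (μ.restrict φ.source).map φ =
      (volume.restrict φ.target).withDensity fun y => ENNReal.ofReal (ρ y)

end Manifold

/-! ### Hermitian vector bundles, smooth sections -/

section Bundles

variable (n m : ℕ) {M : Type*} [TopologicalSpace M] [ChartedSpace (EuclideanSpace ℝ (Fin n)) M]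
  (E : M → Type*) [∀ x, NormedAddCommGroup (E x)] [∀ x, InnerProductSpace ℂ (E x)]
  [TopologicalSpace (TotalSpace (EuclideanSpace ℂ (Fin m)) E)]
  [FiberBundle (EuclideanSpace ℂ (Fin m)) E] [VectorBundle ℂ (EuclideanSpace ℂ (Fin m)) E]

/-- A topological complex vector bundle of rank `m` over a real manifold, whose fibres are inner
product spaces, is a smooth Hermitian bundle if its transition functions and its metric are
smooth. -/
class SmoothHermitianBundle : Prop where
  coordChange : ∀ (e e' : Trivialization (EuclideanSpace ℂ (Fin m))
      (TotalSpace.proj : TotalSpace (EuclideanSpace ℂ (Fin m)) E → M))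
    [MemTrivializationAtlas e] [MemTrivializationAtlas e'],
    ContMDiffOn (𝓡 n) 𝓘(ℝ, EuclideanSpace ℂ (Fin m) →L[ℂ] EuclideanSpace ℂ (Fin m)) ∞
      (fun x : M => (e.coordChangeL ℂ e' x :
        EuclideanSpace ℂ (Fin m) →L[ℂ] EuclideanSpace ℂ (Fin m))) (e.baseSet ∩ e'.baseSet)
  metric : ∀ (e : Trivialization (EuclideanSpace ℂ (Fin m))
      (TotalSpace.proj : TotalSpace (EuclideanSpace ℂ (Fin m)) E → M))
    [MemTrivializationAtlas e] (v w : EuclideanSpace ℂ (Fin m)),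
    ContMDiffOn (𝓡 n) 𝓘(ℝ, ℂ) ∞ (fun x : M => inner ℂ (e.symm x v) (e.symm x w)) e.baseSet

variable {E} in
/-- The component function of a section `s` in a local trivialization `e`. -/
def comp (e : Trivialization (EuclideanSpace ℂ (Fin m))
      (TotalSpace.proj : TotalSpace (EuclideanSpace ℂ (Fin m)) E → M))
    (s : (x : M) → E x) (x : M) : EuclideanSpace ℂ (Fin m) :=
  (e (TotalSpace.mk x (s x))).2

variable {E m} in
theorem comp_add (e : Trivialization (EuclideanSpace ℂ (Fin m))
      (TotalSpace.proj : TotalSpace (EuclideanSpace ℂ (Fin m)) E → M))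
    [MemTrivializationAtlas e] (s t : (x : M) → E x) {x : M} (hx : x ∈ e.baseSet) :
    comp m e (s + t) x = comp m e s x + comp m e t x :=
  (e.linear ℂ hx).map_add (s x) (t x)

variable {E m} in
theorem comp_smul (e : Trivialization (EuclideanSpace ℂ (Fin m))
      (TotalSpace.proj : TotalSpace (EuclideanSpace ℂ (Fin m)) E → M))
    [MemTrivializationAtlas e] (c : ℂ) (s : (x : M) → E x) {x : M} (hx : x ∈ e.baseSet) :
    comp m e (c • s) x = c • comp m e s x :=
  (e.linear ℂ hx).map_smul c (s x)

variable {E m} in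
theorem comp_zero (e : Trivialization (EuclideanSpace ℂ (Fin m))
      (TotalSpace.proj : TotalSpace (EuclideanSpace ℂ (Fin m)) E → M))
    [MemTrivializationAtlas e] {x : M} (hx : x ∈ e.baseSet) :
    comp m e (0 : (x : M) → E x) x = 0 :=
  (e.linear ℂ hx).mk'.map_zero

/-- The space `C^∞(E)` of smooth sections. -/
def smoothSections : Submodule ℂ ((x : M) → E x) where
  carrier := {s | ∀ (e : Trivialization (EuclideanSpace ℂ (Fin m))
      (TotalSpace.proj : TotalSpace (EuclideanSpace ℂ (Fin m)) E → M)) [MemTrivializationAtlas e],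
    ContMDiffOn (𝓡 n) 𝓘(ℝ, EuclideanSpace ℂ (Fin m)) ∞ (comp m e s) e.baseSet}
  add_mem' := by
    intro s t hs ht e _
    exact ((hs e).add (ht e)).congr fun x hx => comp_add e s t hx
  zero_mem' := by
    intro e _
    exact (contMDiffOn_const (c := (0 : EuclideanSpace ℂ (Fin m)))).congr
      fun x hx => comp_zero e hx
  smul_mem' := by
    intro c s hs e _
    have h : ContMDiff 𝓘(ℝ, EuclideanSpace ℂ (Fin m)) 𝓘(ℝ, EuclideanSpace ℂ (Fin m)) ∞
        (fun v : EuclideanSpace ℂ (Fin m) => c • v) :=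
      (contDiff_id.const_smul c).contMDiff
    exact (h.comp_contMDiffOn (hs e)).congr fun x hx => comp_smul e c s hx

/-- The type of smooth sections (with its vector space structure only). -/
def Sec : Type _ := smoothSections n m E

instance : AddCommGroup (Sec n m E) := inferInstanceAs (AddCommGroup (smoothSections n m E))
instance : Module ℂ (Sec n m E) := inferInstanceAs (Module ℂ (smoothSections n m E))

end Bundles

/-! ### The space `L²(E)` -/

theorem eLpNorm_add_toReal_le {X : Type*} [MeasurableSpace X] {G : X → Type*}
    [∀ x, NormedAddCommGroup (G x)] {μ : Measure X} {s t : (x : X) → G x}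
    (hs : MemLp (fun x => ‖s x‖) 2 μ) (ht : MemLp (fun x => ‖t x‖) 2 μ) :
    (eLpNorm (fun x => ‖s x + t x‖) 2 μ).toReal ≤
      (eLpNorm (fun x => ‖s x‖) 2 μ).toReal + (eLpNorm (fun x => ‖t x‖) 2 μ).toReal := by
  have h1 := eLpNorm_add_le hs.1 ht.1 (p := 2) one_le_two
  have h2 : eLpNorm (fun x => ‖s x + t x‖) 2 μ ≤
      eLpNorm ((fun x => ‖s x‖) + fun x => ‖t x‖) 2 μ :=
    eLpNorm_mono_real fun x => by
      rw [norm_norm]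
      exact norm_add_le _ _
  rw [← ENNReal.toReal_add hs.eLpNorm_ne_top ht.eLpNorm_ne_top]
  exact ENNReal.toReal_mono (ENNReal.add_ne_top.2 ⟨hs.eLpNorm_ne_top, ht.eLpNorm_ne_top⟩)
    (h2.trans h1)

theorem eLpNorm_smul_toReal {X : Type*} [MeasurableSpace X] {G : X → Type*}
    [∀ x, NormedAddCommGroup (G x)] [∀ x, InnerProductSpace ℂ (G x)] {μ : Measure X}
    (c : ℂ) (s : (x : X) → G x) :
    (eLpNorm (fun x => ‖c • s x‖) 2 μ).toReal = ‖c‖ * (eLpNorm (fun x => ‖s x‖) 2 μ).toReal := by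
  have : (fun x => ‖c • s x‖) = ‖c‖ • fun x => ‖s x‖ := funext fun x => norm_smul c (s x)
  rw [this, eLpNorm_const_smul]
  simp

section L2

variable (n m : ℕ) {M : Type*} [TopologicalSpace M] [ChartedSpace (EuclideanSpace ℝ (Fin n)) M]
  (E : M → Type*) [∀ x, NormedAddCommGroup (E x)] [∀ x, InnerProductSpace ℂ (E x)]
  [TopologicalSpace (TotalSpace (EuclideanSpace ℂ (Fin m)) E)]
  [FiberBundle (EuclideanSpace ℂ (Fin m)) E] [VectorBundle ℂ (EuclideanSpace ℂ (Fin m)) E]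

variable {E} in
/-- Almost everywhere measurable sections: the components in every local trivialization are
almost everywhere measurable. -/
def IsMeasSection [MeasurableSpace M] (μ : Measure M) (s : (x : M) → E x) : Prop :=
  ∀ (e : Trivialization (EuclideanSpace ℂ (Fin m))
      (TotalSpace.proj : TotalSpace (EuclideanSpace ℂ (Fin m)) E → M)) [MemTrivializationAtlas e],
    AEStronglyMeasurable (comp m e s) (μ.restrict e.baseSet)

variable {E m} in
theorem norm_eq_of_mem (e : Trivialization (EuclideanSpace ℂ (Fin m))
      (TotalSpace.proj : TotalSpace (EuclideanSpace ℂ (Fin m)) E → M))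
    [MemTrivializationAtlas e] (s : (x : M) → E x) {x : M} (hx : x ∈ e.baseSet) :
    ‖s x‖ = Real.sqrt (∑ i, ∑ j, (starRingEnd ℂ (comp m e s x i) * (comp m e s x j *
      inner ℂ (e.symm x (EuclideanSpace.single i 1)) (e.symm x (EuclideanSpace.single j 1))))).re := by
  have h1 : s x = ∑ i, comp m e s x i • e.symm x (EuclideanSpace.single i 1) := by
    have h2 : s x = e.symmₗ ℂ x (comp m e s x) := by
      rw [Trivialization.coe_symmₗ e hx]
      exact (e.symm_apply_apply_mk hx (s x)).symm
    have h3 : comp m e s x = ∑ i, comp m e s x i • EuclideanSpace.single i (1 : ℂ) := by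
      ext k
      simp [Finset.sum_apply, Pi.single_apply]
    conv_lhs => rw [h2, h3, map_sum]
    refine Finset.sum_congr rfl fun i _ => ?_
    rw [map_smul, Trivialization.coe_symmₗ e hx]
  rw [@norm_eq_sqrt_re_inner ℂ]
  congr 1
  conv_lhs => rw [h1]
  simp only [sum_inner, inner_sum, inner_smul_left, inner_smul_right]
  rw [Finset.sum_congr rfl fun i _ => Finset.mul_sum .., Finset.sum_comm]
  refine congrArg Complex.re (Finset.sum_congr rfl fun i _ => Finset.sum_congr rfl fun j _ => ?_)
  ring

variable {E m} in
theorem aestronglyMeasurable_norm [CompactSpace M] [MeasurableSpace M] [BorelSpace M]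
    [SmoothHermitianBundle n m E] {μ : Measure M} {s : (x : M) → E x}
    (hs : IsMeasSection m μ s) : AEStronglyMeasurable (fun x => ‖s x‖) μ := by
  obtain ⟨t, ht⟩ := isCompact_univ.elim_finite_subcover
    (fun y : M => (trivializationAt (EuclideanSpace ℂ (Fin m)) E y).baseSet)
    (fun y => (trivializationAt (EuclideanSpace ℂ (Fin m)) E y).open_baseSet)
    (fun y _ => mem_iUnion.2 ⟨y, mem_baseSet_trivializationAt _ _ y⟩)
  have hcov : (⋃ y : t, (trivializationAt (EuclideanSpace ℂ (Fin m)) E y.1).baseSet) = univ := by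
    refine eq_univ_of_univ_subset (ht.trans ?_)
    intro x hx
    simp only [mem_iUnion] at hx ⊢
    obtain ⟨y, hy, hxy⟩ := hx
    exact ⟨⟨y, hy⟩, hxy⟩
  rw [← Measure.restrict_univ (μ := μ), ← hcov, aestronglyMeasurable_iUnion_iff]
  intro y
  set e := trivializationAt (EuclideanSpace ℂ (Fin m)) E y.1
  have hms : MeasurableSet e.baseSet := e.open_baseSet.measurableSet
  have hc : ∀ i, AEStronglyMeasurable (fun x => comp m e s x i) (μ.restrict e.baseSet) := fun i =>
    (EuclideanSpace.proj (𝕜 := ℂ) i).continuous.comp_aestronglyMeasurable (hs e)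
  have hmain : AEStronglyMeasurable (fun x => Real.sqrt
      (∑ i, ∑ j, (starRingEnd ℂ (comp m e s x i) * (comp m e s x j *
      inner ℂ (e.symm x (EuclideanSpace.single i 1))
        (e.symm x (EuclideanSpace.single j 1))))).re) (μ.restrict e.baseSet) := by
    refine (Real.continuous_sqrt.comp Complex.continuous_re).comp_aestronglyMeasurable ?_
    refine Finset.aestronglyMeasurable_fun_sum _ fun i _ =>
      Finset.aestronglyMeasurable_fun_sum _ fun j _ => ?_
    exact (Complex.continuous_conj.comp_aestronglyMeasurable (hc i)).mul ((hc j).mul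
      ((SmoothHermitianBundle.metric (n := n) e _ _).continuousOn.aestronglyMeasurable hms))
  refine hmain.congr ?_
  filter_upwards [ae_restrict_mem hms] with x hx
  exact (norm_eq_of_mem e s hx).symm

theorem continuous_norm_sec [SmoothHermitianBundle n m E] (s : Sec n m E) : Continuous fun x => ‖s.1 x‖ := by
  rw [continuous_iff_continuousAt]
  intro y
  set e := trivializationAt (EuclideanSpace ℂ (Fin m)) E y
  have hy : y ∈ e.baseSet := mem_baseSet_trivializationAt _ _ y
  have hc : ∀ i, ContinuousOn (fun x => comp m e s.1 x i) e.baseSet := fun i =>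
    (EuclideanSpace.proj (𝕜 := ℂ) i).continuous.comp_continuousOn (s.2 e).continuousOn
  have hmain : ContinuousOn (fun x => Real.sqrt
      (∑ i, ∑ j, (starRingEnd ℂ (comp m e s.1 x i) * (comp m e s.1 x j *
      inner ℂ (e.symm x (EuclideanSpace.single i 1))
        (e.symm x (EuclideanSpace.single j 1))))).re) e.baseSet := by
    refine (Real.continuous_sqrt.comp Complex.continuous_re).comp_continuousOn ?_
    refine continuousOn_finsetSum _ fun i _ => continuousOn_finsetSum _ fun j _ => ?_
    exact (Complex.continuous_conj.comp_continuousOn (hc i)).mul ((hc j).mul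
      (SmoothHermitianBundle.metric (n := n) e _ _).continuousOn)
  exact (hmain.congr fun x hx => norm_eq_of_mem e s.1 hx).continuousAt
    (e.open_baseSet.mem_nhds hy)

variable [CompactSpace M] [MeasurableSpace M] [BorelSpace M] [SmoothHermitianBundle n m E]
  (μ : Measure M)

/-- Square-integrable measurable sections. -/
def sqIntSections : Submodule ℂ ((x : M) → E x) where
  carrier := {s | IsMeasSection m μ s ∧ MemLp (fun x => ‖s x‖) 2 μ}
  add_mem' := by
    intro s t hs ht
    have hst : IsMeasSection m μ (s + t) := by
      intro e _
      refine ((hs.1 e).add (ht.1 e)).congr ?_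
      filter_upwards [ae_restrict_mem e.open_baseSet.measurableSet] with x hx
      exact (comp_add e s t hx).symm
    refine ⟨hst, (hs.2.add ht.2).mono (aestronglyMeasurable_norm n hst) (.of_forall fun x => ?_)⟩
    rw [norm_norm]
    exact (norm_add_le _ _).trans (Real.le_norm_self _)
  zero_mem' := by
    refine ⟨fun e _ => ?_, by simp⟩
    refine (aestronglyMeasurable_const (b := (0 : EuclideanSpace ℂ (Fin m)))).congr ?_
    filter_upwards [ae_restrict_mem e.open_baseSet.measurableSet] with x hx
    exact (comp_zero e hx).symm
  smul_mem' := by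
    intro c s hs
    refine ⟨fun e _ => ?_, ?_⟩
    · refine ((hs.1 e).const_smul c).congr ?_
      filter_upwards [ae_restrict_mem e.open_baseSet.measurableSet] with x hx
      exact (comp_smul e c s hx).symm
    · have : (fun x => ‖(c • s) x‖) = fun x => ‖c‖ * ‖s x‖ := by
        ext x
        exact norm_smul c (s x)
      rw [this]
      exact hs.2.const_mul _

/-- The `L²` seminorm `(∫ ‖s x‖² dμ)^(1/2)`. -/
def l2Seminorm : Seminorm ℂ (sqIntSections n m E μ) :=
  Seminorm.of (fun s => (eLpNorm (fun x => ‖s.1 x‖) 2 μ).toReal)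
    (fun s t => eLpNorm_add_toReal_le s.2.2 t.2.2)
    (fun c s => eLpNorm_smul_toReal c s.1)

/-- Square-integrable measurable sections, as a type carrying the `L²` seminorm. -/
def L2Fun : Type _ := sqIntSections n m E μ

instance : SeminormedAddCommGroup (L2Fun n m E μ) :=
  (l2Seminorm n m E μ).toAddGroupSeminorm.toSeminormedAddCommGroup

instance : Module ℂ (L2Fun n m E μ) := inferInstanceAs (Module ℂ (sqIntSections n m E μ))

theorem L2Fun.norm_def (s : L2Fun n m E μ) :
    ‖s‖ = (eLpNorm (fun x => ‖s.1 x‖) 2 μ).toReal := rfl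

instance : NormedSpace ℂ (L2Fun n m E μ) where
  norm_smul_le c s := ((l2Seminorm n m E μ).smul' c s).le

/-- The space `L²(E)`: square-integrable measurable sections modulo equality almost everywhere
(that is, modulo sections of `L²` norm zero). -/
abbrev L2 : Type _ := SeparationQuotient (L2Fun n m E μ)

theorem sec_mem_sqInt [IsFiniteMeasure μ] (s : Sec n m E) : s.1 ∈ sqIntSections n m E μ := by
  refine ⟨fun e _ => (s.2 e).continuousOn.aestronglyMeasurable e.open_baseSet.measurableSet, ?_⟩
  exact (continuous_norm_sec n m E s).memLp_of_hasCompactSupport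
    (HasCompactSupport.of_compactSpace _)

/-- The inclusion `C^∞(E) → L²(E)`. -/
def toL2 [IsFiniteMeasure μ] : Sec n m E →ₗ[ℂ] L2 n m E μ :=
  (SeparationQuotient.mkCLM ℂ (L2Fun n m E μ)).toLinearMap ∘ₗ
    { toFun := fun s => (⟨s.1, sec_mem_sqInt n m E μ s⟩ : L2Fun n m E μ)
      map_add' := fun _ _ => rfl
      map_smul' := fun _ _ => rfl }

theorem norm_toL2 [IsFiniteMeasure μ] (s : Sec n m E) :
    ‖toL2 n m E μ s‖ = (eLpNorm (fun x => ‖s.1 x‖) 2 μ).toReal := rfl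

theorem toL2_injective [IsFiniteMeasure μ] [μ.IsOpenPosMeasure] :
    Function.Injective (toL2 n m E μ) := by
  rw [← LinearMap.ker_eq_bot, LinearMap.ker_eq_bot']
  intro s hs
  have h0 : (eLpNorm (fun x => ‖s.1 x‖) 2 μ).toReal = 0 := by
    rw [← norm_toL2, hs, norm_zero]
  have hm := (sec_mem_sqInt n m E μ s).2
  rw [ENNReal.toReal_eq_zero_iff, or_iff_left hm.eLpNorm_ne_top,
    eLpNorm_eq_zero_iff hm.1 (by norm_num)] at h0
  have h1 := ((continuous_norm_sec n m E s).ae_eq_iff_eq μ continuous_const).1 h0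
  exact Subtype.ext (funext fun x => norm_eq_zero.1 (congrFun h1 x))

end L2

/-! ### Differential operators and the weighted principal symbol -/

section Operators

variable (n m k p d : ℕ) {M : Type*} [TopologicalSpace M]
  [ChartedSpace (EuclideanSpace ℝ (Fin n)) M]
  (E : M → Type*) [∀ x, NormedAddCommGroup (E x)] [∀ x, InnerProductSpace ℂ (E x)]
  [TopologicalSpace (TotalSpace (EuclideanSpace ℂ (Fin m)) E)]
  [FiberBundle (EuclideanSpace ℂ (Fin m)) E] [VectorBundle ℂ (EuclideanSpace ℂ (Fin m)) E]
  (F : M → Type*) [∀ x, NormedAddCommGroup (F x)] [∀ x, InnerProductSpace ℂ (F x)]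
  [TopologicalSpace (TotalSpace (EuclideanSpace ℂ (Fin k)) F)]
  [FiberBundle (EuclideanSpace ℂ (Fin k)) F] [VectorBundle ℂ (EuclideanSpace ℂ (Fin k)) F]

variable {E F} in
/-- In the coordinates `φ` and the trivializations `e` of `E` and `f` of `F`, the operator `P` is
`∑_{‖α‖ ≤ d} a_α(x) ∂^α` with smooth matrix-valued coefficients `a_α`. -/
structure IsLocalExpr (P : Sec n m E →ₗ[ℂ] Sec n k F)
    (φ : OpenPartialHomeomorph M (EuclideanSpace ℝ (Fin n)))
    (e : Trivialization (EuclideanSpace ℂ (Fin m))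
      (TotalSpace.proj : TotalSpace (EuclideanSpace ℂ (Fin m)) E → M))
    (f : Trivialization (EuclideanSpace ℂ (Fin k))
      (TotalSpace.proj : TotalSpace (EuclideanSpace ℂ (Fin k)) F → M))
    (a : (Fin n → ℕ) → M → EuclideanSpace ℂ (Fin m) →L[ℂ] EuclideanSpace ℂ (Fin k)) : Prop where
  smooth : ∀ α, ContMDiffOn (𝓡 n)
    𝓘(ℝ, EuclideanSpace ℂ (Fin m) →L[ℂ] EuclideanSpace ℂ (Fin k)) ∞ (a α)
    (φ.source ∩ e.baseSet ∩ f.baseSet)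
  eq_sum : ∀ (u : Sec n m E), ∀ x ∈ φ.source ∩ e.baseSet ∩ f.baseSet,
    comp k f (P u).1 x = ∑ α ∈ multiIdx n p d,
      a α x (monomialOp partialDeriv α (fun y => comp m e u.1 (φ.symm y)) (φ x))

variable {E F} in
/-- `P` is a differential operator of weighted order (at most) `d`. -/
def IsDiffOp (H : (x : M) → Submodule ℝ (TangentSpace (𝓡 n) x))
    (P : Sec n m E →ₗ[ℂ] Sec n k F) : Prop :=
  ∀ φ, IsFoliationChart n p H φ →
  ∀ (e : Trivialization (EuclideanSpace ℂ (Fin m))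
      (TotalSpace.proj : TotalSpace (EuclideanSpace ℂ (Fin m)) E → M))
    (f : Trivialization (EuclideanSpace ℂ (Fin k))
      (TotalSpace.proj : TotalSpace (EuclideanSpace ℂ (Fin k)) F → M))
    [MemTrivializationAtlas e] [MemTrivializationAtlas f],
    ∃ a, IsLocalExpr n m k p d P φ e f a

variable {n m k} in
/-- The weighted principal symbol `∑_{‖α‖ = d} a_α(x) (iξ)^α`. -/
def symbol (a : (Fin n → ℕ) → M → EuclideanSpace ℂ (Fin m) →L[ℂ] EuclideanSpace ℂ (Fin k))
    (x : M) (ξ : Fin n → ℝ) : EuclideanSpace ℂ (Fin m) →L[ℂ] EuclideanSpace ℂ (Fin k) :=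
  ∑ α ∈ (multiIdx n p d).filter (fun α => weight p α = d),
    (∏ i, (Complex.I * (ξ i : ℂ)) ^ α i) • a α x

variable {E F} in
/-- The weighted principal symbol of `P` is invertible for `ξ ≠ 0`. (The coefficients of a
differential operator in given coordinates and trivializations are unique.) -/
def HasInvertibleSymbol (H : (x : M) → Submodule ℝ (TangentSpace (𝓡 n) x))
    (P : Sec n m E →ₗ[ℂ] Sec n k F) : Prop :=
  ∀ φ, IsFoliationChart n p H φ →
  ∀ (e : Trivialization (EuclideanSpace ℂ (Fin m))
      (TotalSpace.proj : TotalSpace (EuclideanSpace ℂ (Fin m)) E → M))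
    (f : Trivialization (EuclideanSpace ℂ (Fin k))
      (TotalSpace.proj : TotalSpace (EuclideanSpace ℂ (Fin k)) F → M))
    [MemTrivializationAtlas e] [MemTrivializationAtlas f] (a),
    IsLocalExpr n m k p d P φ e f a →
    ∀ x ∈ φ.source ∩ e.baseSet ∩ f.baseSet, ∀ ξ : Fin n → ℝ, ξ ≠ 0 →
      Function.Bijective (symbol p d a x ξ)

variable [CompactSpace M] [MeasurableSpace M] [BorelSpace M]
  [SmoothHermitianBundle n m E] [SmoothHermitianBundle n k F]
  (μ : Measure M) [IsFiniteMeasure μ] [μ.IsOpenPosMeasure]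

variable {E F} in
/-- `P` as an unbounded operator `L²(E) → L²(F)` with domain `C^∞(E)`. -/
def unboundedOp (P : Sec n m E →ₗ[ℂ] Sec n k F) : L2 n m E μ →ₗ.[ℂ] L2 n k F μ where
  domain := LinearMap.range (toL2 n m E μ)
  toFun := (toL2 n k F μ ∘ₗ P) ∘ₗ
    (LinearEquiv.ofInjective (toL2 n m E μ) (toL2_injective n m E μ)).symm.toLinearMap

variable {E F} in
theorem unboundedOp_apply (P : Sec n m E →ₗ[ℂ] Sec n k F) (u : Sec n m E) :
    unboundedOp n m k μ P ⟨toL2 n m E μ u, ⟨u, rfl⟩⟩ = toL2 n k F μ (P u) := by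
  have : (LinearEquiv.ofInjective (toL2 n m E μ) (toL2_injective n m E μ)).symm
      ⟨toL2 n m E μ u, ⟨u, rfl⟩⟩ = u := by
    rw [LinearEquiv.symm_apply_eq]
    rfl
  exact congrArg (fun v => toL2 n k F μ (P v)) this

end Operators

/-! ### The weighted Sobolev space `W^d` -/

section Sobolev

variable (n m p d : ℕ) {M : Type*} [TopologicalSpace M]
  [ChartedSpace (EuclideanSpace ℝ (Fin n)) M]
  (E : M → Type*) [∀ x, NormedAddCommGroup (E x)] [∀ x, InnerProductSpace ℂ (E x)]
  [TopologicalSpace (TotalSpace (EuclideanSpace ℂ (Fin m)) E)]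
  [FiberBundle (EuclideanSpace ℂ (Fin m)) E] [VectorBundle ℂ (EuclideanSpace ℂ (Fin m)) E]

/-- The choices that enter the weighted Sobolev norm: a finite open cover `U_j` of `M`; on each
`U_j` a smooth frame `X_j^1, …, X_j^n` of the tangent bundle whose first `p` members span `H`, and
a trivialization of `E`; and a smooth partition of unity `φ_j` subordinate to the cover. -/
structure SobolevData [IsManifold (𝓡 n) ∞ M] (H : (x : M) → Submodule ℝ (TangentSpace (𝓡 n) x))
    (J : Type*) where
  U : J → Set M
  isOpen : ∀ j, IsOpen (U j)
  cover : ⋃ j, U j = univ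
  X : J → Fin n → (x : M) → TangentSpace (𝓡 n) x
  smooth : ∀ j i, ContMDiffOn (𝓡 n) (𝓡 n).tangent ∞
    (fun x => (⟨x, X j i x⟩ : TangentBundle (𝓡 n) M)) (U j)
  linearIndependent : ∀ j, ∀ x ∈ U j, LinearIndependent ℝ fun i => X j i x
  span_eq : ∀ j, ∀ x ∈ U j, Submodule.span ℝ {v | ∃ i : Fin n, (i : ℕ) < p ∧ v = X j i x} = H x
  triv : J → Trivialization (EuclideanSpace ℂ (Fin m))
    (TotalSpace.proj : TotalSpace (EuclideanSpace ℂ (Fin m)) E → M)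
  triv_mem : ∀ j, MemTrivializationAtlas (triv j)
  subset_baseSet : ∀ j, U j ⊆ (triv j).baseSet
  φ : SmoothPartitionOfUnity J (𝓡 n) M univ
  subordinate : φ.IsSubordinate U

section deriv

variable {n} {V : Type*} [NormedAddCommGroup V] [NormedSpace ℝ V]
  [IsManifold (𝓡 n) ∞ M]

theorem fieldDeriv_contMDiffOn {U : Set M} (hU : IsOpen U)
    {X : (x : M) → TangentSpace (𝓡 n) x}
    (hX : ContMDiffOn (𝓡 n) (𝓡 n).tangent ∞
      (fun x => (⟨x, X x⟩ : TangentBundle (𝓡 n) M)) U)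
    {f : M → V} (hf : ContMDiffOn (𝓡 n) 𝓘(ℝ, V) ∞ f U) :
    ContMDiffOn (𝓡 n) 𝓘(ℝ, V) ∞ (fieldDeriv n X f) U := by
  have h1 := hf.contMDiffOn_tangentMapWithin (m := ∞) (by simp) hU.uniqueMDiffOn
  have h2 := h1.comp hX (fun x hx => hx)
  have h3 := (contMDiff_snd_tangentBundle_modelSpace (n := ∞) V 𝓘(ℝ, V)).comp_contMDiffOn h2
  refine h3.congr fun x hx => ?_
  simp only [Function.comp, tangentMapWithin, fieldDeriv]
  rw [mfderivWithin_of_isOpen hU hx]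

theorem fieldDeriv_congr {U : Set M} (hU : IsOpen U) (X : (x : M) → TangentSpace (𝓡 n) x)
    {f g : M → V} (h : EqOn f g U) : EqOn (fieldDeriv n X f) (fieldDeriv n X g) U := by
  intro x hx
  have : f =ᶠ[𝓝 x] g := Filter.eventuallyEq_of_mem (hU.mem_nhds hx) h
  simp only [fieldDeriv]
  rw [this.mfderiv_eq]
  rfl

theorem fieldDeriv_add {U : Set M} (hU : IsOpen U) (X : (x : M) → TangentSpace (𝓡 n) x)
    {f g : M → V} (hf : ContMDiffOn (𝓡 n) 𝓘(ℝ, V) ∞ f U) (hg : ContMDiffOn (𝓡 n) 𝓘(ℝ, V) ∞ g U) :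
    EqOn (fieldDeriv n X (f + g)) (fieldDeriv n X f + fieldDeriv n X g) U := by
  intro x hx
  have hf' := ((hf x hx).contMDiffAt (hU.mem_nhds hx)).mdifferentiableAt (by simp)
  have hg' := ((hg x hx).contMDiffAt (hU.mem_nhds hx)).mdifferentiableAt (by simp)
  simp only [fieldDeriv, Pi.add_apply]
  rw [mfderiv_add hf' hg']
  rfl

theorem fieldDeriv_clm {U : Set M} (hU : IsOpen U) (X : (x : M) → TangentSpace (𝓡 n) x)
    {f : M → V} (hf : ContMDiffOn (𝓡 n) 𝓘(ℝ, V) ∞ f U) (L : V →L[ℝ] V) :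
    EqOn (fieldDeriv n X (L ∘ f)) (L ∘ fieldDeriv n X f) U := by
  intro x hx
  have hf' := ((hf x hx).contMDiffAt (hU.mem_nhds hx)).mdifferentiableAt (by simp)
  have h := (L.hasMFDerivAt (x := f x)).comp x hf'.hasMFDerivAt
  simp only [fieldDeriv, Function.comp]
  erw [h.mfderiv]
  rfl

/-- An operator on functions that, over the open set `U`, is local, complex linear and preserves
smoothness. -/
structure LocalOp (V : Type*) [NormedAddCommGroup V] [NormedSpace ℝ V] [NormedSpace ℂ V]
    (U : Set M) (T : (M → V) → (M → V)) : Prop where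
  smooth : ∀ f, ContMDiffOn (𝓡 n) 𝓘(ℝ, V) ∞ f U → ContMDiffOn (𝓡 n) 𝓘(ℝ, V) ∞ (T f) U
  congr : ∀ f g, EqOn f g U → EqOn (T f) (T g) U
  add : ∀ f g, ContMDiffOn (𝓡 n) 𝓘(ℝ, V) ∞ f U → ContMDiffOn (𝓡 n) 𝓘(ℝ, V) ∞ g U →
    EqOn (T (f + g)) (T f + T g) U
  smul : ∀ (c : ℂ) f, ContMDiffOn (𝓡 n) 𝓘(ℝ, V) ∞ f U → EqOn (T (c • f)) (c • T f) U

variable {V' : Type*} [NormedAddCommGroup V'] [NormedSpace ℝ V'] [NormedSpace ℂ V']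
  [IsScalarTower ℝ ℂ V']

theorem LocalOp.comp {U : Set M} {T S : (M → V') → (M → V')} (hT : LocalOp (n := n) V' U T)
    (hS : LocalOp (n := n) V' U S) : LocalOp (n := n) V' U (fun f => T (S f)) where
  smooth _ hf := hT.smooth _ (hS.smooth _ hf)
  congr _ _ h := hT.congr _ _ (hS.congr _ _ h)
  add f g hf hg := (hT.congr _ _ (hS.add f g hf hg)).trans
    (hT.add _ _ (hS.smooth _ hf) (hS.smooth _ hg))
  smul c f hf := (hT.congr _ _ (hS.smul c f hf)).trans (hT.smul c _ (hS.smooth _ hf))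

theorem LocalOp.id (U : Set M) : LocalOp (n := n) V' U (fun f => f) where
  smooth _ hf := hf
  congr _ _ h := h
  add _ _ _ _ := eqOn_refl _ _
  smul _ _ _ := eqOn_refl _ _

theorem LocalOp.iterate {U : Set M} {T : (M → V') → (M → V')} (hT : LocalOp (n := n) V' U T)
    (r : ℕ) : LocalOp (n := n) V' U (T^[r]) := by
  induction r with
  | zero => exact LocalOp.id U
  | succ r ih => exact ih.comp hT

theorem localOp_fieldDeriv {U : Set M} (hU : IsOpen U) {X : (x : M) → TangentSpace (𝓡 n) x}
    (hX : ContMDiffOn (𝓡 n) (𝓡 n).tangent ∞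
      (fun x => (⟨x, X x⟩ : TangentBundle (𝓡 n) M)) U) :
    LocalOp (n := n) V' U (fieldDeriv n X) where
  smooth _ hf := fieldDeriv_contMDiffOn hU hX hf
  congr _ _ h := fieldDeriv_congr hU X h
  add _ _ hf hg := fieldDeriv_add hU X hf hg
  smul c _ hf := fieldDeriv_clm hU X hf ((c • ContinuousLinearMap.id ℂ V').restrictScalars ℝ)

theorem localOp_monomial {U : Set M} {D : Fin n → (M → V') → (M → V')}
    (hD : ∀ i, LocalOp (n := n) V' U (D i)) (α : Fin n → ℕ) :
    LocalOp (n := n) V' U (monomialOp D α) := by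
  have : ∀ l : List (Fin n), LocalOp (n := n) V' U
      (fun f => l.foldr (fun i v => (D i)^[α i] v) f) := by
    intro l
    induction l with
    | nil => exact LocalOp.id U
    | cons i l ih => exact ((hD i).iterate (α i)).comp ih
  exact this (List.finRange n)

end deriv

section norm

variable {n m p E} [IsManifold (𝓡 n) ∞ M] {H : (x : M) → Submodule ℝ (TangentSpace (𝓡 n) x)}
  {J : Type*}

/-- The function `φ_j X_j^α u`, where `X_j^α = (X_j^1)^α₁ ⋯ (X_j^n)^αₙ` acts on the components of
the section `u`. -/
def SobolevData.term (S : SobolevData n m p E H J) (j : J) (α : Fin n → ℕ) (u : Sec n m E) :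
    M → EuclideanSpace ℂ (Fin m) :=
  fun x => S.φ j x • monomialOp (fun i => fieldDeriv n (S.X j i)) α (comp m (S.triv j) u.1) x

variable (S : SobolevData n m p E H J) (j : J) (α : Fin n → ℕ)

theorem SobolevData.localOp :
    LocalOp (n := n) (EuclideanSpace ℂ (Fin m)) (S.U j)
      (monomialOp (fun i => fieldDeriv n (S.X j i)) α) :=
  localOp_monomial (fun i => localOp_fieldDeriv (S.isOpen j) (S.smooth j i)) α

theorem SobolevData.comp_smooth (u : Sec n m E) :
    ContMDiffOn (𝓡 n) 𝓘(ℝ, EuclideanSpace ℂ (Fin m)) ∞ (comp m (S.triv j) u.1) (S.U j) := by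
  have := S.triv_mem j
  exact (u.2 (S.triv j)).mono (S.subset_baseSet j)

theorem SobolevData.φ_eq_zero {x : M} (hx : x ∉ S.U j) : S.φ j x = 0 :=
  image_eq_zero_of_notMem_tsupport fun h => hx (S.subordinate j h)

theorem SobolevData.term_continuous (u : Sec n m E) : Continuous (S.term j α u) := by
  have hsm := (S.localOp j α).smooth _ (S.comp_smooth j u)
  have : ContMDiff (𝓡 n) 𝓘(ℝ, EuclideanSpace ℂ (Fin m)) ∞ (S.term j α u) := by
    refine contMDiff_of_tsupport fun x hx => ?_
    have hxU : x ∈ S.U j := S.subordinate j (tsupport_smul_subset_left _ _ hx)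
    exact ((S.φ j).contMDiff x).smul ((hsm x hxU).contMDiffAt ((S.isOpen j).mem_nhds hxU))
  exact this.continuous

theorem SobolevData.term_add (u v : Sec n m E) :
    S.term j α (u + v) = S.term j α u + S.term j α v := by
  have := S.triv_mem j
  funext x
  by_cases hx : x ∈ S.U j
  · have h1 : EqOn (comp m (S.triv j) (u + v).1)
        (comp m (S.triv j) u.1 + comp m (S.triv j) v.1) (S.U j) :=
      fun y hy => comp_add (S.triv j) u.1 v.1 (S.subset_baseSet j hy)
    have h2 := (((S.localOp j α).congr _ _ h1).trans
      ((S.localOp j α).add _ _ (S.comp_smooth j u) (S.comp_smooth j v))) hx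
    simp only [SobolevData.term, Pi.add_apply] at h2 ⊢
    rw [h2, smul_add]
  · simp [SobolevData.term, S.φ_eq_zero j hx]

theorem SobolevData.term_smul (c : ℂ) (u : Sec n m E) :
    S.term j α (c • u) = c • S.term j α u := by
  have := S.triv_mem j
  funext x
  by_cases hx : x ∈ S.U j
  · have h1 : EqOn (comp m (S.triv j) (c • u).1) (c • comp m (S.triv j) u.1) (S.U j) :=
      fun y hy => comp_smul (S.triv j) c u.1 (S.subset_baseSet j hy)
    have h2 := (((S.localOp j α).congr _ _ h1).trans
      ((S.localOp j α).smul c _ (S.comp_smooth j u))) hx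
    simp only [SobolevData.term, Pi.smul_apply] at h2 ⊢
    rw [h2, smul_comm]
  · simp [SobolevData.term, S.φ_eq_zero j hx]

variable [CompactSpace M] [MeasurableSpace M] [BorelSpace M] (μ : Measure M) [IsFiniteMeasure μ]

theorem SobolevData.term_memLp (u : Sec n m E) : MemLp (S.term j α u) 2 μ :=
  (S.term_continuous j α u).memLp_of_hasCompactSupport (HasCompactSupport.of_compactSpace _)

/-- `u ↦ φ_j X_j^α u` as a linear map into `L²`. -/
def SobolevData.termL2 : Sec n m E →ₗ[ℂ] Lp (EuclideanSpace ℂ (Fin m)) 2 μ where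
  toFun u := (S.term_memLp j α μ u).toLp _
  map_add' u v := by
    rw [← MemLp.toLp_add]
    exact MemLp.toLp_congr _ _ (by rw [S.term_add])
  map_smul' c u := by
    rw [RingHom.id_apply, ← MemLp.toLp_const_smul]
    exact MemLp.toLp_congr _ _ (by rw [S.term_smul])

variable [Fintype J]

/-- The tuple of all `φ_j X_j^α u` with `‖α‖ ≤ d`, in the Hilbert sum of copies of `L²`. -/
def SobolevData.jet : Sec n m E →ₗ[ℂ]
    PiLp 2 (fun _ : J × multiIdx n p d => Lp (EuclideanSpace ℂ (Fin m)) 2 μ) :=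
  (WithLp.linearEquiv 2 ℂ (J × multiIdx n p d → Lp (EuclideanSpace ℂ (Fin m)) 2 μ)).symm.toLinearMap
    ∘ₗ LinearMap.pi fun jα => S.termL2 jα.1 jα.2 μ

/-- `C^∞(E)` with the norm `‖u‖² = ∑_j ∑_{‖α‖ ≤ d} ‖φ_j X_j^α u‖²_{L²}`. -/
def SobolevPre (_S : SobolevData n m p E H J) (_d : ℕ) (_μ : Measure M) : Type _ := Sec n m E

instance : AddCommGroup (SobolevPre S d μ) := inferInstanceAs (AddCommGroup (Sec n m E))
instance : Module ℂ (SobolevPre S d μ) := inferInstanceAs (Module ℂ (Sec n m E))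

instance : SeminormedAddCommGroup (SobolevPre S d μ) :=
  SeminormedAddCommGroup.induced (SobolevPre S d μ) _ (S.jet d μ)

instance : NormedSpace ℂ (SobolevPre S d μ) :=
  NormedSpace.induced ℂ (SobolevPre S d μ) _ (S.jet d μ)

theorem SobolevPre.norm_sq (u : Sec n m E) :
    ‖(show SobolevPre S d μ from u)‖ ^ 2 =
      ∑ j, ∑ α ∈ multiIdx n p d, (eLpNorm (S.term j α u) 2 μ).toReal ^ 2 := by
  change ‖S.jet d μ u‖ ^ 2 = _
  rw [PiLp.norm_sq_eq_of_L2, Fintype.sum_prod_type]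
  refine Finset.sum_congr rfl fun j _ => ?_
  rw [← Finset.sum_coe_sort (multiIdx n p d) fun α => (eLpNorm (S.term j α u) 2 μ).toReal ^ 2]
  refine Finset.sum_congr rfl fun α _ => ?_
  exact congrArg (· ^ 2) (Lp.norm_toLp _ (S.term_memLp j α μ u))

/-- The weighted Sobolev space `W^d`: the completion of `C^∞(E)` in the weighted Sobolev norm. -/
abbrev SobolevSpace : Type _ := UniformSpace.Completion (SobolevPre S d μ)

/-- The canonical map `C^∞(E) → W^d`. -/
def toSobolev (u : Sec n m E) : SobolevSpace d S μ :=
  ((show SobolevPre S d μ from u) : UniformSpace.Completion (SobolevPre S d μ))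

end norm

end Sobolev

end FoliatedSobolev

end

/-! Three facts about smooth sections carry the theorem: the a-priori estimate ‖u‖_{W^d} ≤ C (‖Pu‖ +
‖u‖) (`exists_apriori_estimate`), the bound ‖Au‖ ≤ C ‖u‖_{W^d} for every `A` of weighted order ≤ d
(`IsDiffOp.exists_bound`), and the closability of differential operators, by testing against smooth
functions (`IsDiffOp.eq_zero_of_approx`). The second fact extends the identity and `P` to bounded
maps ι and P' on W^d. By the first, (ι, P') is bounded below on W^d, so its range is closed and
equals the closure of the graph of `P`. Closability excludes points (0, b) with b ≠ 0 from this
closure; hence it is the graph of P̄, ι is injective, and its range is the domain of P̄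
(`closure_of_estimate`). The estimate for `A` is then boundedness of `A` followed by the a-priori
estimate on the completion.

The a-priori estimate is elliptic regularity for the dilations that scale the last coordinates
quadratically. The frozen symbol is homogeneous of degree d, so compactness of a unit sphere gives
|σ(ξ)v| ≥ c |ξ|^d |v| in a homogeneous norm (`exists_constSymbol_bound`). Plancherel converts this
into bounds for derivatives of order ≤ d, and, with an arbitrarily small factor in front of the
operator term, for those of order ≤ d - 1. On small balls the variation of the top coefficients and
the lower-order terms are absorbed (`local_elliptic`). Cutting off costs a commutator of order d - 1
(`interior_estimate`). After transport to `M` and a finite covering, the order d - 1 terms occur on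
the right with a factor as small as desired and are absorbed.

All this needs jets in coordinates and jets in the given frames to be comparable. Operators are
written as sums of coefficients times words in vector fields. Reordering a word produces brackets,
and a bracket replaces two letters of total weight at least 2 by one letter of weight at most 2: the
weight does not grow and the length drops, so every word is bounded by ordered monomials of no
greater weight (`DOp.perm`, `DOp.bound`). Changes of frame preserve weights because the first p
fields span `H` on both sides (`DOp.frameChange`). -/

noncomputable section

set_option linter.unusedSectionVars false

namespace FoliatedSobolev

open MeasureTheory Set Bundle

/-! ### Words in vector fields on open subsets of `ℝⁿ` -/

section Words

variable {n : ℕ} {V : Type*} [NormedAddCommGroup V] [NormedSpace ℝ V]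

/-- The derivative of `f` along the vector field `Z` on `ℝⁿ`. -/
def dirDeriv (Z : EuclideanSpace ℝ (Fin n) → EuclideanSpace ℝ (Fin n))
    (f : EuclideanSpace ℝ (Fin n) → V) : EuclideanSpace ℝ (Fin n) → V :=
  fun y => fderiv ℝ f y (Z y)

/-- The composition of the derivatives along the fields `X i`, `i` running through the word `w`. -/
def wordOp (X : Fin n → EuclideanSpace ℝ (Fin n) → EuclideanSpace ℝ (Fin n)) (w : List (Fin n))
    (f : EuclideanSpace ℝ (Fin n) → V) : EuclideanSpace ℝ (Fin n) → V :=
  w.foldr (fun i g => dirDeriv (X i) g) f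

/-- The weight of a letter. -/
def letterWeight {n : ℕ} (p : ℕ) (i : Fin n) : ℕ := if (i : ℕ) < p then 1 else 2

/-- The weight of a word. -/
def wordWeight {n : ℕ} (p : ℕ) (w : List (Fin n)) : ℕ := (w.map (letterWeight p)).sum

theorem one_le_letterWeight (p : ℕ) (i : Fin n) : 1 ≤ letterWeight p i := by
  unfold letterWeight; split_ifs <;> omega

theorem letterWeight_le_two (p : ℕ) (i : Fin n) : letterWeight p i ≤ 2 := by
  unfold letterWeight; split_ifs <;> omega

@[simp] theorem wordWeight_cons (p : ℕ) (i : Fin n) (w : List (Fin n)) :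
    wordWeight p (i :: w) = letterWeight p i + wordWeight p w := by
  simp [wordWeight]

@[simp] theorem wordWeight_nil (p : ℕ) : wordWeight p ([] : List (Fin n)) = 0 := rfl

variable {U : Set (EuclideanSpace ℝ (Fin n))}

theorem dirDeriv_congr (hU : IsOpen U) (Z : EuclideanSpace ℝ (Fin n) → EuclideanSpace ℝ (Fin n))
    {f g : EuclideanSpace ℝ (Fin n) → V} (h : EqOn f g U) : EqOn (dirDeriv Z f) (dirDeriv Z g) U := by
  intro y hy
  have : f =ᶠ[𝓝 y] g := Filter.eventuallyEq_of_mem (hU.mem_nhds hy) h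
  simp only [dirDeriv, this.fderiv_eq]

theorem dirDeriv_contDiffOn (hU : IsOpen U)
    {Z : EuclideanSpace ℝ (Fin n) → EuclideanSpace ℝ (Fin n)}
    (hZ : ContDiffOn ℝ ∞ Z U) {f : EuclideanSpace ℝ (Fin n) → V} (hf : ContDiffOn ℝ ∞ f U) :
    ContDiffOn ℝ ∞ (dirDeriv Z f) U :=
  (hf.fderiv_of_isOpen hU (by simp)).clm_apply hZ

theorem differentiableAt_of_contDiffOn (hU : IsOpen U) {f : EuclideanSpace ℝ (Fin n) → V}
    (hf : ContDiffOn ℝ ∞ f U) {y : EuclideanSpace ℝ (Fin n)} (hy : y ∈ U) :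
    DifferentiableAt ℝ f y :=
  (hf.contDiffAt (hU.mem_nhds hy)).differentiableAt (by simp)

theorem wordOp_contDiffOn (hU : IsOpen U)
    {X : Fin n → EuclideanSpace ℝ (Fin n) → EuclideanSpace ℝ (Fin n)}
    (hX : ∀ i, ContDiffOn ℝ ∞ (X i) U) (w : List (Fin n)) {f : EuclideanSpace ℝ (Fin n) → V}
    (hf : ContDiffOn ℝ ∞ f U) : ContDiffOn ℝ ∞ (wordOp X w f) U := by
  induction w with
  | nil => exact hf
  | cons i w ih => exact dirDeriv_contDiffOn hU (hX i) ih

theorem wordOp_congr (hU : IsOpen U)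
    (X : Fin n → EuclideanSpace ℝ (Fin n) → EuclideanSpace ℝ (Fin n)) (w : List (Fin n))
    {f g : EuclideanSpace ℝ (Fin n) → V} (h : EqOn f g U) :
    EqOn (wordOp X w f) (wordOp X w g) U := by
  induction w with
  | nil => exact h
  | cons i w ih => exact dirDeriv_congr hU (X i) ih

/-- The word `1⋯1 2⋯2 ⋯ n⋯n` in which the letter `i` occurs `α i` times. -/
def sortedWord (α : Fin n → ℕ) : List (Fin n) :=
  (List.finRange n).flatMap fun i => List.replicate (α i) i

/-- Words can be permuted and built letter by letter, which tuples of exponents do not allow. This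
passes from the ordered monomials in the definitions of differential operators and of W^d to words.
-/
theorem monomialOp_eq_foldr {W : Type*} (D : Fin n → W → W) (α : Fin n → ℕ) (x : W) :
    monomialOp D α x = (sortedWord α).foldr (fun i v => D i v) x := by
  have h1 : ∀ (i : Fin n) (k : ℕ) (x : W),
      (D i)^[k] x = (List.replicate k i).foldr (fun i v => D i v) x := by
    intro i k x
    induction k with
    | zero => rfl
    | succ k ih => rw [Function.iterate_succ_apply', ih, List.replicate_succ, List.foldr_cons]
  have h2 : ∀ l : List (Fin n), l.foldr (fun i v => (D i)^[α i] v) x =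
      (l.flatMap fun i => List.replicate (α i) i).foldr (fun i v => D i v) x := by
    intro l
    induction l with
    | nil => rfl
    | cons i l ih => rw [List.foldr_cons, ih, List.flatMap_cons, List.foldr_append, h1]
  exact h2 _

/-- The coordinate vector fields. -/
def coordField (i : Fin n) : EuclideanSpace ℝ (Fin n) → EuclideanSpace ℝ (Fin n) :=
  fun _ => EuclideanSpace.single i 1

theorem monomialOp_partialDeriv (α : Fin n → ℕ) (f : EuclideanSpace ℝ (Fin n) → V) :
    monomialOp partialDeriv α f = wordOp coordField (sortedWord α) f :=
  monomialOp_eq_foldr _ α f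

theorem coordField_contDiffOn (i : Fin n) : ContDiffOn ℝ ∞ (coordField i) U :=
  contDiffOn_const

theorem count_sortedWord (α : Fin n → ℕ) (i : Fin n) : (sortedWord α).count i = α i := by
  have : ∀ l : List (Fin n), l.Nodup →
      (l.flatMap fun i => List.replicate (α i) i).count i = if i ∈ l then α i else 0 := by
    intro l hl
    induction l with
    | nil => simp
    | cons j l ih =>
      rw [List.nodup_cons] at hl
      rw [List.flatMap_cons, List.count_append, ih hl.2, List.count_replicate]
      by_cases hij : j = i
      · subst hij; simp [hl.1]
      · have : i ≠ j := fun h => hij h.symm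
        simp [hij, this]
  rw [sortedWord, this _ (List.nodup_finRange n), if_pos (List.mem_finRange i)]

/-- Normal ordering: together with `weight_count`, every word is a permutation of an ordered
monomial of the same weight. -/
theorem sortedWord_perm (w : List (Fin n)) : (sortedWord fun i => w.count i).Perm w := by
  rw [List.perm_iff_count]
  exact fun i => count_sortedWord _ i

theorem wordWeight_perm (p : ℕ) {w w' : List (Fin n)} (h : w.Perm w') :
    wordWeight p w = wordWeight p w' :=
  (h.map _).sum_eq

theorem weight_count (p : ℕ) (w : List (Fin n)) :
    weight p (fun i => w.count i) = wordWeight p w := by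
  induction w with
  | nil => simp [weight]
  | cons j w ih =>
    rw [wordWeight_cons, ← ih]
    unfold weight
    have : ∀ i : Fin n, (if (i : ℕ) < p then 1 else 2) * (j :: w).count i =
        (if i = j then letterWeight p j else 0) + (if (i : ℕ) < p then 1 else 2) * w.count i := by
      intro i
      rw [List.count_cons]
      by_cases hij : i = j
      · subst hij
        simp only [BEq.rfl, if_true, letterWeight]
        ring
      · have : ¬ (j == i) = true := by simpa using fun h : j = i => hij h.symm
        simp [hij, this]
    rw [Finset.sum_congr rfl fun i _ => this i, Finset.sum_add_distrib]
    simp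

theorem wordWeight_sortedWord (p : ℕ) (α : Fin n → ℕ) : wordWeight p (sortedWord α) = weight p α := by
  rw [← weight_count]
  congr 1
  funext i
  exact count_sortedWord α i

/-! ### Operators filtered by word length and by weight -/

/-- Operators that on smooth functions on `U` are finite sums of terms `c ∘ X^w`, where `c` is a
smooth operator-valued coefficient and the word `w` has length `< r` and weight `< k`. -/
inductive DOp (p : ℕ) (U : Set (EuclideanSpace ℝ (Fin n)))
    (X : Fin n → EuclideanSpace ℝ (Fin n) → EuclideanSpace ℝ (Fin n)) (r k : ℕ) :
    ((EuclideanSpace ℝ (Fin n) → V) → EuclideanSpace ℝ (Fin n) → V) → Prop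
  | zero (T) (hT : ∀ f, ContDiffOn ℝ ∞ f U → EqOn (T f) 0 U) : DOp p U X r k T
  | add (T T') (c : EuclideanSpace ℝ (Fin n) → V →L[ℝ] V) (w : List (Fin n)) (hw : w.length < r)
      (hk : wordWeight p w < k) (hc : ContDiffOn ℝ ∞ c U) (hT' : DOp p U X r k T')
      (hT : ∀ f, ContDiffOn ℝ ∞ f U → ∀ y ∈ U, T f y = c y (wordOp X w f y) + T' f y) :
      DOp p U X r k T

namespace DOp

variable {p : ℕ} {X : Fin n → EuclideanSpace ℝ (Fin n) → EuclideanSpace ℝ (Fin n)} {r k : ℕ}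
  {T T' : (EuclideanSpace ℝ (Fin n) → V) → EuclideanSpace ℝ (Fin n) → V}

theorem congr (h : DOp p U X r k T) (hT : ∀ f, ContDiffOn ℝ ∞ f U → EqOn (T' f) (T f) U) :
    DOp p U X r k T' := by
  cases h with
  | zero _ h0 => exact zero _ fun f hf => (hT f hf).trans (h0 f hf)
  | add _ T₁ c w hw hk hc h1 h2 =>
    exact add _ T₁ c w hw hk hc h1 fun f hf y hy => (hT f hf hy).trans (h2 f hf y hy)

theorem mono {r' k' : ℕ} (hr : r ≤ r') (hk : k ≤ k') (h : DOp p U X r k T) :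
    DOp p U X r' k' T := by
  induction h with
  | zero _ h0 => exact zero _ h0
  | add _ T₁ c w hw hk hc h1 h2 ih =>
    exact add _ T₁ c w (by omega) (by omega) hc ih h2

theorem plus (h : DOp p U X r k T) (h' : DOp p U X r k T') :
    DOp p U X r k fun f => T f + T' f := by
  induction h with
  | zero _ h0 => exact h'.congr fun f hf y hy => by simp [h0 f hf hy]
  | add _ T₁ c w hw hk hc h1 h2 ih =>
    exact add _ _ c w hw hk hc ih fun f hf y hy => by simp [h2 f hf y hy, add_assoc]

theorem finsetSum {ι : Type*} (s : Finset ι)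
    {T : ι → (EuclideanSpace ℝ (Fin n) → V) → EuclideanSpace ℝ (Fin n) → V}
    (h : ∀ i ∈ s, DOp p U X r k (T i)) : DOp p U X r k fun f => ∑ i ∈ s, T i f := by
  classical
  induction s using Finset.induction_on with
  | empty => exact zero _ fun f _ y _ => by simp
  | insert a s ha ih =>
    refine ((h a (by simp)).plus (ih fun i hi => h i (by simp [hi]))).congr fun f _ y _ => ?_
    rw [Finset.sum_insert ha]

theorem coeff (h : DOp p U X r k T) {b : EuclideanSpace ℝ (Fin n) → V →L[ℝ] V}
    (hb : ContDiffOn ℝ ∞ b U) : DOp p U X r k fun f y => b y (T f y) := by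
  induction h with
  | zero _ h0 => exact zero _ fun f hf y hy => by simp [h0 f hf hy]
  | add _ T₁ c w hw hk hc h1 h2 ih =>
    exact add _ _ (fun y => (b y).comp (c y)) w hw hk (hb.clm_comp hc) ih
      fun f hf y hy => by simp [h2 f hf y hy]

theorem smul (h : DOp p U X r k T) {b : EuclideanSpace ℝ (Fin n) → ℝ}
    (hb : ContDiffOn ℝ ∞ b U) : DOp p U X r k fun f y => b y • T f y :=
  (h.coeff (b := fun y => b y • ContinuousLinearMap.id ℝ V) (hb.smul contDiffOn_const)).congr
    fun f _ y _ => by simp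

theorem word (w : List (Fin n)) : DOp (V := V) p U X (w.length + 1) (wordWeight p w + 1) (wordOp X w) :=
  add _ (fun _ => 0) (fun _ => ContinuousLinearMap.id ℝ V) w (by omega) (by omega) contDiffOn_const
    (zero _ fun _ _ _ _ => rfl) fun f _ y _ => by simp

theorem smooth (hU : IsOpen U) (hX : ∀ i, ContDiffOn ℝ ∞ (X i) U) (h : DOp p U X r k T)
    {f : EuclideanSpace ℝ (Fin n) → V} (hf : ContDiffOn ℝ ∞ f U) : ContDiffOn ℝ ∞ (T f) U := by
  induction h with
  | zero _ h0 => exact contDiffOn_const.congr (h0 f hf)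
  | add _ T₁ c w hw hk hc h1 h2 ih =>
    exact ((hc.clm_apply (wordOp_contDiffOn hU hX w hf)).add ih).congr (h2 f hf)

/-- The Leibniz rule: the new derivative either lengthens the word or falls on the coefficient, and
only the first alternative uses the extra length and weight. -/
theorem deriv (hU : IsOpen U) (hX : ∀ i, ContDiffOn ℝ ∞ (X i) U) (i : Fin n)
    (h : DOp p U X r k T) :
    DOp p U X (r + 1) (k + letterWeight p i) fun f => dirDeriv (X i) (T f) := by
  induction h with
  | zero _ h0 =>
    refine zero _ fun f hf => (dirDeriv_congr hU _ (h0 f hf)).trans fun y _ => ?_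
    simp [dirDeriv]
  | add _ T₁ c w hw hk hc h1 h2 ih =>
    have e1 := add (p := p) (U := U) (X := X) (r := r + 1) (k := k + letterWeight p i) _ _ c (i :: w)
      (by simpa using hw) (by rw [wordWeight_cons]; omega) hc ih (fun f _ y _ => rfl)
    refine add _ _ (dirDeriv (X i) c) w (by omega) (by omega) (dirDeriv_contDiffOn hU (hX i) hc)
      e1 fun f hf y hy => ?_
    rw [dirDeriv_congr hU (X i) (h2 f hf) hy]
    have d1 := differentiableAt_of_contDiffOn hU hc hy
    have d2 := differentiableAt_of_contDiffOn hU (wordOp_contDiffOn hU hX w hf) hy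
    have d3 := differentiableAt_of_contDiffOn hU (smooth hU hX h1 hf) hy
    have d4 := differentiableAt_of_contDiffOn hU (hc.clm_apply (wordOp_contDiffOn hU hX w hf)) hy
    simp only [dirDeriv]
    rw [fderiv_fun_add d4 d3, fderiv_clm_apply d1 d2]
    simp only [_root_.add_apply, ContinuousLinearMap.comp_apply,
      ContinuousLinearMap.flip_apply]
    change _ = (fderiv ℝ c y) (X i y) _ + (c y (fderiv ℝ (wordOp X w f) y (X i y)) + _)
    abel

/-- The hypothesis on brackets: `[X i, X j]` is a combination of the fields `X l`. -/
def _root_.FoliatedSobolev.HasBrackets (V : Type*) [NormedAddCommGroup V] [NormedSpace ℝ V]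
    (U : Set (EuclideanSpace ℝ (Fin n)))
    (X : Fin n → EuclideanSpace ℝ (Fin n) → EuclideanSpace ℝ (Fin n)) : Prop :=
  ∀ i j, ∃ b : Fin n → EuclideanSpace ℝ (Fin n) → ℝ, (∀ l, ContDiffOn ℝ ∞ (b l) U) ∧
    ∀ f : EuclideanSpace ℝ (Fin n) → V, ContDiffOn ℝ ∞ f U → ∀ y ∈ U,
      dirDeriv (X i) (dirDeriv (X j) f) y - dirDeriv (X j) (dirDeriv (X i) f) y =
        ∑ l, b l y • dirDeriv (X l) f y

/-- An adjacent transposition produces a bracket, that is, a combination of single letters. Any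
letter has weight at most 2 and the two letters that it replaces have weight at least 1 each, so the
weight does not increase although nothing is assumed on which fields occur in the bracket. The
length strictly decreases, which is what `bound` recurs on. -/
theorem perm (hU : IsOpen U) (hX : ∀ i, ContDiffOn ℝ ∞ (X i) U) (hb : HasBrackets V U X)
    {w w' : List (Fin n)} (h : w.Perm w') :
    DOp (V := V) p U X w.length (wordWeight p w + 1) fun f => wordOp X w f - wordOp X w' f := by
  induction h with
  | nil => exact zero _ fun f _ y _ => by simp
  | @cons i w w' h ih =>
    refine ((ih.deriv hU hX i).mono (by simp) (by simp; omega)).congr fun f hf y hy => ?_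
    simp only [dirDeriv, wordOp, List.foldr_cons, Pi.sub_apply]
    have d1 := differentiableAt_of_contDiffOn hU (wordOp_contDiffOn hU hX w hf) hy
    have d2 := differentiableAt_of_contDiffOn hU (wordOp_contDiffOn hU hX w' hf) hy
    have := fderiv_sub d1 d2
    simp only [wordOp] at this
    rw [this]
    rfl
  | @swap i j w =>
    obtain ⟨b, hb1, hb2⟩ := hb j i
    have h1 : DOp (V := V) p U X (w.length + 2) (wordWeight p w + 3)
        fun f => ∑ l, fun y => b l y • wordOp X (l :: w) f y := by
      refine finsetSum _ fun l _ => ?_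
      have := letterWeight_le_two p l
      exact ((word (V := V) (l :: w)).smul (hb1 l)).mono (by simp) (by simp; omega)
    have o1 := one_le_letterWeight p i
    have o2 := one_le_letterWeight p j
    refine (h1.mono (by simp) (by simp; omega)).congr fun f hf y hy => ?_
    have := hb2 _ (wordOp_contDiffOn hU hX w hf) y hy
    simp only [Finset.sum_apply]
    exact this
  | @trans w₁ w₂ w₃ h1 h2 ih1 ih2 =>
    -- Both differences must carry the same bounds to be added; length and weight are invariant
    -- under permutation.
    rw [← wordWeight_perm p h1, ← h1.length_eq] at ih2
    exact (ih1.plus ih2).congr fun f _ y _ => by simp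

/-- An operator of weighted order `≤ k` is bounded, locally, by the ordered monomials. -/
theorem bound (hU : IsOpen U) (hX : ∀ i, ContDiffOn ℝ ∞ (X i) U) (hb : HasBrackets V U X)
    (h : DOp p U X r (k + 1) T) {y₀ : EuclideanSpace ℝ (Fin n)} (hy₀ : y₀ ∈ U) :
    ∃ N ∈ 𝓝 y₀, ∃ C : ℝ, 0 ≤ C ∧ ∀ f, ContDiffOn ℝ ∞ f U → ∀ y ∈ N,
      ‖T f y‖ ≤ C * ∑ α ∈ multiIdx n p k, ‖wordOp X (sortedWord α) f y‖ := by
  -- The induction is on the length bound: reordering need not lower the weight, but always lowers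
  -- the length.
  induction r generalizing T with
  | zero =>
    cases h with
    | zero _ h0 =>
      exact ⟨U, hU.mem_nhds hy₀, 0, le_rfl, fun f hf y hy => by simp [h0 f hf hy]⟩
    | add _ T₁ c w hw => exact absurd hw (by omega)
  | succ r ihr =>
    have hword : ∀ w : List (Fin n), w.length < r + 1 → wordWeight p w < k + 1 →
        ∃ N ∈ 𝓝 y₀, ∃ C : ℝ, 0 ≤ C ∧ ∀ f : EuclideanSpace ℝ (Fin n) → V, ContDiffOn ℝ ∞ f U →
          ∀ y ∈ N, ‖wordOp X w f y‖ ≤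
            C * ∑ α ∈ multiIdx n p k, ‖wordOp X (sortedWord α) f y‖ := by
      intro w hw hk
      -- The ordered word is one of the monomials on the right; the difference from it consists of
      -- shorter words and falls under the induction hypothesis.
      have h1 := perm (p := p) hU hX hb (sortedWord_perm w).symm
      obtain ⟨N, hN, C, hC, hT⟩ := ihr (h1.mono (by omega) (by omega))
      refine ⟨N, hN, C + 1, by positivity, fun f hf y hy => ?_⟩
      have h2 := hT f hf y hy
      have h3 : ‖wordOp X (sortedWord fun i => w.count i) f y‖ ≤
          ∑ α ∈ multiIdx n p k, ‖wordOp X (sortedWord α) f y‖ :=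
        Finset.single_le_sum (f := fun α => ‖wordOp X (sortedWord α) f y‖)
          (fun _ _ => norm_nonneg _) (mem_multiIdx.2 (by rw [weight_count]; omega))
      have h4 := norm_add_le (wordOp X w f y - wordOp X (sortedWord fun i => w.count i) f y)
        (wordOp X (sortedWord fun i => w.count i) f y)
      rw [sub_add_cancel] at h4
      simp only [Pi.sub_apply] at h2
      linarith
    clear ihr
    induction h with
    | zero _ h0 =>
      exact ⟨U, hU.mem_nhds hy₀, 0, le_rfl, fun f hf y hy => by simp [h0 f hf hy]⟩
    | add _ T₁ c w hw hk hc h1 h2 ih =>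
      obtain ⟨N₁, hN₁, C₁, hC₁, hT₁⟩ := ih
      obtain ⟨N₂, hN₂, C₂, hC₂, hT₂⟩ := hword w hw hk
      have hcc : ContinuousAt (fun y => ‖c y‖) y₀ :=
        (hc.continuousOn.continuousAt (hU.mem_nhds hy₀)).norm
      have hN₃ : {y | ‖c y‖ < ‖c y₀‖ + 1} ∈ 𝓝 y₀ :=
        hcc.eventually_lt continuousAt_const (by simp)
      refine ⟨N₁ ∩ N₂ ∩ {y | ‖c y‖ < ‖c y₀‖ + 1} ∩ U, Filter.inter_mem (Filter.inter_mem
        (Filter.inter_mem hN₁ hN₂) hN₃) (hU.mem_nhds hy₀), (‖c y₀‖ + 1) * C₂ + C₁, by positivity,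
        fun f hf y hy => ?_⟩
      rw [h2 f hf y hy.2]
      have e1 := hT₁ f hf y hy.1.1.1
      have e2 := hT₂ f hf y hy.1.1.2
      have e3 : ‖c y‖ < ‖c y₀‖ + 1 := hy.1.2
      calc ‖c y (wordOp X w f y) + T₁ f y‖ ≤ ‖c y‖ * ‖wordOp X w f y‖ + ‖T₁ f y‖ :=
            (norm_add_le _ _).trans (by gcongr; exact (c y).le_opNorm _)
        _ ≤ (‖c y₀‖ + 1) * (C₂ * ∑ α ∈ multiIdx n p k, ‖wordOp X (sortedWord α) f y‖) +
            C₁ * ∑ α ∈ multiIdx n p k, ‖wordOp X (sortedWord α) f y‖ := by gcongr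
        _ = _ := by ring

/-- Words in a second frame `Y`, composed with multiplication by a smooth matrix function. -/
theorem frameChange (hU : IsOpen U) (hX : ∀ i, ContDiffOn ℝ ∞ (X i) U)
    {Y : Fin n → EuclideanSpace ℝ (Fin n) → EuclideanSpace ℝ (Fin n)}
    {b : Fin n → Fin n → EuclideanSpace ℝ (Fin n) → ℝ} (hb : ∀ i j, ContDiffOn ℝ ∞ (b i j) U)
    (hb0 : ∀ i j, letterWeight p i < letterWeight p j → ∀ y ∈ U, b i j y = 0)
    (hY : ∀ i, ∀ y ∈ U, Y i y = ∑ j, b i j y • X j y)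
    {g : EuclideanSpace ℝ (Fin n) → V →L[ℝ] V} (hg : ContDiffOn ℝ ∞ g U) (w : List (Fin n)) :
    DOp p U X (w.length + 1) (wordWeight p w + 1) fun f => wordOp Y w fun y => g y (f y) := by
  induction w with
  | nil => exact (word (V := V) []).coeff hg
  | cons i w ih =>
    have h1 : DOp (V := V) p U X (w.length + 1 + 1) (wordWeight p w + 1 + letterWeight p i)
        fun f => ∑ j, fun y => b i j y • dirDeriv (X j) (wordOp Y w fun y => g y (f y)) y := by
      refine finsetSum _ fun j _ => ?_
      -- The coefficients that would replace a letter by a heavier one vanish; the remaining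
      -- replacements do not raise the weight.
      by_cases hij : letterWeight p i < letterWeight p j
      · exact zero _ fun f _ y hy => by simp [hb0 i j hij y hy]
      · exact ((ih.deriv hU hX j).smul (hb i j)).mono le_rfl (by omega)
    refine (h1.mono (by simp) (by simp; omega)).congr fun f hf y hy => ?_
    rw [Finset.sum_apply]
    change fderiv ℝ (wordOp Y w fun y => g y (f y)) y (Y i y) = _
    rw [hY i y hy, map_sum]
    simp [dirDeriv]

/-- The commutator of a word with multiplication by a smooth function has lower order. -/
theorem commutator (hU : IsOpen U) (hX : ∀ i, ContDiffOn ℝ ∞ (X i) U)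
    {χ : EuclideanSpace ℝ (Fin n) → ℝ} (hχ : ContDiffOn ℝ ∞ χ U) (w : List (Fin n)) :
    DOp (V := V) p U X w.length (wordWeight p w)
      fun f y => wordOp X w (fun z => χ z • f z) y - χ y • wordOp X w f y := by
  induction w with
  | nil => exact zero _ fun f _ y _ => by simp [wordOp]
  | cons i w ih =>
    have o1 := one_le_letterWeight p i
    -- With w the tail of the word, [X_i X^w, χ] = X_i [X^w, χ] + (X_i χ) X^w. The second term has
    -- lost a letter, of weight at least 1; the first has lost it by induction.
    have h1 := (ih.deriv hU hX i).mono (p := p) (r' := w.length + 1) (k' := wordWeight p (i :: w))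
      (by omega) (by rw [wordWeight_cons]; omega)
    have h2 := ((word (V := V) (p := p) (U := U) (X := X) w).smul
      (dirDeriv_contDiffOn hU (hX i) hχ)).mono (p := p) (r' := w.length + 1)
      (k' := wordWeight p (i :: w)) (by omega) (by rw [wordWeight_cons]; omega)
    refine (h1.plus h2).congr fun f hf y hy => ?_
    have s1 := wordOp_contDiffOn hU hX w hf
    have s2 : ContDiffOn ℝ ∞ (wordOp X w fun z => χ z • f z) U :=
      wordOp_contDiffOn hU hX w (hχ.smul hf)
    have d1 := differentiableAt_of_contDiffOn hU s1 hy
    have d2 := differentiableAt_of_contDiffOn hU s2 hy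
    have d3 := differentiableAt_of_contDiffOn hU hχ hy
    simp only [Pi.add_apply, dirDeriv]
    change fderiv ℝ (wordOp X w fun z => χ z • f z) y (X i y) -
      χ y • fderiv ℝ (wordOp X w f) y (X i y) = _
    rw [fderiv_fun_sub d2 (d3.fun_smul d1), fderiv_fun_smul d3 d1]
    simp only [_root_.sub_apply, _root_.add_apply, _root_.smul_apply,
      ContinuousLinearMap.smulRight_apply]
    abel

end DOp

end Words

/-! ### Adapted frames -/

/-- The index `i` is meant to run over the functions being estimated: near each point one constant
serves all of them, and finitely many such neighbourhoods cover `K`. -/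
theorem exists_uniform_bound {Y ι : Type*} [TopologicalSpace Y] {K : Set Y} (hK : IsCompact K)
    {l r : ι → Y → ℝ} (hr : ∀ i y, 0 ≤ r i y)
    (h : ∀ x ∈ K, ∃ N ∈ 𝓝 x, ∃ C : ℝ, 0 ≤ C ∧ ∀ i, ∀ y ∈ N, l i y ≤ C * r i y) :
    ∃ C : ℝ, 0 ≤ C ∧ ∀ i, ∀ y ∈ K, l i y ≤ C * r i y := by
  refine hK.induction_on (p := fun s => ∃ C : ℝ, 0 ≤ C ∧ ∀ i, ∀ y ∈ s, l i y ≤ C * r i y)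
    ⟨0, le_rfl, by simp⟩ ?_ ?_ ?_
  · rintro s t hst ⟨C, hC, h⟩
    exact ⟨C, hC, fun i y hy => h i y (hst hy)⟩
  · rintro s t ⟨C, hC, h1⟩ ⟨C', hC', h2⟩
    refine ⟨C + C', by positivity, fun i y hy => ?_⟩
    have := hr i y
    have e1 : 0 ≤ C * r i y := by positivity
    have e2 : 0 ≤ C' * r i y := by positivity
    rw [add_mul]
    rcases hy with hy | hy
    · linarith [h1 i y hy]
    · linarith [h2 i y hy]
  · intro x hx
    obtain ⟨N, hN, C, hC, h⟩ := h x hx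
    exact ⟨N, mem_nhdsWithin_of_mem_nhds hN, C, hC, h⟩

section Frames

variable {n : ℕ}

theorem mem_coordSpan_iff {p : ℕ} {v : EuclideanSpace ℝ (Fin n)} :
    v ∈ coordSpan n p ↔ ∀ j : Fin n, p ≤ (j : ℕ) → v j = 0 := by
  constructor
  · intro hv j hj
    induction hv using Submodule.span_induction with
    | mem x hx =>
      obtain ⟨i, hi, rfl⟩ := hx
      have : j ≠ i := by rintro rfl; omega
      simp [this]
    | zero => simp
    | add x y _ _ hx hy => simp [hx, hy]
    | smul c x _ hx => simp [hx]
  · intro h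
    have : v = ∑ j, v j • EuclideanSpace.single j (1 : ℝ) := by
      ext k
      simp [Finset.sum_apply, Pi.single_apply]
    rw [this]
    refine Submodule.sum_mem _ fun j _ => ?_
    by_cases hj : (j : ℕ) < p
    · exact Submodule.smul_mem _ _ (Submodule.subset_span ⟨j, hj, rfl⟩)
    · rw [h j (by omega), zero_smul]
      exact Submodule.zero_mem _

theorem eq_sum_single (v : EuclideanSpace ℝ (Fin n)) :
    v = ∑ j, v j • EuclideanSpace.single j (1 : ℝ) := by
  ext k
  simp [Finset.sum_apply, Pi.single_apply]

/-- A smooth frame on `U` whose first `p` members lie in the span of the first `p` coordinate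
vectors. -/
structure AdaptedFrame (p : ℕ) (U : Set (EuclideanSpace ℝ (Fin n)))
    (X : Fin n → EuclideanSpace ℝ (Fin n) → EuclideanSpace ℝ (Fin n)) : Prop where
  smooth : ∀ i, ContDiffOn ℝ ∞ (X i) U
  linearIndependent : ∀ y ∈ U, LinearIndependent ℝ fun i => X i y
  mem : ∀ i : Fin n, (i : ℕ) < p → ∀ y ∈ U, X i y ∈ coordSpan n p

variable {p : ℕ} {U : Set (EuclideanSpace ℝ (Fin n))}
  {X : Fin n → EuclideanSpace ℝ (Fin n) → EuclideanSpace ℝ (Fin n)}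

theorem letterWeight_lt {i j : Fin n} (h : letterWeight p i < letterWeight p j) :
    (i : ℕ) < p ∧ p ≤ (j : ℕ) := by
  unfold letterWeight at h
  split_ifs at h <;> omega

namespace AdaptedFrame

/-- The linear map sending the coordinate vectors to the frame. -/
def frameMap (X : Fin n → EuclideanSpace ℝ (Fin n) → EuclideanSpace ℝ (Fin n))
    (y : EuclideanSpace ℝ (Fin n)) : EuclideanSpace ℝ (Fin n) →L[ℝ] EuclideanSpace ℝ (Fin n) :=
  ∑ j, (EuclideanSpace.proj (𝕜 := ℝ) j : EuclideanSpace ℝ (Fin n) →L[ℝ] ℝ).smulRight (X j y)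

theorem frameMap_apply (y v : EuclideanSpace ℝ (Fin n)) :
    frameMap X y v = ∑ j, v j • X j y := by
  simp [frameMap]

theorem frameMap_isInvertible (h : AdaptedFrame p U X) {y : EuclideanSpace ℝ (Fin n)}
    (hy : y ∈ U) : (frameMap X y).IsInvertible := by
  have hinj : Function.Injective (frameMap X y) := by
    rw [injective_iff_map_eq_zero]
    intro v hv
    rw [frameMap_apply] at hv
    ext j
    exact Fintype.linearIndependent_iff.1 (h.linearIndependent y hy) _ hv j
  have hbij : Function.Bijective (frameMap X y : EuclideanSpace ℝ (Fin n) →ₗ[ℝ] _) :=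
    ⟨hinj, LinearMap.injective_iff_surjective.1 hinj⟩
  exact ⟨(LinearEquiv.ofBijective _ hbij).toContinuousLinearEquiv, by ext v; rfl⟩

/-- The coefficients of the coordinate fields in an adapted frame. -/
def coeff (X : Fin n → EuclideanSpace ℝ (Fin n) → EuclideanSpace ℝ (Fin n)) (i j : Fin n)
    (y : EuclideanSpace ℝ (Fin n)) : ℝ :=
  (frameMap X y).inverse (EuclideanSpace.single i 1) j

/-- Inversion of operators is smooth at invertible ones, and the frame map is smooth and invertible.
-/
theorem coeff_contDiffOn (h : AdaptedFrame p U X) (i j : Fin n) :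
    ContDiffOn ℝ ∞ (coeff X i j) U := by
  have h1 : ContDiffOn ℝ ∞ (frameMap X) U :=
    ContDiffOn.sum fun j _ => contDiffOn_const.smulRight (h.smooth j)
  intro y hy
  obtain ⟨e, he⟩ := h.frameMap_isInvertible hy
  have h2 : ContDiffWithinAt ℝ ∞ (fun y => (frameMap X y).inverse) U y := by
    refine ContDiffAt.comp_contDiffWithinAt (g := ContinuousLinearMap.inverse) y ?_ (h1 y hy)
    rw [← he]
    exact contDiffAt_map_inverse e
  exact (EuclideanSpace.proj (𝕜 := ℝ) j).contDiff.comp_contDiffWithinAt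
    (h2.clm_apply contDiffWithinAt_const)

theorem sum_coeff (h : AdaptedFrame p U X) (i : Fin n) {y : EuclideanSpace ℝ (Fin n)}
    (hy : y ∈ U) : coordField i y = ∑ j, coeff X i j y • X j y := by
  obtain ⟨e, he⟩ := h.frameMap_isInvertible hy
  unfold coeff
  rw [← frameMap_apply, ← he, ContinuousLinearMap.inverse_equiv]
  simp [coordField]

/-- The inverse of a block triangular matrix is block triangular: the frame map sends the span of
the first p coordinate vectors into itself, and by injectivity and equality of dimensions onto
itself, so its inverse preserves that span too. -/
theorem coeff_eq_zero (h : AdaptedFrame p U X) {i j : Fin n} (hi : (i : ℕ) < p) (hj : p ≤ (j : ℕ))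
    {y : EuclideanSpace ℝ (Fin n)} (hy : y ∈ U) : coeff X i j y = 0 := by
  obtain ⟨e, he⟩ := h.frameMap_isInvertible hy
  have h1 : (coordSpan n p).map (frameMap X y : EuclideanSpace ℝ (Fin n) →ₗ[ℝ] _) ≤
      coordSpan n p := by
    rw [coordSpan, Submodule.map_span, ← coordSpan, Submodule.span_le]
    rintro _ ⟨_, ⟨k, hk, rfl⟩, rfl⟩
    have : frameMap X y (EuclideanSpace.single k 1) = X k y := by
      rw [frameMap_apply, Finset.sum_eq_single k] <;> simp +contextual
    change frameMap X y _ ∈ _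
    rw [this]
    exact h.mem k hk y hy
  have hinj : Function.Injective (frameMap X y) := by
    rw [← he]; exact e.injective
  have h2 := Submodule.eq_of_le_of_finrank_eq h1
    (Submodule.equivMapOfInjective _ hinj _).symm.finrank_eq
  have h3 : EuclideanSpace.single i (1 : ℝ) ∈ coordSpan n p := Submodule.subset_span ⟨i, hi, rfl⟩
  rw [← h2] at h3
  obtain ⟨v, hv, hv2⟩ := h3
  have h4 : (frameMap X y).inverse (EuclideanSpace.single i 1) = v := by
    rw [← hv2, ← he, ContinuousLinearMap.inverse_equiv]
    simp
  unfold coeff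
  rw [h4]
  exact mem_coordSpan_iff.1 hv j hj

/-- In the commutator the second derivatives of `f` cancel by symmetry. What remains is the
derivative along the bracket field `z`, which is expanded in coordinate fields and these in the
frame. -/
theorem hasBrackets (V : Type*) [NormedAddCommGroup V] [NormedSpace ℝ V] (hU : IsOpen U)
    (h : AdaptedFrame p U X) : HasBrackets V U X := by
  intro i j
  let z : EuclideanSpace ℝ (Fin n) → EuclideanSpace ℝ (Fin n) := fun y =>
    fderiv ℝ (X j) y (X i y) - fderiv ℝ (X i) y (X j y)
  have hz : ContDiffOn ℝ ∞ z U :=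
    (dirDeriv_contDiffOn hU (h.smooth i) (h.smooth j)).sub
      (dirDeriv_contDiffOn hU (h.smooth j) (h.smooth i))
  have hzl : ∀ l, ContDiffOn ℝ ∞ (fun y => z y l) U := fun l =>
    (EuclideanSpace.proj (𝕜 := ℝ) l).contDiff.comp_contDiffOn hz
  refine ⟨fun k y => ∑ l, z y l * coeff X l k y, fun k => ContDiffOn.sum fun l _ =>
    (hzl l).mul (h.coeff_contDiffOn l k), fun f hf y hy => ?_⟩
  have hfy := hf.contDiffAt (hU.mem_nhds hy)
  have d0 : DifferentiableAt ℝ (fderiv ℝ f) y :=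
    differentiableAt_of_contDiffOn hU (hf.fderiv_of_isOpen hU (m := ∞) (by simp)) hy
  have d1 := differentiableAt_of_contDiffOn hU (h.smooth i) hy
  have d2 := differentiableAt_of_contDiffOn hU (h.smooth j) hy
  have hsymm : IsSymmSndFDerivAt ℝ f y := hfy.isSymmSndFDerivAt (by
    rw [minSmoothness_of_isRCLikeNormedField]
    exact WithTop.coe_le_coe.2 (le_top : (2 : ℕ∞) ≤ ⊤))
  have e1 : ∀ Z W : EuclideanSpace ℝ (Fin n) → EuclideanSpace ℝ (Fin n), DifferentiableAt ℝ W y →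
      dirDeriv Z (dirDeriv W f) y =
        fderiv ℝ f y (fderiv ℝ W y (Z y)) + fderiv ℝ (fderiv ℝ f) y (Z y) (W y) := by
    intro Z W hW
    have : dirDeriv W f = fun y => fderiv ℝ f y (W y) := rfl
    rw [dirDeriv, this, fderiv_clm_apply d0 hW]
    simp
  have e2 : z y = ∑ k, (∑ l, z y l * coeff X l k y) • X k y := by
    conv_lhs => rw [eq_sum_single (z y)]
    simp_rw [Finset.sum_smul]
    rw [Finset.sum_comm]
    refine Finset.sum_congr rfl fun l _ => ?_
    have := h.sum_coeff l hy
    simp only [coordField] at this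
    rw [this, Finset.smul_sum]
    simp [mul_smul]
  rw [e1 _ _ d2, e1 _ _ d1, hsymm.eq (X i y) (X j y), add_sub_add_right_eq_sub, ← map_sub]
  change fderiv ℝ f y (z y) = _
  rw [e2, map_sum]
  simp [dirDeriv]

end AdaptedFrame

theorem adaptedFrame_coordField : AdaptedFrame p U (coordField (n := n)) where
  smooth i := coordField_contDiffOn i
  linearIndependent y _ := by
    rw [Fintype.linearIndependent_iff]
    intro g hg i
    have := congrArg (fun v : EuclideanSpace ℝ (Fin n) => v i) hg
    simpa [coordField, Finset.sum_apply, Pi.single_apply] using this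
  mem i hi y _ := Submodule.subset_span ⟨i, hi, rfl⟩

variable {V : Type*} [NormedAddCommGroup V] [NormedSpace ℝ V]

/-- Ordered monomials in an adapted frame are bounded by partial derivatives. -/
theorem AdaptedFrame.frame_le_coord (hU : IsOpen U) (h : AdaptedFrame p U X)
    {g : EuclideanSpace ℝ (Fin n) → V →L[ℝ] V} (hg : ContDiffOn ℝ ∞ g U) {k : ℕ} {α : Fin n → ℕ}
    (hα : α ∈ multiIdx n p k) {y₀ : EuclideanSpace ℝ (Fin n)} (hy₀ : y₀ ∈ U) :
    ∃ N ∈ 𝓝 y₀, ∃ C : ℝ, 0 ≤ C ∧ ∀ f, ContDiffOn ℝ ∞ f U → ∀ y ∈ N,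
      ‖wordOp X (sortedWord α) (fun y => g y (f y)) y‖ ≤
        C * ∑ β ∈ multiIdx n p k, ‖wordOp coordField (sortedWord β) f y‖ := by
  -- In the coordinate basis the coefficients of the frame are its components; for the first p
  -- fields the components beyond p vanish because the frame is adapted.
  have h1 := DOp.frameChange (p := p) hU (fun i => coordField_contDiffOn (U := U) i)
    (b := fun i j y => X i y j)
    (fun i j => (EuclideanSpace.proj (𝕜 := ℝ) j).contDiff.comp_contDiffOn (h.smooth i))
    (fun i j hij y hy => mem_coordSpan_iff.1 (h.mem i (letterWeight_lt hij).1 y hy) j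
      (letterWeight_lt hij).2) (fun i y _ => eq_sum_single (X i y)) hg (sortedWord α)
  have h2 : wordWeight p (sortedWord α) ≤ k := by
    rw [wordWeight_sortedWord]; exact mem_multiIdx.1 hα
  exact DOp.bound hU (fun i => coordField_contDiffOn i)
    ((adaptedFrame_coordField (p := p)).hasBrackets V hU) (h1.mono le_rfl (by omega)) hy₀

/-- Partial derivatives are bounded by ordered monomials in an adapted frame. -/
theorem AdaptedFrame.coord_le_frame (hU : IsOpen U) (h : AdaptedFrame p U X)
    {g : EuclideanSpace ℝ (Fin n) → V →L[ℝ] V} (hg : ContDiffOn ℝ ∞ g U) {k : ℕ} {α : Fin n → ℕ}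
    (hα : α ∈ multiIdx n p k) {y₀ : EuclideanSpace ℝ (Fin n)} (hy₀ : y₀ ∈ U) :
    ∃ N ∈ 𝓝 y₀, ∃ C : ℝ, 0 ≤ C ∧ ∀ f, ContDiffOn ℝ ∞ f U → ∀ y ∈ N,
      ‖wordOp coordField (sortedWord α) (fun y => g y (f y)) y‖ ≤
        C * ∑ β ∈ multiIdx n p k, ‖wordOp X (sortedWord β) f y‖ := by
  have h1 := DOp.frameChange (p := p) hU h.smooth (b := AdaptedFrame.coeff X)
    h.coeff_contDiffOn (fun i j hij y hy => h.coeff_eq_zero (letterWeight_lt hij).1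
      (letterWeight_lt hij).2 hy) (fun i y hy => h.sum_coeff i hy) hg (sortedWord α)
  have h2 : wordWeight p (sortedWord α) ≤ k := by
    rw [wordWeight_sortedWord]; exact mem_multiIdx.1 hα
  exact DOp.bound hU h.smooth (h.hasBrackets V hU) (h1.mono le_rfl (by omega)) hy₀

/-- The commutator of `∂^α` with multiplication by a smooth function, on compact sets. -/
theorem commutator_bound (hU : IsOpen U) {χ : EuclideanSpace ℝ (Fin n) → ℝ}
    (hχ : ContDiffOn ℝ ∞ χ U) {k : ℕ} {α : Fin n → ℕ} (hα : α ∈ multiIdx n p k)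
    {K : Set (EuclideanSpace ℝ (Fin n))} (hK : IsCompact K) (hKU : K ⊆ U) :
    ∃ C : ℝ, 0 ≤ C ∧ ∀ f : EuclideanSpace ℝ (Fin n) → V, ContDiffOn ℝ ∞ f U → ∀ y ∈ K,
      ‖wordOp coordField (sortedWord α) (fun z => χ z • f z) y -
          χ y • wordOp coordField (sortedWord α) f y‖ ≤
        C * ∑ β ∈ multiIdx n p (k - 1), ‖wordOp coordField (sortedWord β) f y‖ := by
  have h2 : wordWeight p (sortedWord α) ≤ k := by
    rw [wordWeight_sortedWord]; exact mem_multiIdx.1 hα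
  -- `k - 1 + 1` differs from `k` only for `k = 0`, and then the commutator has no terms.
  have h1 := (DOp.commutator (V := V) (p := p) hU (fun i => coordField_contDiffOn (U := U) i) hχ
    (sortedWord α)).mono le_rfl (k' := k - 1 + 1) (by omega)
  obtain ⟨C, hC, h3⟩ := exists_uniform_bound hK
    (ι := {f : EuclideanSpace ℝ (Fin n) → V // ContDiffOn ℝ ∞ f U})
    (l := fun f y => ‖wordOp coordField (sortedWord α) (fun z => χ z • f.1 z) y -
          χ y • wordOp coordField (sortedWord α) f.1 y‖)
    (r := fun f y => ∑ β ∈ multiIdx n p (k - 1), ‖wordOp coordField (sortedWord β) f.1 y‖)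
    (fun f y => Finset.sum_nonneg fun _ _ => norm_nonneg _) (fun x hx => by
      obtain ⟨N, hN, C, hC, h⟩ := DOp.bound hU (fun i => coordField_contDiffOn i)
        ((adaptedFrame_coordField (p := p)).hasBrackets V hU) h1 (hKU hx)
      exact ⟨N, hN, C, hC, fun f => h f.1 f.2⟩)
  exact ⟨C, hC, fun f hf => h3 ⟨f, hf⟩⟩

end Frames

/-! ### Weighted homogeneous symbols -/

section Symbol

variable {n : ℕ} {V : Type*} [NormedAddCommGroup V] [NormedSpace ℂ V]

/-- The symbol `∑_{‖α‖ = d} (iξ)^α b_α` with constant coefficients. -/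
def constSymbol (p d : ℕ) (b : (Fin n → ℕ) → V →L[ℂ] V) (ξ : Fin n → ℝ) : V →L[ℂ] V :=
  ∑ α ∈ (multiIdx n p d).filter (fun α => weight p α = d),
    (∏ i, (Complex.I * (ξ i : ℂ)) ^ α i) • b α

/-- A norm-like function, homogeneous for the weighted dilations. -/
def homNorm (p : ℕ) (ξ : Fin n → ℝ) : ℝ :=
  ∑ i : Fin n, if (i : ℕ) < p then |ξ i| else √|ξ i|

/-- The weighted dilations. -/
def dilate (p : ℕ) (t : ℝ) (ξ : Fin n → ℝ) : Fin n → ℝ := fun i => t ^ letterWeight p i * ξ i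

theorem homNorm_nonneg (p : ℕ) (ξ : Fin n → ℝ) : 0 ≤ homNorm p ξ :=
  Finset.sum_nonneg fun i _ => by split_ifs <;> positivity

theorem continuous_homNorm (p : ℕ) : Continuous (homNorm (n := n) p) := by
  refine continuous_finsetSum _ fun i _ => ?_
  split_ifs
  · fun_prop
  · exact Real.continuous_sqrt.comp (by fun_prop)

theorem homNorm_dilate (p : ℕ) {t : ℝ} (ht : 0 ≤ t) (ξ : Fin n → ℝ) :
    homNorm p (dilate p t ξ) = t * homNorm p ξ := by
  unfold homNorm dilate letterWeight
  rw [Finset.mul_sum]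
  refine Finset.sum_congr rfl fun i _ => ?_
  split_ifs
  · rw [pow_one, abs_mul, abs_of_nonneg ht]
  · rw [abs_mul, abs_of_nonneg (by positivity), Real.sqrt_mul (by positivity), Real.sqrt_sq ht]

/-- Each coordinate is controlled by the power of `homNorm` equal to its weight. This bounds
monomials by their weighted degree and makes the unit sphere of `homNorm` compact. -/
theorem abs_le_homNorm_pow (p : ℕ) (ξ : Fin n → ℝ) (i : Fin n) :
    |ξ i| ≤ homNorm p ξ ^ letterWeight p i := by
  have h := Finset.single_le_sum
    (f := fun i : Fin n => if (i : ℕ) < p then |ξ i| else √|ξ i|)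
    (fun i _ => by split_ifs <;> positivity) (Finset.mem_univ i)
  change _ ≤ homNorm p ξ at h
  unfold letterWeight
  split_ifs with hi
  · simpa [hi] using h
  · simp only [hi, if_false] at h
    calc |ξ i| = √|ξ i| ^ 2 := (Real.sq_sqrt (abs_nonneg _)).symm
      _ ≤ _ := by gcongr

theorem homNorm_pos (p : ℕ) {ξ : Fin n → ℝ} (hξ : ξ ≠ 0) : 0 < homNorm p ξ := by
  refine lt_of_le_of_ne (homNorm_nonneg p ξ) fun h => hξ (funext fun i => ?_)
  have h1 := abs_le_homNorm_pow p ξ i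
  rw [← h, zero_pow (by have := one_le_letterWeight p i; omega)] at h1
  exact abs_eq_zero.1 (le_antisymm h1 (abs_nonneg _))

theorem prod_abs_le_homNorm_pow (p : ℕ) (ξ : Fin n → ℝ) (α : Fin n → ℕ) :
    ∏ i, |ξ i| ^ α i ≤ homNorm p ξ ^ weight p α := by
  calc ∏ i, |ξ i| ^ α i ≤ ∏ i, (homNorm p ξ ^ letterWeight p i) ^ α i := by
        refine Finset.prod_le_prod (fun _ _ => by positivity) fun i _ => ?_
        gcongr
        exact abs_le_homNorm_pow p ξ i
    _ = _ := by
        simp_rw [← pow_mul]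
        rw [Finset.prod_pow_eq_pow_sum]
        rfl

theorem norm_prod_I_mul (ξ : Fin n → ℝ) (α : Fin n → ℕ) :
    ‖∏ i, (Complex.I * (ξ i : ℂ)) ^ α i‖ = ∏ i, |ξ i| ^ α i := by
  simp [norm_prod]

/-- Homogeneity is exact because the symbol contains only multi-indices of weight equal to `d`. -/
theorem constSymbol_dilate (p d : ℕ) (b : (Fin n → ℕ) → V →L[ℂ] V) (t : ℝ) (ξ : Fin n → ℝ) :
    constSymbol p d b (dilate p t ξ) = ((t : ℂ) ^ d) • constSymbol p d b ξ := by
  unfold constSymbol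
  rw [Finset.smul_sum]
  refine Finset.sum_congr rfl fun α hα => ?_
  rw [smul_smul]
  congr 1
  have h1 : (t : ℂ) ^ d = ∏ i, (t : ℂ) ^ (letterWeight p i * α i) := by
    rw [Finset.prod_pow_eq_pow_sum, ← (Finset.mem_filter.1 hα).2]
    rfl
  rw [h1, ← Finset.prod_mul_distrib]
  refine Finset.prod_congr rfl fun i _ => ?_
  simp only [dilate]
  push_cast
  rw [pow_mul, ← mul_pow]
  ring

theorem continuous_constSymbol (p d : ℕ) (b : (Fin n → ℕ) → V →L[ℂ] V) :
    Continuous (constSymbol p d b) := by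
  refine continuous_finsetSum _ fun α _ => ?_
  fun_prop

variable [FiniteDimensional ℂ V]

/-- Ellipticity is quantitative. -/
theorem exists_constSymbol_bound (p d : ℕ) (b : (Fin n → ℕ) → V →L[ℂ] V)
    (hb : ∀ ξ : Fin n → ℝ, ξ ≠ 0 → Function.Bijective (constSymbol p d b ξ)) :
    ∃ c : ℝ, 0 < c ∧ ∀ ξ : Fin n → ℝ, ξ ≠ 0 → ∀ v : V,
      c * homNorm p ξ ^ d * ‖v‖ ≤ ‖constSymbol p d b ξ v‖ := by
  have : ProperSpace V := FiniteDimensional.proper ℂ V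
  let S : Set (Fin n → ℝ) := {ξ | homNorm p ξ = 1}
  have hS : IsCompact S := by
    refine (isCompact_closedBall (0 : Fin n → ℝ) 1).of_isClosed_subset
      (isClosed_eq (continuous_homNorm p) continuous_const) fun ξ hξ => ?_
    rw [mem_closedBall_zero_iff, pi_norm_le_iff_of_nonneg zero_le_one]
    intro i
    have h := abs_le_homNorm_pow p ξ i
    rwa [show homNorm p ξ = 1 from hξ, one_pow] at h
  have hne : ∀ ξ ∈ S, ξ ≠ 0 := by
    rintro ξ hξ rfl
    have : homNorm p (0 : Fin n → ℝ) = 0 := by simp [homNorm]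
    rw [show homNorm p (0 : Fin n → ℝ) = 1 from hξ] at this
    exact one_ne_zero this
  have hK : IsCompact (S ×ˢ Metric.sphere (0 : V) 1) := hS.prod (isCompact_sphere 0 1)
  have hcont : Continuous fun q : (Fin n → ℝ) × V => ‖constSymbol p d b q.1 q.2‖ :=
    (((continuous_constSymbol p d b).comp continuous_fst).clm_apply continuous_snd).norm
  obtain ⟨c, hc, hcb⟩ : ∃ c : ℝ, 0 < c ∧ ∀ q ∈ S ×ˢ Metric.sphere (0 : V) 1,
      c ≤ ‖constSymbol p d b q.1 q.2‖ := by
    -- The product is empty if `n = 0` or `V = 0`; any constant will do then.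
    rcases (S ×ˢ Metric.sphere (0 : V) 1).eq_empty_or_nonempty with h | h
    · exact ⟨1, one_pos, by simp [h]⟩
    · obtain ⟨q, hq, hmin⟩ := hK.exists_isMinOn h hcont.continuousOn
      refine ⟨_, norm_pos_iff.2 fun h0 => ?_, hmin⟩
      have h1 := (hb q.1 (hne _ hq.1)).1 (h0.trans (map_zero _).symm)
      have h2 : ‖q.2‖ = 1 := mem_sphere_zero_iff_norm.1 hq.2
      rw [h1, norm_zero] at h2
      exact zero_ne_one h2
  refine ⟨c, hc, fun ξ hξ v => ?_⟩
  by_cases hv : v = 0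
  · simp [hv]
  have ht := homNorm_pos p hξ
  set t := homNorm p ξ
  -- Every nonzero frequency is a dilate of a point of the unit sphere, so homogeneity transfers the
  -- bound found there.
  have hη : dilate p t⁻¹ ξ ∈ S := by
    change homNorm p _ = 1
    rw [homNorm_dilate p (by positivity)]
    exact inv_mul_cancel₀ ht.ne'
  have hξη : ξ = dilate p t (dilate p t⁻¹ ξ) := by
    funext i
    simp only [dilate]
    rw [← mul_assoc, ← mul_pow, mul_inv_cancel₀ ht.ne', one_pow, one_mul]
  have hu : ((‖v‖⁻¹ : ℝ) : ℂ) • v ∈ Metric.sphere (0 : V) 1 := by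
    rw [mem_sphere_zero_iff_norm, norm_smul]
    simp [hv]
  have h1 := hcb (dilate p t⁻¹ ξ, ((‖v‖⁻¹ : ℝ) : ℂ) • v) ⟨hη, hu⟩
  simp only [map_smul, norm_smul, Complex.norm_real, norm_inv, norm_norm] at h1
  have hv' : 0 < ‖v‖ := norm_pos_iff.2 hv
  rw [hξη, constSymbol_dilate, _root_.smul_apply, norm_smul, norm_pow, Complex.norm_real,
    Real.norm_of_nonneg ht.le]
  rw [inv_mul_eq_div, le_div_iff₀ hv'] at h1
  calc c * t ^ d * ‖v‖ = t ^ d * (c * ‖v‖) := by ring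
    _ ≤ _ := by gcongr

/-- Once t exceeds both 1 and 1/ε, the gap in the exponents makes t^k at most ε t^d; below that
threshold t^k is bounded by a constant. -/
theorem pow_le_eps {k d : ℕ} (hk : k < d) {ε : ℝ} (hε : 0 < ε) :
    ∃ C : ℝ, 0 ≤ C ∧ ∀ t : ℝ, 0 ≤ t → t ^ k ≤ ε * t ^ d + C := by
  refine ⟨(max 1 ε⁻¹) ^ k, by positivity, fun t ht => ?_⟩
  rcases le_total t (max 1 ε⁻¹) with h | h
  · have : t ^ k ≤ (max 1 ε⁻¹) ^ k := by gcongr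
    have : 0 ≤ ε * t ^ d := by positivity
    linarith
  · have h1 : 1 ≤ t := (le_max_left _ _).trans h
    have h2 : 1 ≤ ε * t := by
      have := (le_max_right 1 ε⁻¹).trans h
      rw [inv_le_iff_one_le_mul₀ hε] at this
      linarith
    have h3 : t ^ k ≤ ε * t ^ d := by
      calc t ^ k = 1 * t ^ k := (one_mul _).symm
        _ ≤ (ε * t) * t ^ k := by gcongr
        _ = ε * t ^ (k + 1) := by ring
        _ ≤ ε * t ^ d := by
          have := pow_le_pow_right₀ h1 (show k + 1 ≤ d from hk)
          gcongr
    have : 0 ≤ (max 1 ε⁻¹) ^ k := by positivity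
    linarith

theorem monomial_zero_le_one (α : Fin n → ℕ) : (∏ i, |(0 : Fin n → ℝ) i| ^ α i) ≤ 1 :=
  Finset.prod_le_one (fun _ _ => by positivity) fun i _ => by
    simpa using pow_le_one₀ (n := α i) le_rfl (zero_le_one' ℝ)

/-- The a-priori estimate on the Fourier side, top order. -/
theorem exists_symbol_estimate (p d : ℕ) (b : (Fin n → ℕ) → V →L[ℂ] V)
    (hb : ∀ ξ : Fin n → ℝ, ξ ≠ 0 → Function.Bijective (constSymbol p d b ξ)) :
    ∃ C : ℝ, 0 ≤ C ∧ ∀ α ∈ multiIdx n p d, ∀ (ξ : Fin n → ℝ) (v : V),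
      (∏ i, |ξ i| ^ α i) ^ 2 * ‖v‖ ^ 2 ≤ C * (‖constSymbol p d b ξ v‖ ^ 2 + ‖v‖ ^ 2) := by
  obtain ⟨c, hc, h⟩ := exists_constSymbol_bound p d b hb
  refine ⟨1 + c⁻¹ ^ 2, by positivity, fun α hα ξ v => ?_⟩
  -- At the zero frequency the symbol gives no information, but there the monomials are at most 1
  -- and the term ‖v‖² on the right suffices.
  by_cases hξ : ξ = 0
  · subst hξ
    have h1 : (∏ i, |(0 : Fin n → ℝ) i| ^ α i) ^ 2 ≤ 1 :=
      pow_le_one₀ (by positivity) (monomial_zero_le_one α)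
    nlinarith [sq_nonneg ‖v‖, sq_nonneg ‖constSymbol p d b 0 v‖, sq_nonneg c⁻¹,
      mul_nonneg (sq_nonneg c⁻¹) (sq_nonneg ‖v‖),
      mul_nonneg (sq_nonneg c⁻¹) (sq_nonneg ‖constSymbol p d b 0 v‖)]
  · set t := homNorm p ξ
    have ht : 0 < t := homNorm_pos p hξ
    have h1 : ∏ i, |ξ i| ^ α i ≤ t ^ weight p α := prod_abs_le_homNorm_pow p ξ α
    have h2 : t ^ weight p α ≤ 1 + t ^ d := by
      rcases le_total t 1 with h' | h'
      · have := pow_le_one₀ (n := weight p α) ht.le h'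
        have : 0 ≤ t ^ d := by positivity
        linarith
      · have := pow_le_pow_right₀ h' (mem_multiIdx.1 hα)
        linarith
    have h3 : t ^ d * ‖v‖ ≤ c⁻¹ * ‖constSymbol p d b ξ v‖ := by
      rw [inv_mul_eq_div, le_div_iff₀ hc]
      linarith [h ξ hξ v]
    have h4 : (∏ i, |ξ i| ^ α i) * ‖v‖ ≤ ‖v‖ + c⁻¹ * ‖constSymbol p d b ξ v‖ := by
      calc (∏ i, |ξ i| ^ α i) * ‖v‖ ≤ (1 + t ^ d) * ‖v‖ := by gcongr; exact h1.trans h2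
        _ ≤ _ := by linarith
    have h5 : 0 ≤ (∏ i, |ξ i| ^ α i) * ‖v‖ := by positivity
    rw [← mul_pow]
    calc ((∏ i, |ξ i| ^ α i) * ‖v‖) ^ 2 ≤ (‖v‖ + c⁻¹ * ‖constSymbol p d b ξ v‖) ^ 2 := by gcongr
      _ ≤ (1 + c⁻¹ ^ 2) * (‖constSymbol p d b ξ v‖ ^ 2 + ‖v‖ ^ 2) := by
        -- Cauchy–Schwarz in the plane: (x + c⁻¹ y)² ≤ (1 + c⁻²)(x² + y²); the hint is the square of
        -- the defect.
        nlinarith [sq_nonneg (c⁻¹ * ‖v‖ - ‖constSymbol p d b ξ v‖)]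

/-- The a-priori estimate on the Fourier side, lower order. -/
theorem exists_symbol_estimate_lower (p d : ℕ) (b : (Fin n → ℕ) → V →L[ℂ] V)
    (hb : ∀ ξ : Fin n → ℝ, ξ ≠ 0 → Function.Bijective (constSymbol p d b ξ)) {ε : ℝ} (hε : 0 < ε) :
    ∃ C : ℝ, 0 ≤ C ∧ ∀ α ∈ multiIdx n p (d - 1), ∀ (ξ : Fin n → ℝ) (v : V),
      (∏ i, |ξ i| ^ α i) ^ 2 * ‖v‖ ^ 2 ≤ ε * ‖constSymbol p d b ξ v‖ ^ 2 + C * ‖v‖ ^ 2 := by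
  obtain ⟨c, hc, h⟩ := exists_constSymbol_bound p d b hb
  have hmain : ∀ k ≤ d - 1, ∃ C : ℝ, 0 ≤ C ∧ ∀ t : ℝ, 0 ≤ t → (t ^ k) ^ 2 ≤
      ε * c ^ 2 * (t ^ d) ^ 2 + C := by
    intro k hk
    -- For `d = 0` truncated subtraction still admits `k = 0`, which is not below `d`, so this case
    -- is settled by the constant 1. For `k > 0` the bound `k ≤ d - 1` does give `k < d`.
    rcases Nat.eq_zero_or_pos k with rfl | hk0
    · refine ⟨1, zero_le_one, fun t ht => ?_⟩
      have : 0 ≤ ε * c ^ 2 * (t ^ d) ^ 2 := by positivity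
      simpa using this
    · obtain ⟨C, hC, hCt⟩ := pow_le_eps (show k < d by omega) (show 0 < ε * c ^ 2 by positivity)
      refine ⟨C, hC, fun t ht => ?_⟩
      -- Taken at t², since the Plancherel argument needs the inequality between squares.
      have := hCt (t ^ 2) (by positivity)
      rwa [← pow_mul, ← pow_mul, mul_comm 2 k, mul_comm 2 d, pow_mul, pow_mul] at this
  choose! C hC hCt using hmain
  refine ⟨1 + ∑ k ∈ Finset.range (d - 1 + 1), C k, ?_, fun α hα ξ v => ?_⟩
  · have : 0 ≤ ∑ k ∈ Finset.range (d - 1 + 1), C k :=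
      Finset.sum_nonneg fun k hk => hC k (by rw [Finset.mem_range] at hk; omega)
    positivity
  have hwt := mem_multiIdx.1 hα
  have hsum : C (weight p α) ≤ ∑ k ∈ Finset.range (d - 1 + 1), C k :=
    Finset.single_le_sum (f := C) (fun k hk => hC k (by rw [Finset.mem_range] at hk; omega))
      (Finset.mem_range.2 (by omega))
  have hC0 := hC _ hwt
  by_cases hξ : ξ = 0
  · subst hξ
    have h1 : (∏ i, |(0 : Fin n → ℝ) i| ^ α i) ^ 2 ≤ 1 :=
      pow_le_one₀ (by positivity) (monomial_zero_le_one α)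
    have h2 : 0 ≤ ε * ‖constSymbol p d b 0 v‖ ^ 2 := by positivity
    calc (∏ i, |(0 : Fin n → ℝ) i| ^ α i) ^ 2 * ‖v‖ ^ 2
        ≤ (1 + ∑ k ∈ Finset.range (d - 1 + 1), C k) * ‖v‖ ^ 2 := by gcongr; linarith
      _ ≤ _ := by linarith
  · set t := homNorm p ξ
    have ht : 0 < t := homNorm_pos p hξ
    have h1 : ∏ i, |ξ i| ^ α i ≤ t ^ weight p α := prod_abs_le_homNorm_pow p ξ α
    have h3 : (c * t ^ d * ‖v‖) ^ 2 ≤ ‖constSymbol p d b ξ v‖ ^ 2 := by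
      gcongr
      exact h ξ hξ v
    have h4 := hCt _ hwt t ht.le
    calc (∏ i, |ξ i| ^ α i) ^ 2 * ‖v‖ ^ 2 ≤ (t ^ weight p α) ^ 2 * ‖v‖ ^ 2 := by gcongr
      _ ≤ (ε * c ^ 2 * (t ^ d) ^ 2 + C (weight p α)) * ‖v‖ ^ 2 := by gcongr
      _ = ε * (c * t ^ d * ‖v‖) ^ 2 + C (weight p α) * ‖v‖ ^ 2 := by ring
      _ ≤ _ := by gcongr; linarith

end Symbol

/-! ### Constant coefficients: the Fourier transform -/

section Fourier

open scoped FourierTransform LineDeriv SchwartzMap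

variable {n : ℕ} {V : Type*} [NormedAddCommGroup V] [InnerProductSpace ℂ V]

/-- Iterated coordinate derivatives of Schwartz functions. -/
def schwartzWord (w : List (Fin n)) (f : 𝓢(EuclideanSpace ℝ (Fin n), V)) :
    𝓢(EuclideanSpace ℝ (Fin n), V) :=
  w.foldr (fun i g => ∂_{EuclideanSpace.single i (1 : ℝ)} g) f

theorem coe_schwartzWord (w : List (Fin n)) (f : 𝓢(EuclideanSpace ℝ (Fin n), V)) :
    ⇑(schwartzWord w f) = wordOp coordField w f := by
  induction w with
  | nil => rfl
  | cons i w ih =>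
    funext y
    change fderiv ℝ (schwartzWord w f) y _ = fderiv ℝ (wordOp coordField w f) y _
    rw [ih]
    rfl

/-- A coordinate derivative becomes multiplication by 2πi ξ_i. These scalar factors commute, so the
product depends only on the exponents. -/
theorem fourier_schwartzWord (w : List (Fin n)) (f : 𝓢(EuclideanSpace ℝ (Fin n), V))
    (ξ : EuclideanSpace ℝ (Fin n)) :
    𝓕 (schwartzWord w f) ξ =
      (w.map fun i => Complex.I * ((2 * Real.pi * ξ i : ℝ) : ℂ)).prod • 𝓕 f ξ := by
  induction w with
  | nil => simp [schwartzWord]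
  | cons i w ih =>
    change 𝓕 (∂_{EuclideanSpace.single i (1 : ℝ)} (schwartzWord w f)) ξ = _
    have ht : (fun x : EuclideanSpace ℝ (Fin n) =>
        inner ℝ x (EuclideanSpace.single i (1 : ℝ))).HasTemperateGrowth :=
      ((innerSL ℝ).flip (EuclideanSpace.single i (1 : ℝ))).hasTemperateGrowth
    rw [SchwartzMap.fourier_lineDerivOp_eq, _root_.smul_apply,
      SchwartzMap.smulLeftCLM_apply_apply ht, ih, List.map_cons, List.prod_cons]
    have : inner ℝ ξ (EuclideanSpace.single i (1 : ℝ)) = ξ i := by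
      simp [EuclideanSpace.inner_single_right]
    rw [this, ← Complex.coe_smul, smul_smul, smul_smul]
    congr 1
    push_cast
    ring

theorem prod_map_sortedWord {R : Type*} [CommMonoid R] (c : Fin n → R) (α : Fin n → ℕ) :
    ((sortedWord α).map c).prod = ∏ i, c i ^ α i := by
  have : ∀ l : List (Fin n), ((l.flatMap fun i => List.replicate (α i) i).map c).prod =
      (l.map fun i => c i ^ α i).prod := by
    intro l
    induction l with
    | nil => rfl
    | cons i l ih => simp [List.flatMap_cons, ih]
  rw [sortedWord, this, Fin.prod_univ_def]

variable [FiniteDimensional ℂ V]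

theorem fourier_postcomp (L : V →L[ℂ] V) (f : 𝓢(EuclideanSpace ℝ (Fin n), V))
    (ξ : EuclideanSpace ℝ (Fin n)) : 𝓕 (f.postcompCLM L) ξ = L (𝓕 f ξ) := by
  rw [SchwartzMap.fourier_coe, SchwartzMap.fourier_coe, Real.fourier_eq, Real.fourier_eq,
    ← L.integral_comp_comm]
  · simp [SchwartzMap.postcompCLM_apply, Circle.smul_def]
  · exact (Real.fourierIntegral_convergent_iff ξ).2 f.integrable

/-- The constant coefficient operator `∑_{‖α‖ = d} b_α ∂^α` on Schwartz functions. -/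
def schwartzOp (p d : ℕ) (b : (Fin n → ℕ) → V →L[ℂ] V) (f : 𝓢(EuclideanSpace ℝ (Fin n), V)) :
    𝓢(EuclideanSpace ℝ (Fin n), V) :=
  ∑ α ∈ (multiIdx n p d).filter (fun α => weight p α = d),
    (schwartzWord (sortedWord α) f).postcompCLM (b α)

theorem schwartzOp_apply (p d : ℕ) (b : (Fin n → ℕ) → V →L[ℂ] V)
    (f : 𝓢(EuclideanSpace ℝ (Fin n), V)) (y : EuclideanSpace ℝ (Fin n)) :
    schwartzOp p d b f y = ∑ α ∈ (multiIdx n p d).filter (fun α => weight p α = d),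
      b α (wordOp coordField (sortedWord α) f y) := by
  simp [schwartzOp, coe_schwartzWord]

/-- The factor 2π in the Fourier transform merely rescales the frequency; as the symbol estimates
hold for all frequencies they apply unchanged. -/
theorem fourier_schwartzOp (p d : ℕ) (b : (Fin n → ℕ) → V →L[ℂ] V)
    (f : 𝓢(EuclideanSpace ℝ (Fin n), V)) (ξ : EuclideanSpace ℝ (Fin n)) :
    𝓕 (schwartzOp p d b f) ξ = constSymbol p d b (fun i => 2 * Real.pi * ξ i) (𝓕 f ξ) := by
  have h1 : 𝓕 (schwartzOp p d b f) = ∑ α ∈ (multiIdx n p d).filter (fun α => weight p α = d),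
      𝓕 ((schwartzWord (sortedWord α) f).postcompCLM (b α)) := by
    unfold schwartzOp
    exact map_sum (SchwartzMap.fourierTransformCLM ℂ (V := EuclideanSpace ℝ (Fin n))
      (E := V)).toLinearMap _ _
  rw [h1, _root_.sum_apply, constSymbol, _root_.sum_apply]
  refine Finset.sum_congr rfl fun α _ => ?_
  rw [fourier_postcomp, fourier_schwartzWord, prod_map_sortedWord, map_smul, _root_.smul_apply]

theorem integral_norm_sq_schwartzWord (w : List (Fin n)) (f : 𝓢(EuclideanSpace ℝ (Fin n), V)) :
    ∫ y, ‖wordOp coordField w f y‖ ^ 2 =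
      ∫ ξ, ‖𝓕 (schwartzWord w f) ξ‖ ^ 2 := by
  rw [SchwartzMap.integral_norm_sq_fourier, coe_schwartzWord]

theorem norm_fourier_schwartzWord_sq (α : Fin n → ℕ) (f : 𝓢(EuclideanSpace ℝ (Fin n), V))
    (ξ : EuclideanSpace ℝ (Fin n)) :
    ‖𝓕 (schwartzWord (sortedWord α) f) ξ‖ ^ 2 =
      (∏ i, |2 * Real.pi * ξ i| ^ α i) ^ 2 * ‖𝓕 f ξ‖ ^ 2 := by
  rw [fourier_schwartzWord, prod_map_sortedWord, norm_smul, mul_pow]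
  congr 2
  exact norm_prod_I_mul (fun i => 2 * Real.pi * ξ i) α

theorem integrable_norm_sq (f : 𝓢(EuclideanSpace ℝ (Fin n), V)) : Integrable fun y => ‖f y‖ ^ 2 :=
  (f.memLp 2).integrable_norm_pow (by norm_num)

/-- By Plancherel it is enough to integrate the pointwise inequality of `exists_symbol_estimate`
over the frequencies. -/
theorem schwartz_estimate (p d : ℕ) (b : (Fin n → ℕ) → V →L[ℂ] V)
    (hb : ∀ ξ : Fin n → ℝ, ξ ≠ 0 → Function.Bijective (constSymbol p d b ξ)) :
    ∃ C : ℝ, 0 ≤ C ∧ ∀ α ∈ multiIdx n p d, ∀ f : 𝓢(EuclideanSpace ℝ (Fin n), V),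
      ∫ y, ‖wordOp coordField (sortedWord α) f y‖ ^ 2 ≤
        C * ((∫ y, ‖schwartzOp p d b f y‖ ^ 2) + ∫ y, ‖f y‖ ^ 2) := by
  obtain ⟨C, hC, h⟩ := exists_symbol_estimate p d b hb
  refine ⟨C, hC, fun α hα f => ?_⟩
  rw [integral_norm_sq_schwartzWord, ← SchwartzMap.integral_norm_sq_fourier (schwartzOp p d b f),
    ← SchwartzMap.integral_norm_sq_fourier f, ← integral_add (integrable_norm_sq _)
    (integrable_norm_sq _), ← integral_const_mul]
  refine integral_mono (integrable_norm_sq _)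
    (((integrable_norm_sq _).add (integrable_norm_sq _)).const_mul _) fun ξ => ?_
  simp only [norm_fourier_schwartzWord_sq, fourier_schwartzOp]
  exact h α hα _ _

theorem schwartz_estimate_lower (p d : ℕ) (b : (Fin n → ℕ) → V →L[ℂ] V)
    (hb : ∀ ξ : Fin n → ℝ, ξ ≠ 0 → Function.Bijective (constSymbol p d b ξ)) {ε : ℝ} (hε : 0 < ε) :
    ∃ C : ℝ, 0 ≤ C ∧ ∀ α ∈ multiIdx n p (d - 1), ∀ f : 𝓢(EuclideanSpace ℝ (Fin n), V),
      ∫ y, ‖wordOp coordField (sortedWord α) f y‖ ^ 2 ≤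
        ε * (∫ y, ‖schwartzOp p d b f y‖ ^ 2) + C * ∫ y, ‖f y‖ ^ 2 := by
  obtain ⟨C, hC, h⟩ := exists_symbol_estimate_lower p d b hb hε
  refine ⟨C, hC, fun α hα f => ?_⟩
  rw [integral_norm_sq_schwartzWord, ← SchwartzMap.integral_norm_sq_fourier (schwartzOp p d b f),
    ← SchwartzMap.integral_norm_sq_fourier f, ← integral_const_mul, ← integral_const_mul,
    ← integral_add ((integrable_norm_sq _).const_mul _) ((integrable_norm_sq _).const_mul _)]
  refine integral_mono (integrable_norm_sq _)
    (((integrable_norm_sq _).const_mul _).add ((integrable_norm_sq _).const_mul _)) fun ξ => ?_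
  simp only [norm_fourier_schwartzWord_sq, fourier_schwartzOp]
  exact h α hα _ _

end Fourier

/-! ### Variable coefficients on small balls -/

section Local

variable {n : ℕ} {V : Type*} [NormedAddCommGroup V] [InnerProductSpace ℂ V]

theorem wordOp_zero (X : Fin n → EuclideanSpace ℝ (Fin n) → EuclideanSpace ℝ (Fin n))
    (w : List (Fin n)) : wordOp X w (0 : EuclideanSpace ℝ (Fin n) → V) = 0 := by
  induction w with
  | nil => rfl
  | cons i w ih =>
    change dirDeriv (X i) (wordOp X w 0) = 0
    rw [ih]
    funext y
    simp [dirDeriv]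

theorem wordOp_eq_zero_of_notMem_tsupport
    (X : Fin n → EuclideanSpace ℝ (Fin n) → EuclideanSpace ℝ (Fin n)) (w : List (Fin n))
    {f : EuclideanSpace ℝ (Fin n) → V} {y : EuclideanSpace ℝ (Fin n)} (hy : y ∉ tsupport f) :
    wordOp X w f y = 0 := by
  have h : EqOn f 0 (tsupport f)ᶜ := fun z hz => image_eq_zero_of_notMem_tsupport hz
  have := wordOp_congr (isClosed_tsupport f).isOpen_compl X w h hy
  rwa [wordOp_zero] at this

theorem wordOp_coordField_contDiff (w : List (Fin n)) {f : EuclideanSpace ℝ (Fin n) → V}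
    (hf : ContDiff ℝ ∞ f) : ContDiff ℝ ∞ (wordOp coordField w f) :=
  contDiffOn_univ.1 (wordOp_contDiffOn isOpen_univ (fun i => coordField_contDiffOn i) w
    (contDiffOn_univ.2 hf))

/-- The operator `∑_{‖α‖ ≤ d} a_α(y) ∂^α`. -/
def varOp {V' : Type*} [NormedAddCommGroup V'] [InnerProductSpace ℂ V'] (p d : ℕ)
    (a : (Fin n → ℕ) → EuclideanSpace ℝ (Fin n) → V →L[ℂ] V')
    (f : EuclideanSpace ℝ (Fin n) → V) (y : EuclideanSpace ℝ (Fin n)) : V' :=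
  ∑ α ∈ multiIdx n p d, a α y (wordOp coordField (sortedWord α) f y)

theorem norm_sum_sq_le {ι W : Type*} [SeminormedAddCommGroup W] (s : Finset ι) (f : ι → W) :
    ‖∑ i ∈ s, f i‖ ^ 2 ≤ s.card * ∑ i ∈ s, ‖f i‖ ^ 2 :=
  calc ‖∑ i ∈ s, f i‖ ^ 2 ≤ (∑ i ∈ s, ‖f i‖) ^ 2 := by gcongr; exact norm_sum_le _ _
    _ ≤ _ := sq_sum_le_card_mul_sum_sq

theorem norm_sub_sq_le {W : Type*} [SeminormedAddCommGroup W] (x y : W) :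
    ‖x - y‖ ^ 2 ≤ 2 * ‖x‖ ^ 2 + 2 * ‖y‖ ^ 2 := by
  have h := norm_sub_le x y
  nlinarith [sq_nonneg (‖x‖ - ‖y‖), norm_nonneg (x - y), norm_nonneg x, norm_nonneg y]

theorem norm_add_sq_le {W : Type*} [SeminormedAddCommGroup W] (x y : W) :
    ‖x + y‖ ^ 2 ≤ 2 * ‖x‖ ^ 2 + 2 * ‖y‖ ^ 2 := by
  simpa using norm_sub_sq_le x (-y)

variable [FiniteDimensional ℂ V]

theorem setIntegral_eq_of_tsupport {y₀ : EuclideanSpace ℝ (Fin n)} {r : ℝ}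
    {w : EuclideanSpace ℝ (Fin n) → V} (hw : tsupport w ⊆ Metric.closedBall y₀ r)
    {g : EuclideanSpace ℝ (Fin n) → V} (hg : ∀ y ∉ tsupport w, g y = 0) :
    ∫ y in Metric.closedBall y₀ r, ‖g y‖ ^ 2 = ∫ y, ‖g y‖ ^ 2 :=
  setIntegral_eq_integral_of_forall_compl_eq_zero fun y hy => by
    rw [hg y fun h => hy (hw h)]; simp

/-- The coefficient of `∂^α` in the difference between the operator and its frozen principal
part. -/
def remainderCoeff (p d : ℕ) (a : (Fin n → ℕ) → EuclideanSpace ℝ (Fin n) → V →L[ℂ] V)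
    (y₀ : EuclideanSpace ℝ (Fin n)) (α : Fin n → ℕ) (y : EuclideanSpace ℝ (Fin n)) : V →L[ℂ] V :=
  if weight p α = d then a α y - a α y₀ else a α y

/-- Freezing writes the principal part at `y₀` as the full operator minus a remainder. The top-order
coefficients of the remainder vanish at `y₀`; its lower-order coefficients are the original ones. -/
theorem frozen_eq (p d : ℕ) (a : (Fin n → ℕ) → EuclideanSpace ℝ (Fin n) → V →L[ℂ] V)
    (y₀ y : EuclideanSpace ℝ (Fin n)) (f : EuclideanSpace ℝ (Fin n) → V) :
    ∑ α ∈ (multiIdx n p d).filter (fun α => weight p α = d),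
      a α y₀ (wordOp coordField (sortedWord α) f y) =
    varOp p d a f y - ∑ α ∈ multiIdx n p d,
      remainderCoeff p d a y₀ α y (wordOp coordField (sortedWord α) f y) := by
  rw [varOp, ← Finset.sum_sub_distrib, Finset.sum_filter]
  refine Finset.sum_congr rfl fun α _ => ?_
  unfold remainderCoeff
  split_ifs <;> simp

/-- The a-priori estimates for functions supported in a small ball. -/
theorem local_elliptic (p d : ℕ) {U : Set (EuclideanSpace ℝ (Fin n))} (hU : IsOpen U)
    {a : (Fin n → ℕ) → EuclideanSpace ℝ (Fin n) → V →L[ℂ] V} (ha : ∀ α, ContinuousOn (a α) U)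
    {y₀ : EuclideanSpace ℝ (Fin n)} (hy₀ : y₀ ∈ U)
    (hsymb : ∀ ξ : Fin n → ℝ, ξ ≠ 0 →
      Function.Bijective (constSymbol p d (fun α => a α y₀) ξ)) :
    ∃ r₀ : ℝ, 0 < r₀ ∧ Metric.closedBall y₀ r₀ ⊆ U ∧ ∀ r, r ≤ r₀ →
      (∃ C : ℝ, 0 ≤ C ∧ ∀ w : EuclideanSpace ℝ (Fin n) → V, ContDiff ℝ ∞ w →
        tsupport w ⊆ Metric.closedBall y₀ r → ∀ α ∈ multiIdx n p d,
          ∫ y in Metric.closedBall y₀ r, ‖wordOp coordField (sortedWord α) w y‖ ^ 2 ≤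
            C * ((∫ y in Metric.closedBall y₀ r, ‖varOp p d a w y‖ ^ 2) +
              ∫ y in Metric.closedBall y₀ r, ‖w y‖ ^ 2)) ∧
      ∀ ε : ℝ, 0 < ε → ∃ C : ℝ, 0 ≤ C ∧ ∀ w : EuclideanSpace ℝ (Fin n) → V, ContDiff ℝ ∞ w →
        tsupport w ⊆ Metric.closedBall y₀ r → ∀ α ∈ multiIdx n p (d - 1),
          ∫ y in Metric.closedBall y₀ r, ‖wordOp coordField (sortedWord α) w y‖ ^ 2 ≤
            ε * (∫ y in Metric.closedBall y₀ r, ‖varOp p d a w y‖ ^ 2) +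
              C * ∫ y in Metric.closedBall y₀ r, ‖w y‖ ^ 2 := by
  set b : (Fin n → ℕ) → V →L[ℂ] V := fun α => a α y₀ with hbdef
  obtain ⟨C₁, hC₁, hE₁⟩ := schwartz_estimate p d b hsymb
  have hE₂ := fun {ε : ℝ} (hε : 0 < ε) => schwartz_estimate_lower p d b hsymb hε
  set N : ℝ := ((multiIdx n p d).card : ℝ)
  have hN : 0 ≤ N := Nat.cast_nonneg _
  -- Chosen so that 2 N² η ≤ 1/2: summing N remainder terms and splitting the square costs the
  -- factor 2 N², and at most half of the frozen operator may remain on the right.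
  set η : ℝ := (4 * (N ^ 2 + 1))⁻¹ with hη
  have hη0 : 0 < η := by positivity
  -- each remainder term is small compared with the frozen operator
  set A : (Fin n → ℕ) → ℝ := fun α =>
    if weight p α = d then η / (C₁ + 1) else (‖a α y₀‖ + 1) ^ 2 with hA
  have hA0 : ∀ α, 0 < A α := fun α => by rw [hA]; dsimp only; split_ifs <;> positivity
  have hnear : ∀ᶠ y in 𝓝 y₀, ∀ α ∈ multiIdx n p d, ‖remainderCoeff p d a y₀ α y‖ ^ 2 ≤ A α := by
    rw [Filter.eventually_all_finset]
    intro α _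
    have hc := (ha α).continuousAt (hU.mem_nhds hy₀)
    have hcr : ContinuousAt (fun y => ‖remainderCoeff p d a y₀ α y‖ ^ 2) y₀ := by
      unfold remainderCoeff
      split_ifs
      · exact ((hc.sub continuousAt_const).norm).pow 2
      · exact hc.norm.pow 2
    refine (hcr.eventually_lt (g := fun _ => A α) continuousAt_const ?_).mono fun y hy => hy.le
    simp only [remainderCoeff, hA]
    split_ifs
    · simp; positivity
    · have := norm_nonneg (a α y₀); nlinarith
  have hterm : ∀ α ∈ multiIdx n p d, ∃ K : ℝ, 0 ≤ K ∧
      ∀ f : SchwartzMap (EuclideanSpace ℝ (Fin n)) V,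
      A α * ∫ y, ‖wordOp coordField (sortedWord α) f y‖ ^ 2 ≤
        η * (∫ y, ‖schwartzOp p d b f y‖ ^ 2) + K * ∫ y, ‖f y‖ ^ 2 := by
    intro α hα
    -- Top-order derivatives come with the fixed constant `C₁`, so the smallness must lie in the
    -- coefficient; dividing by `C₁ + 1` avoids a zero denominator. Lower-order derivatives can be
    -- estimated with any small factor, so a bounded coefficient is enough.
    by_cases hw : weight p α = d
    · refine ⟨η, hη0.le, fun f => ?_⟩
      have h1 := hE₁ α hα f
      have h2 : A α = η / (C₁ + 1) := by simp [hA, hw]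
      have p1 : 0 ≤ ∫ y, ‖schwartzOp p d b f y‖ ^ 2 := by positivity
      have p2 : 0 ≤ ∫ y, ‖f y‖ ^ 2 := by positivity
      rw [h2, ← mul_add, div_mul_eq_mul_div, div_le_iff₀ (by positivity), mul_assoc]
      gcongr
      nlinarith
    · have hα' : α ∈ multiIdx n p (d - 1) := by
        have := mem_multiIdx.1 hα
        exact mem_multiIdx.2 (by omega)
      obtain ⟨C, hC, h⟩ := hE₂ (show 0 < η / A α from div_pos hη0 (hA0 α))
      refine ⟨A α * C, mul_nonneg (hA0 α).le hC, fun f => ?_⟩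
      have h1 := mul_le_mul_of_nonneg_left (h α hα' f) (hA0 α).le
      have h3 : A α * (η / A α) = η := mul_div_cancel₀ _ (hA0 α).ne'
      rwa [mul_add, ← mul_assoc, ← mul_assoc, h3] at h1
  choose! K hK hterm using hterm
  set Q : ℝ := ∑ α ∈ multiIdx n p d, K α with hQ
  have hQ0 : 0 ≤ Q := Finset.sum_nonneg hK
  obtain ⟨r₀, hr₀, hball⟩ := Metric.nhds_basis_closedBall.mem_iff.1
    (Filter.inter_mem hnear (hU.mem_nhds hy₀))
  refine ⟨r₀, hr₀, fun y hy => (hball hy).2, fun r hr => ?_⟩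
  have hBsub : Metric.closedBall y₀ r ⊆ Metric.closedBall y₀ r₀ :=
    Metric.closedBall_subset_closedBall hr
  have hfreeze : ∀ f : SchwartzMap (EuclideanSpace ℝ (Fin n)) V,
      tsupport f ⊆ Metric.closedBall y₀ r →
      ∫ y, ‖schwartzOp p d b f y‖ ^ 2 ≤
        4 * (∫ y in Metric.closedBall y₀ r, ‖varOp p d a f y‖ ^ 2) +
          (4 * N * Q) * ∫ y in Metric.closedBall y₀ r, ‖f y‖ ^ 2 := by
    intro f hf
    have hcont : ∀ α, Continuous fun y => wordOp coordField (sortedWord α) f y := fun α =>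
      (wordOp_coordField_contDiff (sortedWord α) f.smooth').continuous
    have hpt : ∀ y ∈ Metric.closedBall y₀ r, ‖schwartzOp p d b f y‖ ^ 2 ≤
        2 * ‖varOp p d a f y‖ ^ 2 + (2 * N) *
          ∑ α ∈ multiIdx n p d, A α * ‖wordOp coordField (sortedWord α) f y‖ ^ 2 := by
      intro y hy
      rw [schwartzOp_apply, frozen_eq]
      refine (norm_sub_sq_le _ _).trans ?_
      have h1 := norm_sum_sq_le (multiIdx n p d) fun α =>
        remainderCoeff p d a y₀ α y (wordOp coordField (sortedWord α) f y)
      have h2 : ∑ α ∈ multiIdx n p d,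
          ‖remainderCoeff p d a y₀ α y (wordOp coordField (sortedWord α) f y)‖ ^ 2 ≤
          ∑ α ∈ multiIdx n p d, A α * ‖wordOp coordField (sortedWord α) f y‖ ^ 2 := by
        refine Finset.sum_le_sum fun α hα => ?_
        calc _ ≤ (‖remainderCoeff p d a y₀ α y‖ * ‖wordOp coordField (sortedWord α) f y‖) ^ 2 := by
              gcongr; exact ContinuousLinearMap.le_opNorm _ _
          _ = ‖remainderCoeff p d a y₀ α y‖ ^ 2 * ‖wordOp coordField (sortedWord α) f y‖ ^ 2 :=
              mul_pow _ _ _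
          _ ≤ _ := by gcongr; exact (hball (hBsub hy)).1 α hα
      have h3 := mul_le_mul_of_nonneg_left h2 hN
      linarith
    have hi1 : IntegrableOn (fun y => ‖varOp p d a f y‖ ^ 2) (Metric.closedBall y₀ r) := by
      refine ContinuousOn.integrableOn_compact (isCompact_closedBall y₀ r) ?_
      refine ContinuousOn.pow (ContinuousOn.norm (continuousOn_finsetSum _ fun α _ => ?_)) 2
      exact ((ha α).mono fun y hy => (hball (hBsub hy)).2).clm_apply (hcont α).continuousOn
    have hi2 : ∀ α, IntegrableOn (fun y => A α * ‖wordOp coordField (sortedWord α) f y‖ ^ 2)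
        (Metric.closedBall y₀ r) := fun α =>
      (continuous_const.mul ((hcont α).norm.pow 2)).continuousOn.integrableOn_compact
        (isCompact_closedBall y₀ r)
    have hi3 : IntegrableOn (fun y => ∑ α ∈ multiIdx n p d,
        A α * ‖wordOp coordField (sortedWord α) f y‖ ^ 2) (Metric.closedBall y₀ r) :=
      integrable_finsetSum _ fun α _ => hi2 α
    have hsupp : ∀ α, ∫ y in Metric.closedBall y₀ r, ‖wordOp coordField (sortedWord α) f y‖ ^ 2 =
        ∫ y, ‖wordOp coordField (sortedWord α) f y‖ ^ 2 := fun α =>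
      setIntegral_eq_of_tsupport hf fun y hy => wordOp_eq_zero_of_notMem_tsupport _ _ hy
    have hP0 : ∫ y in Metric.closedBall y₀ r, ‖schwartzOp p d b f y‖ ^ 2 =
        ∫ y, ‖schwartzOp p d b f y‖ ^ 2 :=
      setIntegral_eq_of_tsupport hf fun y hy => by
        rw [schwartzOp_apply]
        refine Finset.sum_eq_zero fun α _ => ?_
        rw [wordOp_eq_zero_of_notMem_tsupport _ _ hy, map_zero]
    have hf0 : ∫ y in Metric.closedBall y₀ r, ‖f y‖ ^ 2 = ∫ y, ‖f y‖ ^ 2 :=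
      setIntegral_eq_of_tsupport hf fun y hy => image_eq_zero_of_notMem_tsupport hy
    have hint := setIntegral_mono_on (integrable_norm_sq (schwartzOp p d b f)).integrableOn
      ((hi1.const_mul 2).add (hi3.const_mul (2 * N))) Metric.isClosed_closedBall.measurableSet hpt
    simp only [Pi.add_apply] at hint
    rw [integral_add (hi1.const_mul 2) (hi3.const_mul (2 * N)), integral_const_mul,
      integral_const_mul, integral_finsetSum _ fun α _ => hi2 α, hP0] at hint
    have hsum : ∑ α ∈ multiIdx n p d, ∫ y in Metric.closedBall y₀ r,
        A α * ‖wordOp coordField (sortedWord α) f y‖ ^ 2 ≤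
        N * η * (∫ y, ‖schwartzOp p d b f y‖ ^ 2) + Q * ∫ y, ‖f y‖ ^ 2 := by
      calc _ ≤ ∑ α ∈ multiIdx n p d, (η * (∫ y, ‖schwartzOp p d b f y‖ ^ 2) +
            K α * ∫ y, ‖f y‖ ^ 2) := by
            refine Finset.sum_le_sum fun α hα => ?_
            rw [integral_const_mul, hsupp α]
            exact hterm α hα f
        _ = _ := by
            rw [Finset.sum_add_distrib, Finset.sum_const, ← Finset.sum_mul, nsmul_eq_mul,
              mul_assoc]
    -- Half of the frozen term is now absorbed on the left, which doubles the constants 2 and 2 N Q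
    -- to those of the claim.
    have hcoef : 2 * N * (N * η) ≤ 1 / 2 := by
      rw [hη]
      have : 0 < 4 * (N ^ 2 + 1) := by positivity
      rw [← mul_assoc, mul_inv_le_iff₀ this]
      nlinarith
    have p1 : 0 ≤ ∫ y, ‖schwartzOp p d b f y‖ ^ 2 := by positivity
    rw [hf0]
    have h5 := mul_le_mul_of_nonneg_left hsum (show 0 ≤ 2 * N by positivity)
    have h6 := mul_le_mul_of_nonneg_right hcoef p1
    nlinarith
  have hsch : ∀ w : EuclideanSpace ℝ (Fin n) → V, ContDiff ℝ ∞ w →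
      tsupport w ⊆ Metric.closedBall y₀ r →
      ∃ f : SchwartzMap (EuclideanSpace ℝ (Fin n)) V, ⇑f = w := fun w hw hs =>
    ⟨HasCompactSupport.toSchwartzMap ((isCompact_closedBall y₀ r).of_isClosed_subset
      (isClosed_tsupport w) hs) hw, rfl⟩
  constructor
  · refine ⟨C₁ * (4 + 4 * N * Q + 1), by positivity, fun w hw hs α hα => ?_⟩
    obtain ⟨f, rfl⟩ := hsch w hw hs
    have h1 := hE₁ α hα f
    have h2 := hfreeze f hs
    have hf0 : ∫ y in Metric.closedBall y₀ r, ‖f y‖ ^ 2 = ∫ y, ‖f y‖ ^ 2 :=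
      setIntegral_eq_of_tsupport hs fun y hy => image_eq_zero_of_notMem_tsupport hy
    have hsupp : ∫ y in Metric.closedBall y₀ r, ‖wordOp coordField (sortedWord α) f y‖ ^ 2 =
        ∫ y, ‖wordOp coordField (sortedWord α) f y‖ ^ 2 :=
      setIntegral_eq_of_tsupport hs fun y hy => wordOp_eq_zero_of_notMem_tsupport _ _ hy
    have p1 : 0 ≤ ∫ y in Metric.closedBall y₀ r, ‖varOp p d a f y‖ ^ 2 := by positivity
    have p2 : 0 ≤ ∫ y, ‖f y‖ ^ 2 := by positivity
    rw [hsupp]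
    refine h1.trans ?_
    rw [mul_assoc]
    gcongr
    rw [hf0] at h2 ⊢
    have p3 : 0 ≤ 4 * N * Q := by positivity
    nlinarith [mul_nonneg p3 p1]
  · intro ε hε
    obtain ⟨C, hC, h⟩ := hE₂ (show 0 < ε / 4 by positivity)
    refine ⟨ε / 4 * (4 * N * Q) + C, by positivity, fun w hw hs α hα => ?_⟩
    obtain ⟨f, rfl⟩ := hsch w hw hs
    have h1 := h α hα f
    have h2 := hfreeze f hs
    have hf0 : ∫ y in Metric.closedBall y₀ r, ‖f y‖ ^ 2 = ∫ y, ‖f y‖ ^ 2 :=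
      setIntegral_eq_of_tsupport hs fun y hy => image_eq_zero_of_notMem_tsupport hy
    have hsupp : ∫ y in Metric.closedBall y₀ r, ‖wordOp coordField (sortedWord α) f y‖ ^ 2 =
        ∫ y, ‖wordOp coordField (sortedWord α) f y‖ ^ 2 :=
      setIntegral_eq_of_tsupport hs fun y hy => wordOp_eq_zero_of_notMem_tsupport _ _ hy
    rw [hsupp]
    rw [hf0] at h2 ⊢
    have h3 := mul_le_mul_of_nonneg_left h2 (show 0 ≤ ε / 4 by positivity)
    linarith

end Local

/-! ### Interior estimates -/

section Interior

variable {n : ℕ} {V : Type*} [NormedAddCommGroup V] [InnerProductSpace ℂ V]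

theorem integrableOn_norm_sq_of_continuousOn {W : Type*} [NormedAddCommGroup W]
    {K : Set (EuclideanSpace ℝ (Fin n))} (hK : IsCompact K)
    {f : EuclideanSpace ℝ (Fin n) → W} (hf : ContinuousOn f K) :
    IntegrableOn (fun y => ‖f y‖ ^ 2) K :=
  (hf.norm.pow 2).integrableOn_compact hK

theorem varOp_continuousOn {V' : Type*} [NormedAddCommGroup V'] [InnerProductSpace ℂ V'] (p d : ℕ)
    {U : Set (EuclideanSpace ℝ (Fin n))} (hU : IsOpen U)
    {a : (Fin n → ℕ) → EuclideanSpace ℝ (Fin n) → V →L[ℂ] V'} (ha : ∀ α, ContinuousOn (a α) U)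
    {v : EuclideanSpace ℝ (Fin n) → V} (hv : ContDiffOn ℝ ∞ v U) :
    ContinuousOn (varOp p d a v) U :=
  continuousOn_finsetSum _ fun α _ => (ha α).clm_apply
    (wordOp_contDiffOn hU (fun i => coordField_contDiffOn i) (sortedWord α) hv).continuousOn

/-- Up to the commutator of each ∂^α with χ, the operator applied to χ v is χ times the operator
applied to v. Those commutators have weighted order at most `d - 1`, and the coefficients are
bounded on the compact set. -/
theorem varOp_cutoff_bound (p d : ℕ) {U : Set (EuclideanSpace ℝ (Fin n))} (hU : IsOpen U)
    {a : (Fin n → ℕ) → EuclideanSpace ℝ (Fin n) → V →L[ℂ] V} (ha : ∀ α, ContinuousOn (a α) U)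
    {χ : EuclideanSpace ℝ (Fin n) → ℝ} (hχ : ContDiffOn ℝ ∞ χ U) (hχ1 : ∀ y, |χ y| ≤ 1)
    {K : Set (EuclideanSpace ℝ (Fin n))} (hK : IsCompact K) (hKU : K ⊆ U) :
    ∃ D : ℝ, 0 ≤ D ∧ ∀ v : EuclideanSpace ℝ (Fin n) → V, ContDiffOn ℝ ∞ v U → ∀ y ∈ K,
      ‖varOp p d a (fun z => χ z • v z) y‖ ^ 2 ≤ 2 * ‖varOp p d a v y‖ ^ 2 +
        D * ∑ β ∈ multiIdx n p (d - 1), ‖wordOp coordField (sortedWord β) v y‖ ^ 2 := by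
  have h1 : ∀ α ∈ multiIdx n p d, ∃ C : ℝ, 0 ≤ C ∧
      ∀ v : EuclideanSpace ℝ (Fin n) → V, ContDiffOn ℝ ∞ v U → ∀ y ∈ K,
      ‖wordOp coordField (sortedWord α) (fun z => χ z • v z) y -
          χ y • wordOp coordField (sortedWord α) v y‖ ≤
        C * ∑ β ∈ multiIdx n p (d - 1), ‖wordOp coordField (sortedWord β) v y‖ :=
    fun α hα => commutator_bound hU hχ hα hK hKU
  choose! C hC hcomm using h1
  have h2 : ∀ α, ∃ A : ℝ, ∀ y ∈ K, ‖a α y‖ ≤ A := fun α =>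
    hK.exists_bound_of_continuousOn ((ha α).mono hKU)
  choose A hA using h2
  set B : ℝ := ∑ α ∈ multiIdx n p d, |A α| * C α
  refine ⟨2 * B ^ 2 * (multiIdx n p (d - 1)).card, by positivity, fun v hv y hy => ?_⟩
  set G := ∑ β ∈ multiIdx n p (d - 1), ‖wordOp coordField (sortedWord β) v y‖
  have hsplit : varOp p d a (fun z => χ z • v z) y = χ y • varOp p d a v y +
      ∑ α ∈ multiIdx n p d, a α y (wordOp coordField (sortedWord α) (fun z => χ z • v z) y -
          χ y • wordOp coordField (sortedWord α) v y) := by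
    simp only [varOp, map_sub, Finset.sum_sub_distrib, Finset.smul_sum]
    rw [← Finset.sum_congr rfl fun α _ => (a α y).map_smul_of_tower (χ y)
      (wordOp coordField (sortedWord α) v y)]
    abel
  have hE : ‖∑ α ∈ multiIdx n p d, a α y (wordOp coordField (sortedWord α)
      (fun z => χ z • v z) y - χ y • wordOp coordField (sortedWord α) v y)‖ ≤ B * G := by
    rw [Finset.sum_mul]
    refine (norm_sum_le _ _).trans (Finset.sum_le_sum fun α hα => ?_)
    refine ((a α y).le_opNorm _).trans ?_
    rw [mul_assoc]
    have := (hA α y hy).trans (le_abs_self _)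
    have := hcomm α hα v hv y hy
    gcongr
  have hG : G ^ 2 ≤ (multiIdx n p (d - 1)).card *
      ∑ β ∈ multiIdx n p (d - 1), ‖wordOp coordField (sortedWord β) v y‖ ^ 2 :=
    sq_sum_le_card_mul_sum_sq
  rw [hsplit]
  refine (norm_add_sq_le _ _).trans ?_
  have e1 : ‖χ y • varOp p d a v y‖ ≤ ‖varOp p d a v y‖ := by
    rw [norm_smul, Real.norm_eq_abs]
    exact mul_le_of_le_one_left (norm_nonneg _) (hχ1 y)
  have e2 := pow_le_pow_left₀ (norm_nonneg _) hE 2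
  have e3 := pow_le_pow_left₀ (norm_nonneg _) e1 2
  have e4 := mul_le_mul_of_nonneg_left hG (show 0 ≤ 2 * B ^ 2 by positivity)
  calc _ ≤ 2 * ‖varOp p d a v y‖ ^ 2 + 2 * (B * G) ^ 2 := by gcongr
    _ = 2 * ‖varOp p d a v y‖ ^ 2 + 2 * B ^ 2 * G ^ 2 := by ring
    _ ≤ _ := by linarith

variable [FiniteDimensional ℂ V]

/-- The estimates of `local_elliptic` are applied to χ v, where χ is a bump function equal to 1 on
the half ball and supported in the full one. The commutator puts derivatives of order `d - 1` on the
right; in the second estimate they carry the factor ε and can be absorbed once the estimate is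
global. -/
theorem interior_estimate (p d : ℕ) {U : Set (EuclideanSpace ℝ (Fin n))} (hU : IsOpen U)
    {a : (Fin n → ℕ) → EuclideanSpace ℝ (Fin n) → V →L[ℂ] V} (ha : ∀ α, ContinuousOn (a α) U)
    {y₀ : EuclideanSpace ℝ (Fin n)} (hy₀ : y₀ ∈ U)
    (hsymb : ∀ ξ : Fin n → ℝ, ξ ≠ 0 →
      Function.Bijective (constSymbol p d (fun α => a α y₀) ξ)) :
    ∃ r₀ : ℝ, 0 < r₀ ∧ Metric.closedBall y₀ r₀ ⊆ U ∧ ∀ r, 0 < r → r ≤ r₀ →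
      (∃ C : ℝ, 0 ≤ C ∧ ∀ v : EuclideanSpace ℝ (Fin n) → V, ContDiffOn ℝ ∞ v U →
        ∀ α ∈ multiIdx n p d,
          ∫ y in Metric.ball y₀ (r / 2), ‖wordOp coordField (sortedWord α) v y‖ ^ 2 ≤
            C * ((∫ y in Metric.closedBall y₀ r, ‖varOp p d a v y‖ ^ 2) +
              (∫ y in Metric.closedBall y₀ r, ∑ β ∈ multiIdx n p (d - 1),
                ‖wordOp coordField (sortedWord β) v y‖ ^ 2) +
              ∫ y in Metric.closedBall y₀ r, ‖v y‖ ^ 2)) ∧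
      ∀ ε : ℝ, 0 < ε → ∃ C : ℝ, 0 ≤ C ∧ ∀ v : EuclideanSpace ℝ (Fin n) → V, ContDiffOn ℝ ∞ v U →
        ∀ α ∈ multiIdx n p (d - 1),
          ∫ y in Metric.ball y₀ (r / 2), ‖wordOp coordField (sortedWord α) v y‖ ^ 2 ≤
            ε * ((∫ y in Metric.closedBall y₀ r, ‖varOp p d a v y‖ ^ 2) +
              ∫ y in Metric.closedBall y₀ r, ∑ β ∈ multiIdx n p (d - 1),
                ‖wordOp coordField (sortedWord β) v y‖ ^ 2) +
              C * ∫ y in Metric.closedBall y₀ r, ‖v y‖ ^ 2 := by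
  obtain ⟨r₀, hr₀, hrU, hmain⟩ := local_elliptic p d hU ha hy₀ hsymb
  refine ⟨r₀, hr₀, hrU, fun r hr hrr => ?_⟩
  obtain ⟨⟨C₁, hC₁, h1⟩, h2⟩ := hmain r hrr
  have hBU : Metric.closedBall y₀ r ⊆ U := (Metric.closedBall_subset_closedBall hrr).trans hrU
  have hBc : IsCompact (Metric.closedBall y₀ r) := isCompact_closedBall y₀ r
  let χ : ContDiffBump y₀ := ⟨r / 2, r, by positivity, by linarith⟩
  have hχ1 : ∀ y, |χ y| ≤ 1 := fun y => by rw [abs_of_nonneg χ.nonneg]; exact χ.le_one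
  have hχs : tsupport χ = Metric.closedBall y₀ r := χ.tsupport_eq
  obtain ⟨D, hD, hcut⟩ := varOp_cutoff_bound p d hU ha (χ := χ) χ.contDiff.contDiffOn hχ1 hBc hBU
  have hcont : ∀ v : EuclideanSpace ℝ (Fin n) → V, ContDiffOn ℝ ∞ v U → ∀ w,
      ContinuousOn (wordOp coordField w v) (Metric.closedBall y₀ r) := fun v hv w =>
    ((wordOp_contDiffOn hU (fun i => coordField_contDiffOn i) w hv).continuousOn).mono hBU
  have hw : ∀ v : EuclideanSpace ℝ (Fin n) → V, ContDiffOn ℝ ∞ v U →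
      ContDiff ℝ ∞ (fun z => χ z • v z) := by
    intro v hv
    -- `v` is smooth only on `U`; the product is smooth everywhere because the support of the bump
    -- lies in `U`.
    refine contMDiff_iff_contDiff.1 (contMDiff_of_tsupport fun x hx => ?_)
    have hxU : x ∈ U := hBU (hχs ▸ tsupport_smul_subset_left _ _ hx)
    exact (χ.contDiff.contDiffAt.smul (hv.contDiffAt (hU.mem_nhds hxU))).contMDiffAt
  have hws : ∀ v : EuclideanSpace ℝ (Fin n) → V,
      tsupport (fun z => χ z • v z) ⊆ Metric.closedBall y₀ r := fun v =>
    (tsupport_smul_subset_left _ _).trans hχs.le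
  have hP : ∀ v : EuclideanSpace ℝ (Fin n) → V, ContDiffOn ℝ ∞ v U →
      ∫ y in Metric.closedBall y₀ r, ‖varOp p d a (fun z => χ z • v z) y‖ ^ 2 ≤
        2 * (∫ y in Metric.closedBall y₀ r, ‖varOp p d a v y‖ ^ 2) +
        D * ∫ y in Metric.closedBall y₀ r, ∑ β ∈ multiIdx n p (d - 1),
                ‖wordOp coordField (sortedWord β) v y‖ ^ 2 := by
    intro v hv
    have i1 := integrableOn_norm_sq_of_continuousOn hBc ((varOp_continuousOn p d hU ha hv).mono hBU)
    have i2 : IntegrableOn (fun y => ∑ β ∈ multiIdx n p (d - 1),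
        ‖wordOp coordField (sortedWord β) v y‖ ^ 2) (Metric.closedBall y₀ r) :=
      integrable_finsetSum _ fun β _ => integrableOn_norm_sq_of_continuousOn hBc (hcont v hv _)
    rw [← integral_const_mul, ← integral_const_mul, ← integral_add (i1.const_mul 2) (i2.const_mul D)]
    exact setIntegral_mono_on (integrableOn_norm_sq_of_continuousOn hBc
      ((varOp_continuousOn p d hU ha (hw v hv).contDiffOn).mono hBU))
      ((i1.const_mul 2).add (i2.const_mul D)) Metric.isClosed_closedBall.measurableSet (hcut v hv)
  have hL : ∀ v : EuclideanSpace ℝ (Fin n) → V, ContDiffOn ℝ ∞ v U →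
      ∫ y in Metric.closedBall y₀ r, ‖χ y • v y‖ ^ 2 ≤
        ∫ y in Metric.closedBall y₀ r, ‖v y‖ ^ 2 := by
    intro v hv
    refine setIntegral_mono_on (integrableOn_norm_sq_of_continuousOn hBc
      (hw v hv).continuous.continuousOn) (integrableOn_norm_sq_of_continuousOn hBc
      (hv.continuousOn.mono hBU)) Metric.isClosed_closedBall.measurableSet fun y _ => ?_
    rw [norm_smul, mul_pow, Real.norm_eq_abs]
    exact mul_le_of_le_one_left (by positivity) (pow_le_one₀ (abs_nonneg _) (hχ1 y))
  have hI : ∀ v : EuclideanSpace ℝ (Fin n) → V, ContDiffOn ℝ ∞ v U → ∀ α,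
      ∫ y in Metric.ball y₀ (r / 2), ‖wordOp coordField (sortedWord α) v y‖ ^ 2 ≤
      ∫ y in Metric.closedBall y₀ r,
        ‖wordOp coordField (sortedWord α) (fun z => χ z • v z) y‖ ^ 2 := by
    intro v hv α
    have heq : EqOn (wordOp coordField (sortedWord α) v)
        (wordOp coordField (sortedWord α) (fun z => χ z • v z)) (Metric.ball y₀ (r / 2)) := by
      refine wordOp_congr Metric.isOpen_ball _ _ fun y hy => ?_
      have : χ y = 1 := χ.one_of_mem_closedBall (Metric.ball_subset_closedBall hy)
      simp [this]
    rw [setIntegral_congr_fun Metric.isOpen_ball.measurableSet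
      (fun y hy => congrArg (fun z => ‖z‖ ^ 2) (heq hy))]
    refine setIntegral_mono_set (integrableOn_norm_sq_of_continuousOn hBc
      (wordOp_coordField_contDiff _ (hw v hv)).continuous.continuousOn)
      (.of_forall fun y => by positivity) (LE.le.eventuallyLE ?_)
    exact Metric.ball_subset_closedBall.trans (Metric.closedBall_subset_closedBall (by linarith))
  constructor
  · refine ⟨C₁ * (2 + D), by positivity, fun v hv α hα => ?_⟩
    have e1 := h1 _ (hw v hv) (hws v) α hα
    have e2 := hP v hv
    have e3 := hL v hv
    refine (hI v hv α).trans (e1.trans ?_)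
    have p1 : 0 ≤ ∫ y in Metric.closedBall y₀ r, ‖varOp p d a v y‖ ^ 2 := by positivity
    have p2 : 0 ≤ ∫ y in Metric.closedBall y₀ r, ∑ β ∈ multiIdx n p (d - 1),
                ‖wordOp coordField (sortedWord β) v y‖ ^ 2 := by positivity
    have p3 : 0 ≤ ∫ y in Metric.closedBall y₀ r, ‖v y‖ ^ 2 := by positivity
    rw [mul_assoc]
    gcongr
    nlinarith [mul_nonneg hD p1, mul_nonneg hD p3]
  · intro ε hε
    -- 2 + D bounds both factors that `hP` introduces when the cutoff is removed from the operator
    -- term.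
    obtain ⟨C, hC, h⟩ := h2 (ε / (2 + D)) (by positivity)
    refine ⟨C, hC, fun v hv α hα => ?_⟩
    have e1 := h _ (hw v hv) (hws v) α hα
    have e2 := hP v hv
    have e3 := mul_le_mul_of_nonneg_left (hL v hv) hC
    have p1 : 0 ≤ ∫ y in Metric.closedBall y₀ r, ‖varOp p d a v y‖ ^ 2 := by positivity
    have p2 : 0 ≤ ∫ y in Metric.closedBall y₀ r, ∑ β ∈ multiIdx n p (d - 1),
                ‖wordOp coordField (sortedWord β) v y‖ ^ 2 := by positivity
    refine (hI v hv α).trans (e1.trans (add_le_add ?_ e3))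
    rw [div_mul_eq_mul_div, div_le_iff₀ (by positivity), mul_assoc]
    gcongr
    nlinarith [mul_nonneg hD p1]

end Interior

/-! ### Transport to foliation charts -/

section Transport

variable {n : ℕ} {M : Type*} [TopologicalSpace M] [ChartedSpace (EuclideanSpace ℝ (Fin n)) M]
  [IsManifold (𝓡 n) ∞ M] {V : Type*} [NormedAddCommGroup V] [NormedSpace ℝ V]
  {φ : OpenPartialHomeomorph M (EuclideanSpace ℝ (Fin n))}

/-- The part of the chart domain in `ℝⁿ` that corresponds to the set `A`. -/
def chartDom (φ : OpenPartialHomeomorph M (EuclideanSpace ℝ (Fin n))) (A : Set M) :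
    Set (EuclideanSpace ℝ (Fin n)) := φ.target ∩ φ.symm ⁻¹' A

theorem isOpen_chartDom {A : Set M} (hA : IsOpen A) : IsOpen (chartDom φ A) :=
  φ.isOpen_inter_preimage_symm hA

theorem mem_chartDom {A : Set M} {x : M} (hx : x ∈ φ.source) (hA : x ∈ A) :
    φ x ∈ chartDom φ A :=
  ⟨φ.map_source hx, by simpa [φ.left_inv hx] using hA⟩

theorem comp_symm_contDiffOn (hφ : φ ∈ IsManifold.maximalAtlas (𝓡 n) ∞ M) {A : Set M}
    {f : M → V} (hf : ContMDiffOn (𝓡 n) 𝓘(ℝ, V) ∞ f A) :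
    ContDiffOn ℝ ∞ (fun y => f (φ.symm y)) (chartDom φ A) := by
  rw [← contMDiffOn_iff_contDiffOn]
  exact hf.comp ((contMDiffOn_symm_of_mem_maximalAtlas hφ).mono inter_subset_left)
    fun y hy => hy.2

/-- The vector field `X` in the chart `φ`. -/
def chartField (φ : OpenPartialHomeomorph M (EuclideanSpace ℝ (Fin n)))
    (X : (x : M) → TangentSpace (𝓡 n) x) : EuclideanSpace ℝ (Fin n) → EuclideanSpace ℝ (Fin n) :=
  fun y => fieldDeriv n X φ (φ.symm y)

theorem chartField_contDiffOn (hφ : φ ∈ IsManifold.maximalAtlas (𝓡 n) ∞ M) {A : Set M}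
    (hA : IsOpen A) {X : (x : M) → TangentSpace (𝓡 n) x}
    (hX : ContMDiffOn (𝓡 n) (𝓡 n).tangent ∞
      (fun x => (⟨x, X x⟩ : TangentBundle (𝓡 n) M)) A) :
    ContDiffOn ℝ ∞ (chartField φ X) (chartDom φ A) := by
  have h1 := fieldDeriv_contMDiffOn (n := n) (hA.inter φ.open_source) (hX.mono inter_subset_left)
    ((contMDiffOn_of_mem_maximalAtlas hφ).mono inter_subset_right)
  exact (comp_symm_contDiffOn hφ h1).mono fun y hy => ⟨hy.1, hy.2, φ.map_target hy.1⟩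

/-- The chain rule for `f = (f ∘ φ.symm) ∘ φ`, valid near the point. -/
theorem fieldDeriv_eq_dirDeriv (hφ : φ ∈ IsManifold.maximalAtlas (𝓡 n) ∞ M) {A : Set M}
    (hA : IsOpen A) (X : (x : M) → TangentSpace (𝓡 n) x) {f : M → V}
    (hf : ContMDiffOn (𝓡 n) 𝓘(ℝ, V) ∞ f A) {y : EuclideanSpace ℝ (Fin n)} (hy : y ∈ chartDom φ A) :
    fieldDeriv n X f (φ.symm y) = dirDeriv (chartField φ X) (fun z => f (φ.symm z)) y := by
  have hx : φ.symm y ∈ φ.source := φ.map_target hy.1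
  have hxy : φ (φ.symm y) = y := φ.right_inv hy.1
  have d1 : DifferentiableAt ℝ (fun z => f (φ.symm z)) (φ (φ.symm y)) := by
    rw [hxy]
    exact differentiableAt_of_contDiffOn (isOpen_chartDom hA) (comp_symm_contDiffOn hφ hf) hy
  have d2 : MDifferentiableAt (𝓡 n) (𝓡 n) φ (φ.symm y) :=
    (contMDiffAt_of_mem_maximalAtlas hφ hx).mdifferentiableAt (by simp)
  have heq : f =ᶠ[𝓝 (φ.symm y)] (fun z => f (φ.symm z)) ∘ φ :=
    Filter.eventuallyEq_of_mem (φ.open_source.mem_nhds hx) fun x hx => by simp [φ.left_inv hx]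
  have h1 : mfderiv (𝓡 n) 𝓘(ℝ, V) ((fun z => f (φ.symm z)) ∘ φ) (φ.symm y) = _ :=
    mfderiv_comp (φ.symm y) d1.mdifferentiableAt d2
  simp only [fieldDeriv, dirDeriv, chartField]
  rw [heq.mfderiv_eq]
  have h2 := congrArg (fun L : _ →L[ℝ] _ => L (X (φ.symm y))) h1
  refine h2.trans ?_
  rw [mfderiv_eq_fderiv]
  exact congrArg (fun z => (fderiv ℝ (fun z => f (φ.symm z)) z :
    EuclideanSpace ℝ (Fin n) →L[ℝ] V) (fieldDeriv n X φ (φ.symm y))) hxy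

/-- Smoothness and the identity are proved in one induction, since the chain rule for the next
letter needs the smoothness of everything to its right. -/
theorem foldr_fieldDeriv_eq_wordOp (hφ : φ ∈ IsManifold.maximalAtlas (𝓡 n) ∞ M) {A : Set M}
    (hA : IsOpen A) {X : Fin n → (x : M) → TangentSpace (𝓡 n) x}
    (hX : ∀ i, ContMDiffOn (𝓡 n) (𝓡 n).tangent ∞
      (fun x => (⟨x, X i x⟩ : TangentBundle (𝓡 n) M)) A) (w : List (Fin n)) {f : M → V}
    (hf : ContMDiffOn (𝓡 n) 𝓘(ℝ, V) ∞ f A) :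
    ContMDiffOn (𝓡 n) 𝓘(ℝ, V) ∞ (w.foldr (fun i v => fieldDeriv n (X i) v) f) A ∧
    ∀ y ∈ chartDom φ A, w.foldr (fun i v => fieldDeriv n (X i) v) f (φ.symm y) =
      wordOp (fun i => chartField φ (X i)) w (fun z => f (φ.symm z)) y := by
  induction w with
  | nil => exact ⟨hf, fun y _ => rfl⟩
  | cons i w ih =>
    refine ⟨fieldDeriv_contMDiffOn hA (hX i) ih.1, fun y hy => ?_⟩
    refine (fieldDeriv_eq_dirDeriv hφ hA (X i) ih.1 hy).trans ?_
    exact dirDeriv_congr (isOpen_chartDom hA) _ (fun z hz => ih.2 z hz) hy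

variable {m p : ℕ} {E : M → Type*} [∀ x, NormedAddCommGroup (E x)]
  [∀ x, InnerProductSpace ℂ (E x)] [TopologicalSpace (TotalSpace (EuclideanSpace ℂ (Fin m)) E)]
  [FiberBundle (EuclideanSpace ℂ (Fin m)) E] [VectorBundle ℂ (EuclideanSpace ℂ (Fin m)) E]
  {H : (x : M) → Submodule ℝ (TangentSpace (𝓡 n) x)} {J : Type*}

/-- A foliation chart carries `H` to the span of the first p coordinate vectors, so a frame adapted
to `H` becomes an adapted frame of ℝⁿ. This is what makes the weights of frame and coordinate
monomials comparable. -/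
theorem SobolevData.adaptedFrame (S : SobolevData n m p E H J) (hφ : IsFoliationChart n p H φ)
    (j : J) : AdaptedFrame p (chartDom φ (S.U j)) fun i => chartField φ (S.X j i) where
  smooth i := chartField_contDiffOn hφ.1 (S.isOpen j) (S.smooth j i)
  linearIndependent y hy := by
    have hx : φ.symm y ∈ φ.source := φ.map_target hy.1
    have hmd : φ.MDifferentiable (𝓡 n) (𝓡 n) :=
      ⟨(contMDiffOn_of_mem_maximalAtlas hφ.1).mdifferentiableOn (by simp),
        (contMDiffOn_symm_of_mem_maximalAtlas hφ.1).mdifferentiableOn (by simp)⟩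
    have hinj := hmd.mfderiv_injective hx
    exact (S.linearIndependent j _ hy.2).map' (mfderiv (𝓡 n) (𝓡 n) φ (φ.symm y)).toLinearMap
      (LinearMap.ker_eq_bot.2 hinj)
  mem i hi y hy := by
    have hx : φ.symm y ∈ φ.source := φ.map_target hy.1
    refine (hφ.2 _ hx _).1 ?_
    rw [← S.span_eq j _ hy.2]
    exact Submodule.subset_span ⟨i, hi, rfl⟩

/-- The components of a section in a chart and a trivialization. -/
def chartRep (φ : OpenPartialHomeomorph M (EuclideanSpace ℝ (Fin n)))
    (e : Trivialization (EuclideanSpace ℂ (Fin m))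
      (TotalSpace.proj : TotalSpace (EuclideanSpace ℂ (Fin m)) E → M))
    (s : (x : M) → E x) (y : EuclideanSpace ℝ (Fin n)) : EuclideanSpace ℂ (Fin m) :=
  comp m e s (φ.symm y)

theorem chartRep_contDiffOn (hφ : φ ∈ IsManifold.maximalAtlas (𝓡 n) ∞ M)
    (e : Trivialization (EuclideanSpace ℂ (Fin m))
      (TotalSpace.proj : TotalSpace (EuclideanSpace ℂ (Fin m)) E → M)) [MemTrivializationAtlas e]
    (u : Sec n m E) : ContDiffOn ℝ ∞ (chartRep φ e u.1) (chartDom φ e.baseSet) :=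
  comp_symm_contDiffOn hφ (u.2 e)

/-- The squared norms of all derivatives of weighted order `≤ k` of the components. -/
def chartJetSq (p k : ℕ) (φ : OpenPartialHomeomorph M (EuclideanSpace ℝ (Fin n)))
    (e : Trivialization (EuclideanSpace ℂ (Fin m))
      (TotalSpace.proj : TotalSpace (EuclideanSpace ℂ (Fin m)) E → M))
    (u : Sec n m E) (y : EuclideanSpace ℝ (Fin n)) : ℝ :=
  ∑ α ∈ multiIdx n p k, ‖wordOp coordField (sortedWord α) (chartRep φ e u.1) y‖ ^ 2

/-- The pointwise sum of squares that defines the weighted Sobolev norm. -/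
def SobolevData.densitySq [Fintype J] (S : SobolevData n m p E H J) (k : ℕ) (u : Sec n m E)
    (x : M) : ℝ :=
  ∑ j, ∑ α ∈ multiIdx n p k, ‖S.term j α u x‖ ^ 2

theorem SobolevData.densitySq_nonneg [Fintype J] (S : SobolevData n m p E H J) (k : ℕ)
    (u : Sec n m E) (x : M) : 0 ≤ S.densitySq k u x :=
  Finset.sum_nonneg fun _ _ => Finset.sum_nonneg fun _ _ => by positivity

theorem SobolevData.densitySq_continuous [Fintype J] (S : SobolevData n m p E H J) (k : ℕ)
    (u : Sec n m E) : Continuous (S.densitySq k u) :=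
  continuous_finsetSum _ fun j _ => continuous_finsetSum _ fun α _ =>
    (S.term_continuous j α u).norm.pow 2

theorem SobolevData.term_eq (S : SobolevData n m p E H J) (hφ : IsFoliationChart n p H φ) (j : J)
    (α : Fin n → ℕ) (u : Sec n m E) {y : EuclideanSpace ℝ (Fin n)}
    (hy : y ∈ chartDom φ (S.U j)) : S.term j α u (φ.symm y) = S.φ j (φ.symm y) •
      wordOp (fun i => chartField φ (S.X j i)) (sortedWord α) (chartRep φ (S.triv j) u.1) y := by
  have := (foldr_fieldDeriv_eq_wordOp hφ.1 (S.isOpen j) (S.smooth j) (sortedWord α)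
    (S.comp_smooth j u)).2 y hy
  simp only [SobolevData.term]
  rw [monomialOp_eq_foldr]
  exact congrArg _ this

variable [SmoothHermitianBundle n m E]

/-- The change of trivialization in a chart. -/
def chartCoordChange (φ : OpenPartialHomeomorph M (EuclideanSpace ℝ (Fin n)))
    (e e' : Trivialization (EuclideanSpace ℂ (Fin m))
      (TotalSpace.proj : TotalSpace (EuclideanSpace ℂ (Fin m)) E → M))
    [MemTrivializationAtlas e] [MemTrivializationAtlas e'] (y : EuclideanSpace ℝ (Fin n)) :
    EuclideanSpace ℂ (Fin m) →L[ℝ] EuclideanSpace ℂ (Fin m) :=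
  (e.coordChangeL ℂ e' (φ.symm y) :
    EuclideanSpace ℂ (Fin m) →L[ℂ] EuclideanSpace ℂ (Fin m)).restrictScalars ℝ

theorem chartCoordChange_contDiffOn (hφ : φ ∈ IsManifold.maximalAtlas (𝓡 n) ∞ M)
    (e e' : Trivialization (EuclideanSpace ℂ (Fin m))
      (TotalSpace.proj : TotalSpace (EuclideanSpace ℂ (Fin m)) E → M))
    [MemTrivializationAtlas e] [MemTrivializationAtlas e'] :
    ContDiffOn ℝ ∞ (chartCoordChange φ e e') (chartDom φ (e.baseSet ∩ e'.baseSet)) := by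
  have h := comp_symm_contDiffOn hφ (SmoothHermitianBundle.coordChange (n := n) e e')
  exact (ContinuousLinearMap.restrictScalarsL ℂ (EuclideanSpace ℂ (Fin m))
    (EuclideanSpace ℂ (Fin m)) ℝ ℝ).contDiff.comp_contDiffOn h

theorem chartRep_eq_coordChange (e e' : Trivialization (EuclideanSpace ℂ (Fin m))
      (TotalSpace.proj : TotalSpace (EuclideanSpace ℂ (Fin m)) E → M))
    [MemTrivializationAtlas e] [MemTrivializationAtlas e'] (s : (x : M) → E x)
    {y : EuclideanSpace ℝ (Fin n)} (hy : y ∈ chartDom φ (e.baseSet ∩ e'.baseSet)) :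
    chartRep φ e' s y = chartCoordChange φ e e' y (chartRep φ e s y) := by
  unfold chartCoordChange chartRep comp
  rw [ContinuousLinearMap.coe_restrictScalars', ContinuousLinearEquiv.coe_coe,
    Trivialization.coordChangeL_apply e e' hy.2, Trivialization.symm_apply_apply_mk e hy.2.1]

theorem sum_sq_le_of_le_sum {ι : Type*} (s : Finset ι) {f g : ι → ℝ} (hf : ∀ i, 0 ≤ f i)
    {C : ι → ℝ} (h : ∀ i ∈ s, f i ≤ C i * ∑ k ∈ s, g k) :
    ∑ i ∈ s, f i ^ 2 ≤ ((∑ i ∈ s, C i ^ 2) * s.card) * ∑ k ∈ s, g k ^ 2 := by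
  calc ∑ i ∈ s, f i ^ 2 ≤ ∑ i ∈ s, C i ^ 2 * (s.card * ∑ k ∈ s, g k ^ 2) := by
        refine Finset.sum_le_sum fun i hi => ?_
        calc f i ^ 2 ≤ (C i * ∑ k ∈ s, g k) ^ 2 := pow_le_pow_left₀ (hf i) (h i hi) 2
          _ = C i ^ 2 * (∑ k ∈ s, g k) ^ 2 := mul_pow _ _ _
          _ ≤ _ := by gcongr; exact sq_sum_le_card_mul_sum_sq
    _ = _ := by rw [← Finset.sum_mul, mul_assoc]

variable [Fintype J]

/-- The Sobolev density is bounded by the derivatives in a foliation chart. -/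
theorem SobolevData.densitySq_le (S : SobolevData n m p E H J) (k : ℕ)
    (hφ : IsFoliationChart n p H φ) (e : Trivialization (EuclideanSpace ℂ (Fin m))
      (TotalSpace.proj : TotalSpace (EuclideanSpace ℂ (Fin m)) E → M)) [MemTrivializationAtlas e]
    {x₀ : M} (hx₀ : x₀ ∈ φ.source) (he : x₀ ∈ e.baseSet) :
    ∃ N ∈ 𝓝 (φ x₀), ∃ C : ℝ, 0 ≤ C ∧ ∀ u : Sec n m E, ∀ y ∈ N,
      S.densitySq k u (φ.symm y) ≤ C * chartJetSq p k φ e u y := by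
  have hone : ∀ j, ∃ N ∈ 𝓝 (φ x₀), ∃ C : ℝ, 0 ≤ C ∧ ∀ u : Sec n m E, ∀ y ∈ N,
      ∑ α ∈ multiIdx n p k, ‖S.term j α u (φ.symm y)‖ ^ 2 ≤ C * chartJetSq p k φ e u y := by
    intro j
    have htm := S.triv_mem j
    by_cases hj : x₀ ∈ S.U j
    · set A : Set M := S.U j ∩ e.baseSet
      have hA : IsOpen A := (S.isOpen j).inter e.open_baseSet
      have hU : IsOpen (chartDom φ A) := isOpen_chartDom hA
      have hfr := S.adaptedFrame hφ j
      have hfr' : AdaptedFrame p (chartDom φ A) fun i => chartField φ (S.X j i) :=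
        ⟨fun i => (hfr.smooth i).mono fun y hy => ⟨hy.1, hy.2.1⟩,
          fun y hy => hfr.linearIndependent y ⟨hy.1, hy.2.1⟩,
          fun i hi y hy => hfr.mem i hi y ⟨hy.1, hy.2.1⟩⟩
      have hg := (chartCoordChange_contDiffOn hφ.1 e (S.triv j)).mono
        (t := chartDom φ A) fun y hy => ⟨hy.1, hy.2.2, S.subset_baseSet j hy.2.1⟩
      have h1 := fun α (hα : α ∈ multiIdx n p k) =>
        hfr'.frame_le_coord hU hg hα (mem_chartDom hx₀ ⟨hj, he⟩)
      choose! N hN C hC hb using h1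
      refine ⟨(⋂ α ∈ multiIdx n p k, N α) ∩ chartDom φ A, Filter.inter_mem
        ((Filter.biInter_finset_mem _).2 hN) (hU.mem_nhds (mem_chartDom hx₀ ⟨hj, he⟩)),
        (∑ α ∈ multiIdx n p k, C α ^ 2) * (multiIdx n p k).card, by positivity,
        fun u y hy => ?_⟩
      refine sum_sq_le_of_le_sum (multiIdx n p k) (fun _ => norm_nonneg _) fun α hα => ?_
      rw [S.term_eq hφ j α u ⟨hy.2.1, hy.2.2.1⟩, norm_smul]
      have h2 := hb α hα (chartRep φ e u.1) ((chartRep_contDiffOn hφ.1 e u).mono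
        fun y hy => ⟨hy.1, hy.2.2⟩) y (by have := hy.1; simp only [mem_iInter] at this; exact this α hα)
      have h3 : EqOn (chartRep φ (S.triv j) u.1)
          (fun y => chartCoordChange φ e (S.triv j) y (chartRep φ e u.1 y)) (chartDom φ A) :=
        fun z hz => chartRep_eq_coordChange e (S.triv j) u.1
          ⟨hz.1, hz.2.2, S.subset_baseSet j hz.2.1⟩
      rw [wordOp_congr hU _ _ h3 hy.2]
      refine le_trans (mul_le_of_le_one_left (norm_nonneg _) ?_) h2
      rw [Real.norm_eq_abs, abs_of_nonneg (S.φ.nonneg j _)]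
      exact S.φ.le_one j _
    -- Outside `U j` nothing is known about the frame, but the point is off the closed support of
    -- the cutoff, which therefore vanishes on a whole neighbourhood.
    · have hx : x₀ ∉ tsupport (S.φ j) := fun h => hj (S.subordinate j h)
      have hA : IsOpen (tsupport (S.φ j))ᶜ := (isClosed_tsupport _).isOpen_compl
      refine ⟨chartDom φ (tsupport (S.φ j))ᶜ, (isOpen_chartDom hA).mem_nhds (mem_chartDom hx₀ hx),
        0, le_rfl, fun u y hy => ?_⟩
      have : S.φ j (φ.symm y) = 0 := image_eq_zero_of_notMem_tsupport hy.2
      simp [SobolevData.term, this]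
  choose N hN C hC hb using hone
  refine ⟨⋂ j, N j, Filter.iInter_mem.2 hN, ∑ j, C j, Finset.sum_nonneg fun j _ => hC j,
    fun u y hy => ?_⟩
  rw [SobolevData.densitySq, Finset.sum_mul]
  exact Finset.sum_le_sum fun j _ => hb j u y (mem_iInter.1 hy j)

/-- The derivatives in a foliation chart are bounded by the Sobolev density. -/
theorem SobolevData.le_densitySq (S : SobolevData n m p E H J) (k : ℕ)
    (hφ : IsFoliationChart n p H φ) (e : Trivialization (EuclideanSpace ℂ (Fin m))
      (TotalSpace.proj : TotalSpace (EuclideanSpace ℂ (Fin m)) E → M)) [MemTrivializationAtlas e]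
    {x₀ : M} (hx₀ : x₀ ∈ φ.source) (he : x₀ ∈ e.baseSet) :
    ∃ N ∈ 𝓝 (φ x₀), ∃ C : ℝ, 0 ≤ C ∧ ∀ u : Sec n m E, ∀ y ∈ N,
      chartJetSq p k φ e u y ≤ C * S.densitySq k u (φ.symm y) := by
  -- One member of the partition that is positive at `x₀` is enough: near `x₀` it exceeds half its
  -- value there and can be divided out.
  obtain ⟨j, hj0⟩ : ∃ j, 0 < S.φ j x₀ := S.φ.exists_pos_of_mem (mem_univ x₀)
  have hj : x₀ ∈ S.U j := by
    by_contra h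
    exact hj0.ne' (S.φ_eq_zero j h)
  have htm := S.triv_mem j
  set A : Set M := S.U j ∩ e.baseSet
  have hA : IsOpen A := (S.isOpen j).inter e.open_baseSet
  have hU : IsOpen (chartDom φ A) := isOpen_chartDom hA
  have hfr := S.adaptedFrame hφ j
  have hfr' : AdaptedFrame p (chartDom φ A) fun i => chartField φ (S.X j i) :=
    ⟨fun i => (hfr.smooth i).mono fun y hy => ⟨hy.1, hy.2.1⟩,
      fun y hy => hfr.linearIndependent y ⟨hy.1, hy.2.1⟩,
      fun i hi y hy => hfr.mem i hi y ⟨hy.1, hy.2.1⟩⟩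
  have hg := (chartCoordChange_contDiffOn hφ.1 (S.triv j) e).mono
    (t := chartDom φ A) fun y hy => ⟨hy.1, S.subset_baseSet j hy.2.1, hy.2.2⟩
  have h1 := fun α (hα : α ∈ multiIdx n p k) =>
    hfr'.coord_le_frame hU hg hα (mem_chartDom hx₀ ⟨hj, he⟩)
  choose! N hN C hC hb using h1
  set c : ℝ := S.φ j x₀ / 2
  have hc : 0 < c := by positivity
  have hO : IsOpen {x | c < S.φ j x} := isOpen_lt continuous_const (S.φ j).contMDiff.continuous
  have hOx : x₀ ∈ {x | c < S.φ j x} := by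
    change S.φ j x₀ / 2 < S.φ j x₀
    linarith
  refine ⟨(⋂ α ∈ multiIdx n p k, N α) ∩ chartDom φ A ∩ chartDom φ {x | c < S.φ j x},
    Filter.inter_mem (Filter.inter_mem ((Filter.biInter_finset_mem _).2 hN)
      (hU.mem_nhds (mem_chartDom hx₀ ⟨hj, he⟩)))
      ((isOpen_chartDom hO).mem_nhds (mem_chartDom hx₀ hOx)),
    (∑ α ∈ multiIdx n p k, (C α / c) ^ 2) * (multiIdx n p k).card, by positivity,
    fun u y hy => ?_⟩
  have hstep : chartJetSq p k φ e u y ≤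
      (∑ α ∈ multiIdx n p k, (C α / c) ^ 2) * (multiIdx n p k).card *
        ∑ α ∈ multiIdx n p k, ‖S.term j α u (φ.symm y)‖ ^ 2 := by
    refine sum_sq_le_of_le_sum (multiIdx n p k) (fun _ => norm_nonneg _) fun α hα => ?_
    have h2 := hb α hα (chartRep φ (S.triv j) u.1) ((chartRep_contDiffOn hφ.1 (S.triv j) u).mono
      fun y hy => ⟨hy.1, S.subset_baseSet j hy.2.1⟩) y
      (by have := hy.1.1; simp only [mem_iInter] at this; exact this α hα)
    have h3 : EqOn (chartRep φ e u.1)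
        (fun y => chartCoordChange φ (S.triv j) e y (chartRep φ (S.triv j) u.1 y)) (chartDom φ A) :=
      fun z hz => chartRep_eq_coordChange (S.triv j) e u.1
        ⟨hz.1, S.subset_baseSet j hz.2.1, hz.2.2⟩
    rw [wordOp_congr hU _ _ h3 hy.1.2]
    refine h2.trans ?_
    rw [div_mul_eq_mul_div, ← mul_div_assoc', Finset.sum_div]
    have hCα := hC α hα
    gcongr with β hβ
    rw [S.term_eq hφ j β u ⟨hy.1.2.1, hy.1.2.2.1⟩, norm_smul, Real.norm_eq_abs,
      abs_of_nonneg (S.φ.nonneg j _), le_div_iff₀ hc, mul_comm]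
    gcongr
    exact (show c < S.φ j (φ.symm y) from hy.2.2).le
  refine hstep.trans ?_
  gcongr
  exact Finset.single_le_sum (f := fun j => ∑ α ∈ multiIdx n p k, ‖S.term j α u (φ.symm y)‖ ^ 2)
    (fun _ _ => Finset.sum_nonneg fun _ _ => by positivity) (Finset.mem_univ j)

end Transport

/-! ### Comparison of fibre norms and of measures with their coordinate expressions -/

section FibreNorm

variable {n : ℕ} {M : Type*} [TopologicalSpace M] [ChartedSpace (EuclideanSpace ℝ (Fin n)) M]
  {m : ℕ} {E : M → Type*} [∀ x, NormedAddCommGroup (E x)]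
  [∀ x, InnerProductSpace ℂ (E x)] [TopologicalSpace (TotalSpace (EuclideanSpace ℂ (Fin m)) E)]
  [FiberBundle (EuclideanSpace ℂ (Fin m)) E] [VectorBundle ℂ (EuclideanSpace ℂ (Fin m)) E]

theorem comp_symm (e : Trivialization (EuclideanSpace ℂ (Fin m))
      (TotalSpace.proj : TotalSpace (EuclideanSpace ℂ (Fin m)) E → M))
    [MemTrivializationAtlas e] (c : EuclideanSpace ℂ (Fin m)) {x : M} (hx : x ∈ e.baseSet) :
    comp m e (fun x => e.symm x c) x = c := by
  simp [comp, e.apply_mk_symm hx]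

theorem symm_comp (e : Trivialization (EuclideanSpace ℂ (Fin m))
      (TotalSpace.proj : TotalSpace (EuclideanSpace ℂ (Fin m)) E → M))
    [MemTrivializationAtlas e] (s : (x : M) → E x) {x : M} (hx : x ∈ e.baseSet) :
    e.symm x (comp m e s x) = s x :=
  e.symm_apply_apply_mk hx (s x)

variable (n)

/-- Smoothness of the metric is given for fixed pairs of vectors; expanding the norm through the
Gram matrix gives continuity jointly in the point and the vector. -/
theorem continuousOn_norm_symm [SmoothHermitianBundle n m E]
    (e : Trivialization (EuclideanSpace ℂ (Fin m))
      (TotalSpace.proj : TotalSpace (EuclideanSpace ℂ (Fin m)) E → M))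
    [MemTrivializationAtlas e] :
    ContinuousOn (fun q : M × EuclideanSpace ℂ (Fin m) => ‖e.symm q.1 q.2‖)
      (e.baseSet ×ˢ univ) := by
  have hmain : ContinuousOn (fun q : M × EuclideanSpace ℂ (Fin m) => Real.sqrt
      (∑ i, ∑ j, (starRingEnd ℂ (q.2 i) * (q.2 j *
      inner ℂ (e.symm q.1 (EuclideanSpace.single i 1))
        (e.symm q.1 (EuclideanSpace.single j 1))))).re) (e.baseSet ×ˢ univ) := by
    refine (Real.continuous_sqrt.comp Complex.continuous_re).comp_continuousOn ?_
    refine continuousOn_finsetSum _ fun i _ => continuousOn_finsetSum _ fun j _ => ?_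
    have hc : ∀ i, Continuous fun q : M × EuclideanSpace ℂ (Fin m) => q.2 i := fun i =>
      (EuclideanSpace.proj (𝕜 := ℂ) i).continuous.comp continuous_snd
    refine (Complex.continuous_conj.comp (hc i)).continuousOn.mul ((hc j).continuousOn.mul ?_)
    exact (SmoothHermitianBundle.metric (n := n) e _ _).continuousOn.comp continuousOn_fst
      fun q hq => hq.1
  refine hmain.congr fun q hq => ?_
  have h := norm_eq_of_mem e (fun x => e.symm x q.2) hq.1
  simp only [comp_symm e q.2 hq.1] at h
  exact h

/-- By homogeneity only unit vectors in the model fibre matter. On their compact sphere the fibre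
norm is positive and jointly continuous, so it is bounded above and below uniformly near `x₀`. -/
theorem exists_norm_comparison [SmoothHermitianBundle n m E]
    (e : Trivialization (EuclideanSpace ℂ (Fin m))
      (TotalSpace.proj : TotalSpace (EuclideanSpace ℂ (Fin m)) E → M))
    [MemTrivializationAtlas e] {x₀ : M} (hx₀ : x₀ ∈ e.baseSet) :
    ∃ N ∈ 𝓝 x₀, N ⊆ e.baseSet ∧ ∃ C : ℝ, 0 < C ∧ ∀ (s : (x : M) → E x), ∀ x ∈ N,
      ‖s x‖ ≤ C * ‖comp m e s x‖ ∧ ‖comp m e s x‖ ≤ C * ‖s x‖ := by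
  have hcont := continuousOn_norm_symm n e
  obtain ⟨N, hN, C, hC, h⟩ : ∃ N ∈ 𝓝 x₀, ∃ C : ℝ, 0 < C ∧ ∀ x ∈ N,
      ∀ c ∈ Metric.sphere (0 : EuclideanSpace ℂ (Fin m)) 1,
        ‖e.symm x c‖ ≤ C ∧ 1 ≤ C * ‖e.symm x c‖ := by
    refine (isCompact_sphere (0 : EuclideanSpace ℂ (Fin m)) 1).induction_on
      (p := fun s => ∃ N ∈ 𝓝 x₀, ∃ C : ℝ, 0 < C ∧ ∀ x ∈ N, ∀ c ∈ s,
        ‖e.symm x c‖ ≤ C ∧ 1 ≤ C * ‖e.symm x c‖) ⟨univ, Filter.univ_mem, 1, one_pos, by simp⟩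
      ?_ ?_ ?_
    · rintro s t hst ⟨N, hN, C, hC, h⟩
      exact ⟨N, hN, C, hC, fun x hx c hc => h x hx c (hst hc)⟩
    · rintro s t ⟨N, hN, C, hC, h⟩ ⟨N', hN', C', hC', h'⟩
      refine ⟨N ∩ N', Filter.inter_mem hN hN', C + C', by positivity, fun x hx c hc => ?_⟩
      have h0 := norm_nonneg (e.symm x c)
      rcases hc with hc | hc
      · obtain ⟨h1, h2⟩ := h x hx.1 c hc
        constructor <;> nlinarith
      · obtain ⟨h1, h2⟩ := h' x hx.2 c hc
        constructor <;> nlinarith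
    · intro c hc
      have hpos : 0 < ‖e.symm x₀ c‖ := by
        rw [norm_pos_iff]
        intro h0
        have h1 := comp_symm e c hx₀
        have h2 : comp m e (fun x => e.symm x c) x₀ = 0 := by
          have := (e.linear ℂ hx₀).mk'.map_zero
          simp only [comp, h0]
          exact this
        rw [h1] at h2
        rw [mem_sphere_zero_iff_norm, h2, norm_zero] at hc
        exact zero_ne_one hc
      have hat := hcont.continuousAt (x := (x₀, c))
        (prod_mem_nhds (e.open_baseSet.mem_nhds hx₀) Filter.univ_mem)
      have hev := (hat.eventually (lt_mem_nhds (show ‖e.symm x₀ c‖ / 2 < ‖e.symm x₀ c‖ by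
        linarith))).and (hat.eventually (gt_mem_nhds (show ‖e.symm x₀ c‖ < ‖e.symm x₀ c‖ + 1 by
        linarith)))
      rw [nhds_prod_eq] at hev
      obtain ⟨N, hN, W, hW, hNW⟩ := Filter.mem_prod_iff.1 hev
      -- The first summands give the upper bound and 2/‖·‖ the lower one; their sum serves for both.
      refine ⟨W, mem_nhdsWithin_of_mem_nhds hW, N, hN, ‖e.symm x₀ c‖ + 1 + 2 / ‖e.symm x₀ c‖,
        by positivity, fun x hx c' hc' => ?_⟩
      obtain ⟨h1, h2⟩ := hNW (mk_mem_prod hx hc')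
      have h3 : 0 < 2 / ‖e.symm x₀ c‖ := by positivity
      refine ⟨by simp only at h2; linarith, ?_⟩
      have h4 : 1 ≤ 2 / ‖e.symm x₀ c‖ * ‖e.symm x c'‖ := by
        rw [div_mul_eq_mul_div, le_div_iff₀ hpos]
        simp only at h1
        linarith
      have h5 : 0 ≤ (‖e.symm x₀ c‖ + 1) * ‖e.symm x c'‖ := by positivity
      nlinarith
  refine ⟨N ∩ e.baseSet, Filter.inter_mem hN (e.open_baseSet.mem_nhds hx₀), inter_subset_right,
    C, hC, fun s x hx => ?_⟩
  set v := comp m e s x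
  have hs : s x = e.symm x v := (symm_comp e s hx.2).symm
  by_cases hv : v = 0
  · have h0 : s x = 0 := by
      rw [hs, hv, ← e.coe_symmₗ (R := ℂ) hx.2, map_zero]
    simp [hv, h0]
  · have hvp : 0 < ‖v‖ := norm_pos_iff.2 hv
    have hsm : e.symm x (((‖v‖⁻¹ : ℝ) : ℂ) • v) = ((‖v‖⁻¹ : ℝ) : ℂ) • s x := by
      rw [← e.coe_symmₗ (R := ℂ) hx.2, map_smul, e.coe_symmₗ (R := ℂ) hx.2, hs]
    have hu : ((‖v‖⁻¹ : ℝ) : ℂ) • v ∈ Metric.sphere (0 : EuclideanSpace ℂ (Fin m)) 1 := by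
      rw [mem_sphere_zero_iff_norm, norm_smul]
      simp [hv]
    obtain ⟨h1, h2⟩ := h x hx.1 _ hu
    rw [hsm, norm_smul, Complex.norm_real, norm_inv, norm_norm] at h1 h2
    rw [inv_mul_eq_div, div_le_iff₀ hvp] at h1
    refine ⟨h1, ?_⟩
    have h3 : C * (‖v‖⁻¹ * ‖s x‖) = (C * ‖s x‖) / ‖v‖ := by
      rw [inv_mul_eq_div, mul_div_assoc]
    rw [h3, le_div_iff₀ hvp, one_mul] at h2
    exact h2

end FibreNorm

/-! ### Comparison of the density with Lebesgue measure in a chart -/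

section Density

variable {n : ℕ} {M : Type*} [TopologicalSpace M] [ChartedSpace (EuclideanSpace ℝ (Fin n)) M]
  [MeasurableSpace M] {μ : Measure M}
  {φ : OpenPartialHomeomorph M (EuclideanSpace ℝ (Fin n))}

/-- Near `y₀` the continuous positive density lies between half its value and its value plus 1, so
Lebesgue measure and the image of μ dominate each other there up to a constant. -/
theorem exists_density_bounds (hμ : IsSmoothDensity n μ)
    (hφ : φ ∈ IsManifold.maximalAtlas (𝓡 n) ∞ M) {y₀ : EuclideanSpace ℝ (Fin n)}
    (hy₀ : y₀ ∈ φ.target) :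
    ∃ O ∈ 𝓝 y₀, O ⊆ φ.target ∧ ∃ C : ℝ, 0 ≤ C ∧ ∀ B ⊆ O, MeasurableSet B →
      volume.restrict B ≤ ENNReal.ofReal C • ((μ.restrict φ.source).map φ).restrict B ∧
      ((μ.restrict φ.source).map φ).restrict B ≤ ENNReal.ofReal C • volume.restrict B := by
  obtain ⟨ρ, hρ, hpos, hmap⟩ := hμ φ hφ
  have hat := hρ.continuousOn.continuousAt (φ.open_target.mem_nhds hy₀)
  have h0 := hpos y₀ hy₀
  have hev := (hat.eventually (lt_mem_nhds (show ρ y₀ / 2 < ρ y₀ by linarith))).and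
    (hat.eventually (gt_mem_nhds (show ρ y₀ < ρ y₀ + 1 by linarith)))
  refine ⟨{y | ρ y₀ / 2 < ρ y ∧ ρ y < ρ y₀ + 1} ∩ φ.target,
    Filter.inter_mem hev (φ.open_target.mem_nhds hy₀), inter_subset_right,
    ρ y₀ + 1 + 2 / ρ y₀, by positivity, fun B hB hBm => ?_⟩
  have hBt : B ⊆ φ.target := fun y hy => (hB hy).2
  rw [hmap, restrict_withDensity hBm, Measure.restrict_restrict hBm, inter_eq_left.2 hBt]
  have hq : 0 < 2 / ρ y₀ := by positivity
  constructor
  · calc volume.restrict B = (volume.restrict B).withDensity 1 := withDensity_one.symm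
      _ ≤ (volume.restrict B).withDensity
          (ENNReal.ofReal (ρ y₀ + 1 + 2 / ρ y₀) • fun y => ENNReal.ofReal (ρ y)) := by
          refine withDensity_mono ?_
          filter_upwards [ae_restrict_mem hBm] with y hy
          rw [Pi.smul_apply, smul_eq_mul, ← ENNReal.ofReal_mul (by positivity), Pi.one_apply,
            ENNReal.one_le_ofReal]
          have h1 := (hB hy).1.1
          have h2 : 1 ≤ 2 / ρ y₀ * ρ y := by
            rw [div_mul_eq_mul_div, le_div_iff₀ h0]
            linarith
          have h3 : 0 ≤ (ρ y₀ + 1) * ρ y := by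
            have : 0 < ρ y := by linarith
            positivity
          nlinarith
      _ = _ := withDensity_smul' _ _ ENNReal.ofReal_ne_top
  · calc (volume.restrict B).withDensity (fun y => ENNReal.ofReal (ρ y))
        ≤ (volume.restrict B).withDensity (fun _ => ENNReal.ofReal (ρ y₀ + 1 + 2 / ρ y₀)) := by
          refine withDensity_mono ?_
          filter_upwards [ae_restrict_mem hBm] with y hy
          refine ENNReal.ofReal_le_ofReal ?_
          have := (hB hy).1.2
          linarith
      _ = _ := withDensity_const _

variable [BorelSpace M]

theorem aemeasurable_chart : AEMeasurable φ (μ.restrict φ.source) :=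
  φ.continuousOn.aemeasurable φ.open_source.measurableSet

/-- No measurability of `h` is needed: for lower integrals of arbitrary functions, passing from the
image measure back to μ is still an inequality in this direction. -/
theorem lintegral_comp_symm_le {B : Set (EuclideanSpace ℝ (Fin n))} {c : ENNReal}
    (hB : volume.restrict B ≤ c • ((μ.restrict φ.source).map φ).restrict B) (h : M → ENNReal) :
    ∫⁻ y in B, h (φ.symm y) ≤ c * ∫⁻ x, h x ∂μ := by
  calc ∫⁻ y in B, h (φ.symm y)
      ≤ ∫⁻ y, h (φ.symm y) ∂(c • ((μ.restrict φ.source).map φ).restrict B) :=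
        lintegral_mono' hB le_rfl
    _ = c * ∫⁻ y in B, h (φ.symm y) ∂((μ.restrict φ.source).map φ) := lintegral_smul_measure _ _
    _ ≤ c * ∫⁻ y, h (φ.symm y) ∂((μ.restrict φ.source).map φ) := by
        gcongr; exact Measure.restrict_le_self
    _ ≤ c * ∫⁻ x in φ.source, h (φ.symm (φ x)) ∂μ := by
        gcongr; exact lintegral_map_le _ _
    _ = c * ∫⁻ x in φ.source, h x ∂μ := by
        congr 1
        exact setLIntegral_congr_fun φ.open_source.measurableSet
          fun x hx => by simp only [φ.left_inv hx]
    _ ≤ _ := by gcongr; exact Measure.restrict_le_self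

theorem setIntegral_comp_symm_le {B : Set (EuclideanSpace ℝ (Fin n))} {C : ℝ} (hC : 0 ≤ C)
    (hB : volume.restrict B ≤ ENNReal.ofReal C • ((μ.restrict φ.source).map φ).restrict B)
    {h : M → ℝ} (h0 : ∀ x, 0 ≤ h x) (hi : Integrable h μ)
    (hm : AEStronglyMeasurable (fun y => h (φ.symm y)) (volume.restrict B)) :
    ∫ y in B, h (φ.symm y) ≤ C * ∫ x, h x ∂μ := by
  rw [integral_eq_lintegral_of_nonneg_ae (.of_forall fun y => h0 _) hm,
    integral_eq_lintegral_of_nonneg_ae (.of_forall h0) hi.1]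
  have h1 := lintegral_comp_symm_le hB fun x => ENNReal.ofReal (h x)
  have hfin : ∫⁻ x, ENNReal.ofReal (h x) ∂μ ≠ ⊤ := by
    have := hi.2
    rw [hasFiniteIntegral_iff_ofReal (.of_forall h0)] at this
    exact this.ne
  have h2 := ENNReal.toReal_mono (ENNReal.mul_ne_top ENNReal.ofReal_ne_top hfin) h1
  rwa [ENNReal.toReal_mul, ENNReal.toReal_ofReal hC] at h2

/-- In this direction the change of variables is needed as an equality of lower integrals, so the
integrand must be measurable in the chart; continuity of `h` provides that. -/
theorem setIntegral_le_comp_symm {B : Set (EuclideanSpace ℝ (Fin n))} (hBm : MeasurableSet B)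
    (hBt : B ⊆ φ.target) {C : ℝ} (hC : 0 ≤ C)
    (hB : ((μ.restrict φ.source).map φ).restrict B ≤ ENNReal.ofReal C • volume.restrict B)
    {h : M → ℝ} (h0 : ∀ x, 0 ≤ h x) (hc : Continuous h)
    (hi : IntegrableOn (fun y => h (φ.symm y)) B) :
    ∫ x in φ.source ∩ φ ⁻¹' B, h x ∂μ ≤ C * ∫ y in B, h (φ.symm y) := by
  rw [integral_eq_lintegral_of_nonneg_ae (.of_forall h0) hc.aestronglyMeasurable,
    integral_eq_lintegral_of_nonneg_ae (.of_forall fun y => h0 _) hi.1]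
  have hcont : ContinuousOn (fun y => ENNReal.ofReal (h (φ.symm y))) B :=
    ENNReal.continuous_ofReal.comp_continuousOn
      (hc.comp_continuousOn (φ.symm.continuousOn.mono hBt))
  -- `φ` is continuous only on its source, so the preimage is taken under its extension by a
  -- constant.
  have hNm : MeasurableSet (φ.source ∩ φ ⁻¹' B) := by
    classical
    have hmeas : Measurable (φ.source.piecewise φ fun _ => 0) :=
      φ.continuousOn.measurable_piecewise continuousOn_const φ.open_source.measurableSet
    convert (hmeas hBm).inter φ.open_source.measurableSet using 1
    ext x
    by_cases hx : x ∈ φ.source <;> simp [hx]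
  have h1 : ∫⁻ x in φ.source ∩ φ ⁻¹' B, ENNReal.ofReal (h x) ∂μ ≤
      ENNReal.ofReal C * ∫⁻ y in B, ENNReal.ofReal (h (φ.symm y)) := by
    calc ∫⁻ x in φ.source ∩ φ ⁻¹' B, ENNReal.ofReal (h x) ∂μ
        = ∫⁻ x in φ.source ∩ φ ⁻¹' B, ENNReal.ofReal (h (φ.symm (φ x))) ∂μ :=
          setLIntegral_congr_fun hNm fun x hx => by simp only [φ.left_inv hx.1]
      _ = ∫⁻ x in φ.source, B.indicator (fun y => ENNReal.ofReal (h (φ.symm y))) (φ x) ∂μ := by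
          rw [← lintegral_indicator hNm, ← lintegral_indicator φ.open_source.measurableSet]
          congr 1
          funext x
          by_cases h1 : x ∈ φ.source <;> by_cases h2 : φ x ∈ B <;> simp [h1, h2]
      _ = ∫⁻ y, B.indicator (fun y => ENNReal.ofReal (h (φ.symm y))) y
            ∂((μ.restrict φ.source).map φ) := by
          rw [lintegral_map' ((aemeasurable_indicator_iff hBm).2 (hcont.aemeasurable hBm))
            aemeasurable_chart]
      _ = ∫⁻ y in B, ENNReal.ofReal (h (φ.symm y)) ∂((μ.restrict φ.source).map φ) :=
          lintegral_indicator hBm _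
      _ ≤ ∫⁻ y, ENNReal.ofReal (h (φ.symm y)) ∂(ENNReal.ofReal C • volume.restrict B) :=
          lintegral_mono' hB le_rfl
      _ = _ := lintegral_smul_measure _ _
  have hfin : ∫⁻ y in B, ENNReal.ofReal (h (φ.symm y)) ≠ ⊤ := by
    have := hi.2
    rw [hasFiniteIntegral_iff_ofReal (.of_forall fun y => h0 _)] at this
    exact this.ne
  have h2 := ENNReal.toReal_mono (ENNReal.mul_ne_top ENNReal.ofReal_ne_top hfin) h1
  rwa [ENNReal.toReal_mul, ENNReal.toReal_ofReal hC] at h2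

end Density

/-! ### Global estimates -/

theorem eLpNorm_toReal_sq {X W : Type*} [MeasurableSpace X] [NormedAddCommGroup W] {μ : Measure X}
    {f : X → W} (hf : MemLp f 2 μ) : (eLpNorm f 2 μ).toReal ^ 2 = ∫ x, ‖f x‖ ^ 2 ∂μ := by
  have h0 : 0 ≤ ∫ x, ‖f x‖ ^ 2 ∂μ := by positivity
  rw [hf.eLpNorm_eq_integral_rpow_norm (by norm_num) (by norm_num),
    ENNReal.toReal_ofReal (by positivity)]
  simp only [ENNReal.toReal_ofNat, Real.rpow_ofNat]
  rw [← Real.rpow_natCast, ← Real.rpow_mul h0]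
  norm_num

section Global

variable {n m p d : ℕ} {M : Type*} [TopologicalSpace M] [ChartedSpace (EuclideanSpace ℝ (Fin n)) M]
  [IsManifold (𝓡 n) ∞ M] [CompactSpace M] [MeasurableSpace M] [BorelSpace M]
  {H : (x : M) → Submodule ℝ (TangentSpace (𝓡 n) x)}
  {μ : Measure M} [IsFiniteMeasure μ]
  {E : M → Type*} [∀ x, NormedAddCommGroup (E x)] [∀ x, InnerProductSpace ℂ (E x)]
  [TopologicalSpace (TotalSpace (EuclideanSpace ℂ (Fin m)) E)]
  [FiberBundle (EuclideanSpace ℂ (Fin m)) E] [VectorBundle ℂ (EuclideanSpace ℂ (Fin m)) E]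
  [SmoothHermitianBundle n m E]
  {J : Type*} [Fintype J]

theorem norm_toL2_sq (u : Sec n m E) : ‖toL2 n m E μ u‖ ^ 2 = ∫ x, ‖u.1 x‖ ^ 2 ∂μ := by
  rw [norm_toL2, eLpNorm_toReal_sq (sec_mem_sqInt n m E μ u).2]
  simp

theorem integrable_of_continuous {W : Type*} [NormedAddCommGroup W] {f : M → W}
    (hf : Continuous f) : Integrable f μ :=
  (hf.memLp_of_hasCompactSupport (p := 1) (HasCompactSupport.of_compactSpace _)).integrable le_rfl

theorem SobolevPre.norm_sq_eq_integral (S : SobolevData n m p E H J) (d : ℕ) (u : Sec n m E) :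
    ‖(show SobolevPre S d μ from u)‖ ^ 2 = ∫ x, S.densitySq d u x ∂μ := by
  rw [SobolevPre.norm_sq]
  have hi : ∀ j α, Integrable (fun x => ‖S.term j α u x‖ ^ 2) μ := fun j α =>
    integrable_of_continuous ((S.term_continuous j α u).norm.pow 2)
  unfold SobolevData.densitySq
  rw [integral_finsetSum _ fun j _ => integrable_finsetSum _ fun α _ => hi j α]
  refine Finset.sum_congr rfl fun j _ => ?_
  rw [integral_finsetSum _ fun α _ => hi j α]
  exact Finset.sum_congr rfl fun α _ => eLpNorm_toReal_sq (S.term_memLp j α μ u)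

variable {k : ℕ} {G : M → Type*} [∀ x, NormedAddCommGroup (G x)] [∀ x, InnerProductSpace ℂ (G x)]
  [TopologicalSpace (TotalSpace (EuclideanSpace ℂ (Fin k)) G)]
  [FiberBundle (EuclideanSpace ℂ (Fin k)) G] [VectorBundle ℂ (EuclideanSpace ℂ (Fin k)) G]
  [SmoothHermitianBundle n k G]

theorem IsLocalExpr.chartRep_eq {φ : OpenPartialHomeomorph M (EuclideanSpace ℝ (Fin n))}
    {e : Trivialization (EuclideanSpace ℂ (Fin m))
      (TotalSpace.proj : TotalSpace (EuclideanSpace ℂ (Fin m)) E → M)}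
    {f : Trivialization (EuclideanSpace ℂ (Fin k))
      (TotalSpace.proj : TotalSpace (EuclideanSpace ℂ (Fin k)) G → M)}
    [MemTrivializationAtlas e] [MemTrivializationAtlas f]
    {A : Sec n m E →ₗ[ℂ] Sec n k G}
    {a : (Fin n → ℕ) → M → EuclideanSpace ℂ (Fin m) →L[ℂ] EuclideanSpace ℂ (Fin k)}
    (ha : IsLocalExpr n m k p d A φ e f a) (u : Sec n m E) {y : EuclideanSpace ℝ (Fin n)}
    (hy : y ∈ chartDom φ (e.baseSet ∩ f.baseSet)) :
    chartRep φ f (A u).1 y = varOp p d (fun α y => a α (φ.symm y)) (chartRep φ e u.1) y := by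
  have h := ha.eq_sum u (φ.symm y) ⟨⟨φ.map_target hy.1, hy.2.1⟩, hy.2.2⟩
  rw [φ.right_inv hy.1] at h
  refine h.trans (Finset.sum_congr rfl fun α _ => ?_)
  rw [monomialOp_partialDeriv]
  rfl

theorem IsLocalExpr.contDiffOn {φ : OpenPartialHomeomorph M (EuclideanSpace ℝ (Fin n))}
    (hφ : φ ∈ IsManifold.maximalAtlas (𝓡 n) ∞ M)
    {e : Trivialization (EuclideanSpace ℂ (Fin m))
      (TotalSpace.proj : TotalSpace (EuclideanSpace ℂ (Fin m)) E → M)}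
    {f : Trivialization (EuclideanSpace ℂ (Fin k))
      (TotalSpace.proj : TotalSpace (EuclideanSpace ℂ (Fin k)) G → M)}
    {A : Sec n m E →ₗ[ℂ] Sec n k G}
    {a : (Fin n → ℕ) → M → EuclideanSpace ℂ (Fin m) →L[ℂ] EuclideanSpace ℂ (Fin k)}
    (ha : IsLocalExpr n m k p d A φ e f a) (α : Fin n → ℕ) :
    ContDiffOn ℝ ∞ (fun y => a α (φ.symm y)) (chartDom φ (e.baseSet ∩ f.baseSet)) :=
  (comp_symm_contDiffOn hφ (ha.smooth α)).mono fun _ hy =>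
    ⟨hy.1, ⟨φ.map_target hy.1, hy.2.1⟩, hy.2.2⟩

/-- A differential operator of weighted order `≤ d` is pointwise bounded by the Sobolev density. -/
theorem IsDiffOp.exists_pointwise_bound (hH : IsFoliation n p H) (S : SobolevData n m p E H J)
    {A : Sec n m E →ₗ[ℂ] Sec n k G} (hA : IsDiffOp n m k p d H A) :
    ∃ C : ℝ, 0 ≤ C ∧ ∀ u : Sec n m E, ∀ x, ‖(A u).1 x‖ ^ 2 ≤ C * S.densitySq d u x := by
  suffices hloc : ∀ x₀ : M, ∃ N ∈ 𝓝 x₀, ∃ C : ℝ, 0 ≤ C ∧ ∀ u : Sec n m E, ∀ x ∈ N,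
      ‖(A u).1 x‖ ^ 2 ≤ C * S.densitySq d u x by
    obtain ⟨C, hC, h⟩ := exists_uniform_bound (ι := Sec n m E) (isCompact_univ (X := M))
      (l := fun u x => ‖(A u).1 x‖ ^ 2) (r := fun u x => S.densitySq d u x)
      (fun u x => S.densitySq_nonneg d u x) (fun x₀ _ => hloc x₀)
    exact ⟨C, hC, fun u x => h u x (mem_univ x)⟩
  intro x₀
  obtain ⟨φ, hφ, hx₀⟩ := hH.exists_chart x₀
  set e := trivializationAt (EuclideanSpace ℂ (Fin m)) E x₀
  set f := trivializationAt (EuclideanSpace ℂ (Fin k)) G x₀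
  have he : x₀ ∈ e.baseSet := mem_baseSet_trivializationAt _ _ x₀
  have hf : x₀ ∈ f.baseSet := mem_baseSet_trivializationAt _ _ x₀
  obtain ⟨a, ha⟩ := hA φ hφ e f
  obtain ⟨N₁, hN₁, C₁, hC₁, h1⟩ := S.le_densitySq d hφ e hx₀ he
  obtain ⟨N₂, hN₂, -, C₂, hC₂, h2⟩ := exists_norm_comparison n f hf
  have hU : IsOpen (chartDom φ (e.baseSet ∩ f.baseSet)) :=
    isOpen_chartDom (e.open_baseSet.inter f.open_baseSet)
  have hyU : φ x₀ ∈ chartDom φ (e.baseSet ∩ f.baseSet) := mem_chartDom hx₀ ⟨he, hf⟩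
  have hat := fun α => ((ha.contDiffOn hφ.1 α).continuousOn.continuousAt (hU.mem_nhds hyU)).norm
  have hev : ∀ᶠ y in 𝓝 (φ x₀), ∀ α ∈ multiIdx n p d,
      ‖a α (φ.symm y)‖ ≤ ‖a α (φ.symm (φ x₀))‖ + 1 := by
    rw [Filter.eventually_all_finset]
    intro α _
    exact ((hat α).eventually (gt_mem_nhds (lt_add_one _))).mono fun y hy => hy.le
  set Q : ℝ := ∑ α ∈ multiIdx n p d, (‖a α (φ.symm (φ x₀))‖ + 1) ^ 2
  have hpull : ∀ {s : Set (EuclideanSpace ℝ (Fin n))}, s ∈ 𝓝 (φ x₀) → φ ⁻¹' s ∈ 𝓝 x₀ :=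
    fun hs => (φ.continuousAt hx₀).preimage_mem_nhds hs
  refine ⟨φ ⁻¹' N₁ ∩ N₂ ∩ φ ⁻¹' chartDom φ (e.baseSet ∩ f.baseSet) ∩ φ.source ∩ φ ⁻¹' _,
    Filter.inter_mem (Filter.inter_mem (Filter.inter_mem (Filter.inter_mem (hpull hN₁) hN₂)
    (hpull (hU.mem_nhds hyU))) (φ.open_source.mem_nhds hx₀)) (hpull hev),
    C₂ ^ 2 * (((multiIdx n p d).card * Q) * C₁), by positivity, fun u x hx => ?_⟩
  obtain ⟨⟨⟨⟨hx1, hx2⟩, hx3⟩, hx4⟩, hx5⟩ := hx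
  have hxx : φ.symm (φ x) = x := φ.left_inv hx4
  have e1 := (h2 (A u).1 x hx2).1
  have e2 : comp k f (A u).1 x = chartRep φ f (A u).1 (φ x) := by rw [chartRep, hxx]
  have e3 := h1 u (φ x) hx1
  rw [hxx] at e3
  have e4 : ‖varOp p d (fun α y => a α (φ.symm y)) (chartRep φ e u.1) (φ x)‖ ^ 2 ≤
      ((multiIdx n p d).card * Q) * chartJetSq p d φ e u (φ x) := by
    refine (norm_sum_sq_le _ _).trans ?_
    rw [mul_assoc]
    gcongr
    rw [chartJetSq, Finset.mul_sum]
    refine Finset.sum_le_sum fun α hα => ?_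
    calc _ ≤ (‖a α (φ.symm (φ x))‖ *
          ‖wordOp coordField (sortedWord α) (chartRep φ e u.1) (φ x)‖) ^ 2 := by
          gcongr; exact ContinuousLinearMap.le_opNorm _ _
      _ = ‖a α (φ.symm (φ x))‖ ^ 2 *
          ‖wordOp coordField (sortedWord α) (chartRep φ e u.1) (φ x)‖ ^ 2 := mul_pow _ _ _
      _ ≤ _ := by
          gcongr
          have h5 : ‖a α (φ.symm (φ x))‖ ^ 2 ≤ (‖a α (φ.symm (φ x₀))‖ + 1) ^ 2 := by
            gcongr
            exact hx5 α hα
          exact h5.trans (Finset.single_le_sum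
            (f := fun α => (‖a α (φ.symm (φ x₀))‖ + 1) ^ 2) (fun _ _ => by positivity) hα)
  rw [← ha.chartRep_eq u hx3, ← e2] at e4
  calc ‖(A u).1 x‖ ^ 2 ≤ (C₂ * ‖comp k f (A u).1 x‖) ^ 2 := by gcongr
    _ = C₂ ^ 2 * ‖comp k f (A u).1 x‖ ^ 2 := mul_pow _ _ _
    _ ≤ C₂ ^ 2 * (((multiIdx n p d).card * Q) * (C₁ * S.densitySq d u x)) := by
        gcongr
        refine e4.trans ?_
        gcongr
    _ = _ := by ring

theorem IsDiffOp.exists_bound (hH : IsFoliation n p H) (S : SobolevData n m p E H J)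
    {A : Sec n m E →ₗ[ℂ] Sec n k G} (hA : IsDiffOp n m k p d H A) :
    ∃ C : ℝ, 0 ≤ C ∧ ∀ u : Sec n m E,
      ‖toL2 n k G μ (A u)‖ ≤ C * ‖(show SobolevPre S d μ from u)‖ := by
  obtain ⟨C, hC, h⟩ := hA.exists_pointwise_bound hH S
  refine ⟨√C, Real.sqrt_nonneg _, fun u => ?_⟩
  refine (pow_le_pow_iff_left₀ (norm_nonneg _) (by positivity) two_ne_zero).1 ?_
  rw [mul_pow, Real.sq_sqrt hC, norm_toL2_sq, SobolevPre.norm_sq_eq_integral,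
    ← integral_const_mul]
  exact integral_mono (integrable_of_continuous ((continuous_norm_sec n k G (A u)).pow 2))
    ((integrable_of_continuous (S.densitySq_continuous d u)).const_mul C) fun x => h u x

/-- Between two trivializations the identity is the smooth change of trivialization, an operator of
order zero. Hence the inclusion into L² extends to W^d by the same argument as any other operator.
-/
theorem isDiffOp_id (p d : ℕ) (H : (x : M) → Submodule ℝ (TangentSpace (𝓡 n) x)) :
    IsDiffOp n m m p d H (LinearMap.id : Sec n m E →ₗ[ℂ] Sec n m E) := by
  classical
  intro φ hφ e f _ _
  refine ⟨fun α x => if α = 0 then (e.coordChangeL ℂ f x :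
    EuclideanSpace ℂ (Fin m) →L[ℂ] EuclideanSpace ℂ (Fin m)) else 0, fun α => ?_, fun u x hx => ?_⟩
  · split_ifs
    · exact (SmoothHermitianBundle.coordChange (n := n) e f).mono fun x hx => ⟨hx.1.2, hx.2⟩
    · exact contMDiffOn_const
  · rw [Finset.sum_eq_single_of_mem (0 : Fin n → ℕ) (mem_multiIdx.2 (by simp [weight]))
      (fun α _ hα => by simp [hα])]
    have h1 : monomialOp partialDeriv (0 : Fin n → ℕ) (fun y => comp m e u.1 (φ.symm y)) =
        fun y => comp m e u.1 (φ.symm y) := by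
      rw [monomialOp_eq_foldr]
      have h2 : sortedWord (0 : Fin n → ℕ) = [] := by simp [sortedWord]
      rw [h2]
      rfl
    have h3 : comp m f u.1 x = (e.coordChangeL ℂ f x :
        EuclideanSpace ℂ (Fin m) →L[ℂ] EuclideanSpace ℂ (Fin m)) (comp m e u.1 x) := by
      rw [ContinuousLinearEquiv.coe_coe, Trivialization.coordChangeL_apply e f ⟨hx.1.2, hx.2⟩,
        symm_comp e u.1 hx.1.2]
      rfl
    rw [h1, if_pos rfl]
    beta_reduce
    rw [φ.left_inv hx.1.1]
    exact h3

variable {F : M → Type*} [∀ x, NormedAddCommGroup (F x)] [∀ x, InnerProductSpace ℂ (F x)]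
  [TopologicalSpace (TotalSpace (EuclideanSpace ℂ (Fin m)) F)]
  [FiberBundle (EuclideanSpace ℂ (Fin m)) F] [VectorBundle ℂ (EuclideanSpace ℂ (Fin m)) F]
  [SmoothHermitianBundle n m F]

-- `interior_estimate` is transported to `M` at the price of constants: densities compare the
-- measures, fibre norms compare components with sections, and `densitySq` compares jets. The
-- neighbourhood is chosen before ε; only then can a finite cover be fixed first and ε made small
-- afterwards.
set_option maxHeartbeats 400000 in
theorem exists_local_estimate (hH : IsFoliation n p H) (hμ : IsSmoothDensity n μ)
    (S : SobolevData n m p E H J) {P : Sec n m E →ₗ[ℂ] Sec n m F} (hP : IsDiffOp n m m p d H P)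
    (hsymb : HasInvertibleSymbol n m m p d H P) (x₀ : M) :
    ∃ N ∈ 𝓝 x₀, (∃ C : ℝ, 0 ≤ C ∧ ∀ u : Sec n m E, ∫ x in N, S.densitySq d u x ∂μ ≤
        C * ((∫ x, ‖(P u).1 x‖ ^ 2 ∂μ) + (∫ x, S.densitySq (d - 1) u x ∂μ) +
          ∫ x, ‖u.1 x‖ ^ 2 ∂μ)) ∧
      ∀ ε : ℝ, 0 < ε → ∃ C : ℝ, 0 ≤ C ∧ ∀ u : Sec n m E,
        ∫ x in N, S.densitySq (d - 1) u x ∂μ ≤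
        ε * ((∫ x, ‖(P u).1 x‖ ^ 2 ∂μ) + ∫ x, S.densitySq (d - 1) u x ∂μ) +
          C * ∫ x, ‖u.1 x‖ ^ 2 ∂μ := by
  obtain ⟨φ, hφ, hx₀⟩ := hH.exists_chart x₀
  set e := trivializationAt (EuclideanSpace ℂ (Fin m)) E x₀
  set f := trivializationAt (EuclideanSpace ℂ (Fin m)) F x₀
  have he : x₀ ∈ e.baseSet := mem_baseSet_trivializationAt _ _ x₀
  have hf : x₀ ∈ f.baseSet := mem_baseSet_trivializationAt _ _ x₀
  obtain ⟨a, ha⟩ := hP φ hφ e f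
  set U := chartDom φ (e.baseSet ∩ f.baseSet) with hUdef
  have hU : IsOpen U := isOpen_chartDom (e.open_baseSet.inter f.open_baseSet)
  have hyU : φ x₀ ∈ U := mem_chartDom hx₀ ⟨he, hf⟩
  have hac := fun α => (ha.contDiffOn hφ.1 α).continuousOn
  -- Invertibility of the symbol at the single point `x₀` suffices for the estimate nearby.
  have hsy : ∀ ξ : Fin n → ℝ, ξ ≠ 0 → Function.Bijective
      (constSymbol p d (fun α => a α (φ.symm (φ x₀))) ξ) := by
    intro ξ hξ
    rw [φ.left_inv hx₀]
    exact hsymb φ hφ e f a ha x₀ ⟨⟨hx₀, he⟩, hf⟩ ξ hξ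
  obtain ⟨r₀, hr₀, hr₀U, hmain⟩ := interior_estimate p d hU hac hyU hsy
  obtain ⟨N₁, hN₁, C₁, hC₁, h1⟩ := S.densitySq_le d hφ e hx₀ he
  obtain ⟨N₂, hN₂, C₂, hC₂, h2⟩ := S.densitySq_le (d - 1) hφ e hx₀ he
  obtain ⟨N₃, hN₃, C₃, hC₃, h3⟩ := S.le_densitySq (d - 1) hφ e hx₀ he
  obtain ⟨N₄, hN₄, -, C₄, hC₄, h4⟩ := exists_norm_comparison n e he
  obtain ⟨N₅, hN₅, -, C₅, hC₅, h5⟩ := exists_norm_comparison n f hf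
  obtain ⟨O, hO, hOt, C₆, hC₆, h6⟩ := exists_density_bounds hμ hφ.1 (φ.map_source hx₀)
  have hback : ∀ {s : Set M}, s ∈ 𝓝 x₀ → φ.symm ⁻¹' s ∈ 𝓝 (φ x₀) := fun hs =>
    (φ.symm.continuousAt (φ.map_source hx₀)).preimage_mem_nhds (by simpa [φ.left_inv hx₀] using hs)
  obtain ⟨r₁, hr₁, hball⟩ := Metric.nhds_basis_closedBall.mem_iff.1
    (Filter.inter_mem (Filter.inter_mem (Filter.inter_mem (Filter.inter_mem (Filter.inter_mem hN₁ hN₂)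
      hN₃) (hback hN₄)) (hback hN₅)) hO)
  set r := min r₀ r₁ with hrdef
  have hr : 0 < r := lt_min hr₀ hr₁
  set B := Metric.closedBall (φ x₀) r with hB
  set B' := Metric.ball (φ x₀) (r / 2) with hB'
  have hBB : B ⊆ Metric.closedBall (φ x₀) r₁ := Metric.closedBall_subset_closedBall (min_le_right _ _)
  have hB'B : B' ⊆ B := Metric.ball_subset_closedBall.trans
    (Metric.closedBall_subset_closedBall (by linarith))
  have hBU : B ⊆ U := (Metric.closedBall_subset_closedBall (min_le_left _ _)).trans hr₀U
  have hBO : B ⊆ O := fun y hy => (hball (hBB hy)).2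
  have hBt : B ⊆ φ.target := hBO.trans hOt
  have hBc : IsCompact B := isCompact_closedBall _ _
  have hBm : MeasurableSet B := Metric.isClosed_closedBall.measurableSet
  have hB'm : MeasurableSet B' := Metric.isOpen_ball.measurableSet
  have hsymmc : ∀ {g : M → ℝ}, Continuous g → ContinuousOn (fun y => g (φ.symm y)) B := fun hg =>
    hg.comp_continuousOn (φ.symm.continuousOn.mono hBt)
  have hpull : ∀ {g : M → ℝ}, (∀ x, 0 ≤ g x) → Continuous g →
      ∫ y in B, g (φ.symm y) ≤ C₆ * ∫ x, g x ∂μ := fun h0 hg =>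
    setIntegral_comp_symm_le hC₆ (h6 B hBO hBm).1 h0 (integrable_of_continuous hg)
      ((hsymmc hg).aestronglyMeasurable hBm)
  have hpush : ∀ {g : M → ℝ}, (∀ x, 0 ≤ g x) → Continuous g →
      ∫ x in φ.source ∩ φ ⁻¹' B', g x ∂μ ≤ C₆ * ∫ y in B', g (φ.symm y) := fun h0 hg =>
    setIntegral_le_comp_symm hB'm (hB'B.trans hBt) hC₆ (h6 B' (hB'B.trans hBO) hB'm).2 h0 hg
      (((hsymmc hg).integrableOn_compact hBc).mono_set hB'B)
  have hv : ∀ u : Sec n m E, ContDiffOn ℝ ∞ (chartRep φ e u.1) U := fun u =>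
    (chartRep_contDiffOn hφ.1 e u).mono fun y hy => ⟨hy.1, hy.2.1⟩
  have hwc : ∀ (u : Sec n m E) w, ContinuousOn (wordOp coordField w (chartRep φ e u.1)) B :=
    fun u w => (wordOp_contDiffOn hU (fun i => coordField_contDiffOn i) w (hv u)).continuousOn.mono hBU
  have hjc : ∀ (u : Sec n m E) k, IntegrableOn (chartJetSq p k φ e u) B := fun u k =>
    integrable_finsetSum _ fun β _ => integrableOn_norm_sq_of_continuousOn hBc (hwc u _)
  -- the three quantities on the right
  have hPu : ∀ u : Sec n m E, ∫ y in B, ‖varOp p d (fun α y => a α (φ.symm y))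
      (chartRep φ e u.1) y‖ ^ 2 ≤ C₅ ^ 2 * C₆ * ∫ x, ‖(P u).1 x‖ ^ 2 ∂μ := by
    intro u
    have hc := (continuous_norm_sec n m F (P u)).pow 2
    rw [mul_assoc]
    refine le_trans ?_ (mul_le_mul_of_nonneg_left (hpull (fun x => by positivity) hc)
      (sq_nonneg C₅))
    rw [← integral_const_mul]
    refine setIntegral_mono_on (integrableOn_norm_sq_of_continuousOn hBc
      ((varOp_continuousOn p d hU hac (hv u)).mono hBU))
      (((hsymmc hc).integrableOn_compact hBc).const_mul _) hBm fun y hy => ?_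
    rw [← ha.chartRep_eq u (hBU hy), ← mul_pow]
    gcongr
    exact (h5 (P u).1 (φ.symm y) (hball (hBB hy)).1.2).2
  have hDu : ∀ u : Sec n m E, ∫ y in B, chartJetSq p (d - 1) φ e u y ≤
      C₃ * C₆ * ∫ x, S.densitySq (d - 1) u x ∂μ := by
    intro u
    have hc := S.densitySq_continuous (d - 1) u
    rw [mul_assoc]
    refine le_trans ?_ (mul_le_mul_of_nonneg_left (hpull (S.densitySq_nonneg (d - 1) u) hc) hC₃)
    rw [← integral_const_mul]
    exact setIntegral_mono_on (hjc u _) (((hsymmc hc).integrableOn_compact hBc).const_mul _) hBm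
      fun y hy => h3 u y (hball (hBB hy)).1.1.1.2
  have hQu : ∀ u : Sec n m E, ∫ y in B, ‖chartRep φ e u.1 y‖ ^ 2 ≤
      C₄ ^ 2 * C₆ * ∫ x, ‖u.1 x‖ ^ 2 ∂μ := by
    intro u
    have hc := (continuous_norm_sec n m E u).pow 2
    rw [mul_assoc]
    refine le_trans ?_ (mul_le_mul_of_nonneg_left (hpull (fun x => by positivity) hc)
      (sq_nonneg C₄))
    rw [← integral_const_mul]
    refine setIntegral_mono_on (integrableOn_norm_sq_of_continuousOn hBc
      ((hv u).continuousOn.mono hBU))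
      (((hsymmc hc).integrableOn_compact hBc).const_mul _) hBm fun y hy => ?_
    rw [← mul_pow]
    gcongr
    exact (h4 u.1 (φ.symm y) (hball (hBB hy)).1.1.2).2
  -- the left side
  have hleft : ∀ (k : ℕ) (c R : ℝ) (u : Sec n m E), 0 ≤ c →
      (∀ y ∈ B, S.densitySq k u (φ.symm y) ≤ c * chartJetSq p k φ e u y) →
      (∀ α ∈ multiIdx n p k, ∫ y in B', ‖wordOp coordField (sortedWord α)
        (chartRep φ e u.1) y‖ ^ 2 ≤ R) →
      ∫ x in φ.source ∩ φ ⁻¹' B', S.densitySq k u x ∂μ ≤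
        C₆ * (c * ((multiIdx n p k).card * R)) := by
    intro k c R u hc hle hR
    have hcont := S.densitySq_continuous k u
    refine (hpush (S.densitySq_nonneg k u) hcont).trans ?_
    gcongr
    calc ∫ y in B', S.densitySq k u (φ.symm y) ≤ ∫ y in B', c * chartJetSq p k φ e u y :=
          setIntegral_mono_on (((hsymmc hcont).integrableOn_compact hBc).mono_set hB'B)
            (((hjc u k).mono_set hB'B).const_mul _) hB'm fun y hy => hle y (hB'B hy)
      _ = c * ∑ α ∈ multiIdx n p k, ∫ y in B', ‖wordOp coordField (sortedWord α)
        (chartRep φ e u.1) y‖ ^ 2 := by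
          rw [integral_const_mul]
          congr 1
          exact integral_finsetSum _ fun β _ =>
            (integrableOn_norm_sq_of_continuousOn hBc (hwc u _)).mono_set hB'B
      _ ≤ _ := by
          gcongr
          rw [← nsmul_eq_mul]
          exact Finset.sum_le_card_nsmul _ _ _ hR
  obtain ⟨⟨K, hK, hmain1⟩, hmain2⟩ := hmain r hr (min_le_left _ _)
  refine ⟨φ.source ∩ φ ⁻¹' B', (φ.isOpen_inter_preimage Metric.isOpen_ball).mem_nhds
    ⟨hx₀, Metric.mem_ball_self (by positivity)⟩, ?_, ?_⟩
  · set L := C₅ ^ 2 * C₆ + C₃ * C₆ + C₄ ^ 2 * C₆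
    have hL1 : 0 ≤ C₅ ^ 2 * C₆ := by positivity
    have hL2 : 0 ≤ C₃ * C₆ := by positivity
    have hL3 : 0 ≤ C₄ ^ 2 * C₆ := by positivity
    refine ⟨C₆ * (C₁ * ((multiIdx n p d).card * (K * L))), by positivity, fun u => ?_⟩
    have q1 : 0 ≤ ∫ x, ‖(P u).1 x‖ ^ 2 ∂μ := by positivity
    have q2 : 0 ≤ ∫ x, S.densitySq (d - 1) u x ∂μ :=
      integral_nonneg (S.densitySq_nonneg (d - 1) u)
    have q3 : 0 ≤ ∫ x, ‖u.1 x‖ ^ 2 ∂μ := by positivity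
    have hfin := hleft d C₁ (K * (L * ((∫ x, ‖(P u).1 x‖ ^ 2 ∂μ) +
      (∫ x, S.densitySq (d - 1) u x ∂μ) + ∫ x, ‖u.1 x‖ ^ 2 ∂μ))) u hC₁
      (fun y hy => h1 u y (hball (hBB hy)).1.1.1.1.1) (fun α hα => by
        refine (hmain1 _ (hv u) α hα).trans ?_
        gcongr
        refine (add_le_add (add_le_add (hPu u) (hDu u)) (hQu u)).trans ?_
        have := mul_nonneg hL1 q2
        have := mul_nonneg hL1 q3
        have := mul_nonneg hL2 q1
        have := mul_nonneg hL2 q3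
        have := mul_nonneg hL3 q1
        have := mul_nonneg hL3 q2
        simp only [L]
        linarith)
    refine hfin.trans (le_of_eq ?_)
    ring
  · intro ε hε
    set L := C₅ ^ 2 * C₆ + C₃ * C₆
    have hL1 : 0 ≤ C₅ ^ 2 * C₆ := by positivity
    have hL2 : 0 ≤ C₃ * C₆ := by positivity
    set T := C₆ * (C₂ * ((multiIdx n p (d - 1)).card * L))
    have hT : 0 ≤ T := by positivity
    -- `T` collects all factors lost in the transport, so the interior estimate is applied with a
    -- parameter `q` that still leaves at most ε.
    obtain ⟨q, hq, hqT⟩ : ∃ q : ℝ, 0 < q ∧ q * T ≤ ε := by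
      refine ⟨ε / (T + 1), by positivity, ?_⟩
      rw [div_mul_eq_mul_div, div_le_iff₀ (by positivity)]
      nlinarith
    obtain ⟨K', hK', hmain2⟩ := hmain2 q hq
    refine ⟨C₆ * (C₂ * ((multiIdx n p (d - 1)).card * (K' * (C₄ ^ 2 * C₆)))), by positivity,
      fun u => ?_⟩
    have q1 : 0 ≤ ∫ x, ‖(P u).1 x‖ ^ 2 ∂μ := by positivity
    have q2 : 0 ≤ ∫ x, S.densitySq (d - 1) u x ∂μ :=
      integral_nonneg (S.densitySq_nonneg (d - 1) u)
    have q3 : 0 ≤ ∫ x, ‖u.1 x‖ ^ 2 ∂μ := by positivity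
    have hfin := hleft (d - 1) C₂ (q * (L * ((∫ x, ‖(P u).1 x‖ ^ 2 ∂μ) +
      (∫ x, S.densitySq (d - 1) u x ∂μ))) + K' * (C₄ ^ 2 * C₆ * ∫ x, ‖u.1 x‖ ^ 2 ∂μ)) u hC₂
      (fun y hy => h2 u y (hball (hBB hy)).1.1.1.1.2) (fun α hα => by
        refine (hmain2 _ (hv u) α hα).trans ?_
        gcongr
        · refine (add_le_add (hPu u) (hDu u)).trans ?_
          have := mul_nonneg hL1 q2
          have := mul_nonneg hL2 q1
          simp only [L]
          linarith
        · exact hQu u)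
    refine hfin.trans ?_
    calc _ = q * T * ((∫ x, ‖(P u).1 x‖ ^ 2 ∂μ) + ∫ x, S.densitySq (d - 1) u x ∂μ) +
          C₆ * (C₂ * ((multiIdx n p (d - 1)).card * (K' * (C₄ ^ 2 * C₆)))) *
            ∫ x, ‖u.1 x‖ ^ 2 ∂μ := by
          simp only [T]
          ring
      _ ≤ _ := by gcongr

/-- Compactness induction on sets. A union receives ε/2 from each piece, which is possible because
each piece satisfies the estimate for every ε. -/
theorem exists_global_of_local {f : Sec n m E → M → ℝ} (hf0 : ∀ u x, 0 ≤ f u x)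
    (hfc : ∀ u, Continuous (f u)) {R₁ R₂ : Sec n m E → ℝ} (hR₁ : ∀ u, 0 ≤ R₁ u)
    (h : ∀ x₀ : M, ∃ N ∈ 𝓝 x₀, ∀ ε : ℝ, 0 < ε → ∃ C : ℝ, 0 ≤ C ∧ ∀ u,
      ∫ x in N, f u x ∂μ ≤ ε * R₁ u + C * R₂ u) (ε : ℝ) (hε : 0 < ε) :
    ∃ C : ℝ, 0 ≤ C ∧ ∀ u, ∫ x, f u x ∂μ ≤ ε * R₁ u + C * R₂ u := by
  have key := (isCompact_univ (X := M)).induction_on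
    (p := fun s => ∀ ε : ℝ, 0 < ε → ∃ C : ℝ, 0 ≤ C ∧ ∀ u,
      ∫ x in s, f u x ∂μ ≤ ε * R₁ u + C * R₂ u) ?_ ?_ ?_ ?_
  · obtain ⟨C, hC, hu⟩ := key ε hε
    exact ⟨C, hC, fun u => by simpa using hu u⟩
  · intro ε hε
    exact ⟨0, le_rfl, fun u => by simpa using mul_nonneg hε.le (hR₁ u)⟩
  · intro s t hst ht ε hε
    obtain ⟨C, hC, hu⟩ := ht ε hε
    refine ⟨C, hC, fun u => le_trans ?_ (hu u)⟩
    exact setIntegral_mono_set (integrable_of_continuous (hfc u)).integrableOn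
      (.of_forall (hf0 u)) (LE.le.eventuallyLE hst)
  · intro s t hs ht ε hε
    obtain ⟨C, hC, hu⟩ := hs (ε / 2) (by positivity)
    obtain ⟨C', hC', hu'⟩ := ht (ε / 2) (by positivity)
    refine ⟨C + C', by positivity, fun u => ?_⟩
    have hi := integrable_of_continuous (μ := μ) (hfc u)
    -- The sets met in the compactness induction need not be measurable; subadditivity of the
    -- restricted measures is enough for a nonnegative integrand.
    have h1 : ∫ x in s ∪ t, f u x ∂μ ≤ (∫ x in s, f u x ∂μ) + ∫ x in t, f u x ∂μ := by
      rw [← integral_add_measure hi.integrableOn hi.integrableOn]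
      exact integral_mono_measure (Measure.restrict_union_le s t) (.of_forall (hf0 u))
        (hi.restrict.add_measure hi.restrict)
    have := hu u
    have := hu' u
    linarith
  · intro x _
    obtain ⟨N, hN, hx⟩ := h x
    exact ⟨N, mem_nhdsWithin_of_mem_nhds hN, hx⟩

/-- The a-priori estimate `‖u‖_{W^d} ≤ C (‖P u‖ + ‖u‖)` for smooth sections. -/
theorem exists_apriori_estimate (hH : IsFoliation n p H) (hμ : IsSmoothDensity n μ)
    (S : SobolevData n m p E H J) {P : Sec n m E →ₗ[ℂ] Sec n m F} (hP : IsDiffOp n m m p d H P)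
    (hsymb : HasInvertibleSymbol n m m p d H P) :
    ∃ C : ℝ, 0 ≤ C ∧ ∀ u : Sec n m E, ‖(show SobolevPre S d μ from u)‖ ≤
      C * (‖toL2 n m F μ (P u)‖ + ‖toL2 n m E μ u‖) := by
  have hloc := exists_local_estimate hH hμ S hP hsymb
  have p1 : ∀ u, 0 ≤ ∫ x, ‖(P u).1 x‖ ^ 2 ∂μ := fun u => by positivity
  have p2 : ∀ u, 0 ≤ ∫ x, S.densitySq (d - 1) u x ∂μ := fun u =>
    integral_nonneg (S.densitySq_nonneg (d - 1) u)
  have p3 : ∀ u : Sec n m E, 0 ≤ ∫ x, ‖u.1 x‖ ^ 2 ∂μ := fun u => by positivity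
  -- With ε = 1/2 the order d - 1 term on the right is absorbed: its integral is at most ∫‖Pu‖² + 2
  -- C₁ ∫‖u‖².
  obtain ⟨C₁, hC₁, h1⟩ := exists_global_of_local (μ := μ) (S.densitySq_nonneg (d - 1))
    (S.densitySq_continuous (d - 1)) (R₂ := fun u => ∫ x, ‖u.1 x‖ ^ 2 ∂μ) (fun u => add_nonneg (p1 u) (p2 u))
    (fun x₀ => by obtain ⟨N, hN, -, h⟩ := hloc x₀; exact ⟨N, hN, h⟩) (1 / 2) (by norm_num)
  -- The top-order estimate needs no small parameter, so the ε term is made void by R₁ = 0.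
  -- Inserting the bound for order d - 1 gives the factor 2 + 2 C₁ in `K`.
  obtain ⟨C₂, hC₂, h2⟩ := exists_global_of_local (μ := μ) (R₁ := fun _ => 0)
    (R₂ := fun u => (∫ x, ‖(P u).1 x‖ ^ 2 ∂μ) + (∫ x, S.densitySq (d - 1) u x ∂μ) +
      ∫ x, ‖u.1 x‖ ^ 2 ∂μ)
    (S.densitySq_nonneg d) (S.densitySq_continuous d) (fun u => le_rfl)
    (fun x₀ => by
      obtain ⟨N, hN, ⟨C, hC, h⟩, -⟩ := hloc x₀
      exact ⟨N, hN, fun ε _ => ⟨C, hC, fun u => by simpa using h u⟩⟩) 1 one_pos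
  set K := C₂ * (2 + 2 * C₁) with hK
  have hK0 : 0 ≤ K := by positivity
  refine ⟨√K, Real.sqrt_nonneg _, fun u => ?_⟩
  refine (pow_le_pow_iff_left₀ (norm_nonneg _) (by positivity) two_ne_zero).1 ?_
  rw [mul_pow, Real.sq_sqrt hK0, SobolevPre.norm_sq_eq_integral]
  have e1 := h1 u
  have e2 := h2 u
  have q1 := p1 u
  have q2 := p2 u
  have q3 := p3 u
  have hsum : (∫ x, ‖(P u).1 x‖ ^ 2 ∂μ) + ∫ x, ‖u.1 x‖ ^ 2 ∂μ ≤
      (‖toL2 n m F μ (P u)‖ + ‖toL2 n m E μ u‖) ^ 2 := by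
    rw [← norm_toL2_sq, ← norm_toL2_sq]
    nlinarith [norm_nonneg (toL2 n m F μ (P u)), norm_nonneg (toL2 n m E μ u)]
  have e3 : (∫ x, ‖(P u).1 x‖ ^ 2 ∂μ) + (∫ x, S.densitySq (d - 1) u x ∂μ) +
      ∫ x, ‖u.1 x‖ ^ 2 ∂μ ≤ (2 + 2 * C₁) *
      ((∫ x, ‖(P u).1 x‖ ^ 2 ∂μ) + ∫ x, ‖u.1 x‖ ^ 2 ∂μ) := by
    nlinarith [mul_nonneg hC₁ q1]
  calc ∫ x, S.densitySq d u x ∂μ ≤ C₂ * ((∫ x, ‖(P u).1 x‖ ^ 2 ∂μ) +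
        (∫ x, S.densitySq (d - 1) u x ∂μ) + ∫ x, ‖u.1 x‖ ^ 2 ∂μ) := by linarith
    _ ≤ C₂ * ((2 + 2 * C₁) * ((∫ x, ‖(P u).1 x‖ ^ 2 ∂μ) + ∫ x, ‖u.1 x‖ ^ 2 ∂μ)) := by gcongr
    _ ≤ C₂ * ((2 + 2 * C₁) * (‖toL2 n m F μ (P u)‖ + ‖toL2 n m E μ u‖) ^ 2) := by gcongr
    _ = _ := by rw [hK]; ring

end Global

/-! ### Completeness of `L²(E)` -/

theorem ae_of_locally {M : Type*} [TopologicalSpace M] [CompactSpace M] [MeasurableSpace M]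
    {μ : Measure M} {q : M → Prop} (h : ∀ x₀, ∃ N ∈ 𝓝 x₀, ∀ᵐ x ∂μ, x ∈ N → q x) :
    ∀ᵐ x ∂μ, q x := by
  have : ∀ᵐ x ∂μ, x ∈ (univ : Set M) → q x := by
    refine isCompact_univ.induction_on (p := fun s => ∀ᵐ x ∂μ, x ∈ s → q x) (by simp)
      (fun s t hst ht => ht.mono fun x hx hs => hx (hst hs))
      (fun s t hs ht => by
        filter_upwards [hs, ht] with x h1 h2 h3
        exact h3.elim h1 h2) fun x₀ _ => ?_
    obtain ⟨N, hN, h⟩ := h x₀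
    exact ⟨N, mem_nhdsWithin_of_mem_nhds hN, h⟩
  simpa using this

section Complete

variable {n m : ℕ} {M : Type*} [TopologicalSpace M] [ChartedSpace (EuclideanSpace ℝ (Fin n)) M]
  [CompactSpace M] [MeasurableSpace M] [BorelSpace M] {μ : Measure M}
  {E : M → Type*} [∀ x, NormedAddCommGroup (E x)] [∀ x, InnerProductSpace ℂ (E x)]
  [TopologicalSpace (TotalSpace (EuclideanSpace ℂ (Fin m)) E)]
  [FiberBundle (EuclideanSpace ℂ (Fin m)) E] [VectorBundle ℂ (EuclideanSpace ℂ (Fin m)) E]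

theorem comp_sub (e : Trivialization (EuclideanSpace ℂ (Fin m))
      (TotalSpace.proj : TotalSpace (EuclideanSpace ℂ (Fin m)) E → M))
    [MemTrivializationAtlas e] (s t : (x : M) → E x) {x : M} (hx : x ∈ e.baseSet) :
    comp m e (s - t) x = comp m e s x - comp m e t x := by
  have h := comp_add e (s - t) t hx
  rw [sub_add_cancel] at h
  rw [h, add_sub_cancel_right]

-- Convergence in the fibre norm does not refer to a trivialization; this lets limits found in one
-- trivialization be used in all others.
variable (n) in
theorem tendsto_comp_iff [SmoothHermitianBundle n m E] (e : Trivialization (EuclideanSpace ℂ (Fin m))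
      (TotalSpace.proj : TotalSpace (EuclideanSpace ℂ (Fin m)) E → M))
    [MemTrivializationAtlas e] (u : ℕ → (x : M) → E x) (s : (x : M) → E x) {x : M}
    (hx : x ∈ e.baseSet) : Filter.Tendsto (fun k => comp m e (u k) x) Filter.atTop (𝓝 (comp m e s x)) ↔
      Filter.Tendsto (fun k => ‖u k x - s x‖) Filter.atTop (𝓝 0) := by
  obtain ⟨N, hN, hNe, C, hC, h⟩ := exists_norm_comparison n e hx
  have hxN := mem_of_mem_nhds hN
  rw [tendsto_iff_norm_sub_tendsto_zero]
  simp only [← comp_sub e _ _ hx]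
  constructor
  · intro h1
    refine squeeze_zero (fun _ => norm_nonneg _) (fun k => (h (u k - s) x hxN).1) ?_
    simpa using h1.const_mul C
  · intro h1
    refine squeeze_zero (fun _ => norm_nonneg _) (fun k => (h (u k - s) x hxN).2) ?_
    simpa using h1.const_mul C

variable [SmoothHermitianBundle n m E]

/-- Riesz–Fischer for sections: a sequence that is Cauchy at a geometric rate converges almost
everywhere fibrewise, and the limit is also the L² limit. Completeness is needed to extend operators
from smooth sections to W^d with values in L². -/
instance L2Fun.instCompleteSpace : CompleteSpace (L2Fun n m E μ) := by
  classical
  refine Metric.complete_of_convergent_controlled_sequences (fun N => (1 / 2 : ℝ) ^ N)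
    (fun N => by positivity) fun u hu => ?_
  have hu' : ∀ N k l, N ≤ k → N ≤ l →
      eLpNorm (fun x => ‖(u k).1 x - (u l).1 x‖) 2 μ < ENNReal.ofReal ((1 / 2 : ℝ) ^ N) := by
    intro N k l hk hl
    have h := hu N k l hk hl
    rw [dist_eq_norm] at h
    exact (ENNReal.lt_ofReal_iff_toReal_lt (u k - u l).2.2.eLpNorm_ne_top).2 h
  -- Locally the components in one trivialization are Cauchy in L² with summable bounds, hence
  -- converge almost everywhere; the limit is carried back to the fibre.
  have hconv : ∀ᵐ x ∂μ, ∃ v : E x,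
      Filter.Tendsto (fun k => ‖(u k).1 x - v‖) Filter.atTop (𝓝 0) := by
    refine ae_of_locally fun x₀ => ?_
    set e := trivializationAt (EuclideanSpace ℂ (Fin m)) E x₀
    obtain ⟨N, hN, hNe, C, hC, h⟩ :=
      exists_norm_comparison n e (mem_baseSet_trivializationAt _ _ x₀)
    have hCe : ENNReal.ofReal C ≠ 0 := by simpa using hC
    have hsub : interior N ⊆ e.baseSet := interior_subset.trans hNe
    have hm : MeasurableSet (interior N) := isOpen_interior.measurableSet
    refine ⟨interior N, interior_mem_nhds.2 hN, ?_⟩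
    rw [← ae_restrict_iff' hm]
    have hlim := Lp.ae_tendsto_of_cauchy_eLpNorm (μ := μ.restrict (interior N)) (p := 2)
      (f := fun k => comp m e (u k).1)
      (B := fun N => ENNReal.ofReal C * ENNReal.ofReal ((1 / 2 : ℝ) ^ N))
      (fun k => ((u k).2.1 e).mono_measure (Measure.restrict_mono hsub le_rfl)) (by norm_num)
      (by
        rw [ENNReal.tsum_mul_left]
        refine ENNReal.mul_ne_top ENNReal.ofReal_ne_top ?_
        rw [← ENNReal.ofReal_tsum_of_nonneg (fun _ => by positivity) summable_geometric_two]
        exact ENNReal.ofReal_ne_top)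
      (fun K k l hk hl => by
        refine lt_of_le_of_lt ?_ (ENNReal.mul_lt_mul_right hCe ENNReal.ofReal_ne_top (hu' K k l hk hl))
        refine le_trans (eLpNorm_le_mul_eLpNorm_of_ae_le_mul (c := C)
          (g := fun x => ‖(u k).1 x - (u l).1 x‖) ?_ 2) ?_
        · filter_upwards [ae_restrict_mem hm] with x hx
          rw [norm_norm, Pi.sub_apply, ← comp_sub e _ _ (hsub hx)]
          exact (h _ x (interior_subset hx)).2
        · gcongr
          exact Measure.restrict_le_self)
    filter_upwards [hlim, ae_restrict_mem hm] with x ⟨l, hl⟩ hx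
    refine ⟨e.symm x l, ?_⟩
    have h1 := (tendsto_comp_iff n e (fun k => (u k).1) (fun x => e.symm x l) (hsub hx)).1
    rw [comp_symm e l (hsub hx)] at h1
    exact h1 hl
  -- The limit is chosen point by point without a trivialization, and is zero where there is none;
  -- its measurability follows since in each trivialization it is an almost everywhere limit of
  -- measurable components.
  let s : (x : M) → E x := fun x =>
    if h : ∃ v : E x, Filter.Tendsto (fun k => ‖(u k).1 x - v‖) Filter.atTop (𝓝 0)
      then h.choose else 0
  have hs : ∀ᵐ x ∂μ, Filter.Tendsto (fun k => ‖(u k).1 x - s x‖) Filter.atTop (𝓝 0) := by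
    filter_upwards [hconv] with x hx
    simp only [s, dif_pos hx]
    exact hx.choose_spec
  have hsm : IsMeasSection m μ s := by
    intro e _
    refine aestronglyMeasurable_of_tendsto_ae Filter.atTop (fun k => (u k).2.1 e) ?_
    filter_upwards [ae_restrict_of_ae hs, ae_restrict_mem e.open_baseSet.measurableSet] with x hx hxe
    exact (tendsto_comp_iff n e _ s hxe).2 hx
  have hbound : ∀ N k, N ≤ k → eLpNorm (fun x => ‖(u k).1 x - s x‖) 2 μ ≤
      ENNReal.ofReal ((1 / 2 : ℝ) ^ N) := by
    intro N k hk
    refine Lp.eLpNorm_le_of_ae_tendsto (u := Filter.atTop)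
      (f := fun l x => ‖(u k).1 x - (u l).1 x‖) ?_
      (fun l => aestronglyMeasurable_norm n (u k - u l).2.1) ?_
    · filter_upwards [Filter.eventually_ge_atTop N] with l hl
      exact (hu' N k l hk hl).le
    · filter_upwards [hs] with x hx
      rw [tendsto_iff_norm_sub_tendsto_zero]
      refine squeeze_zero (fun _ => norm_nonneg _) (fun l => ?_) hx
      refine (abs_norm_sub_norm_le _ _).trans_eq ?_
      rw [sub_sub_sub_cancel_left, norm_sub_rev]
  have hmem : ∀ k, (fun x => (u k).1 x - s x) ∈ sqIntSections n m E μ := by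
    intro k
    have hms : IsMeasSection m μ (fun x => (u k).1 x - s x) := by
      intro e _
      refine (((u k).2.1 e).sub (hsm e)).congr ?_
      filter_upwards [ae_restrict_mem e.open_baseSet.measurableSet] with x hx
      exact (comp_sub e _ _ hx).symm
    exact ⟨hms, aestronglyMeasurable_norm n hms,
      (hbound 0 k (Nat.zero_le k)).trans_lt ENNReal.ofReal_lt_top⟩
  have hsq : s ∈ sqIntSections n m E μ := by
    have := (sqIntSections n m E μ).sub_mem (u 0).2 (hmem 0)
    convert this using 1
    funext x
    simp
  let s' : L2Fun n m E μ := (⟨s, hsq⟩ : sqIntSections n m E μ)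
  refine ⟨s', ?_⟩
  rw [tendsto_iff_norm_sub_tendsto_zero]
  refine squeeze_zero (fun _ => norm_nonneg _) (g := fun k => (1 / 2 : ℝ) ^ k) (fun k => ?_)
    (tendsto_pow_atTop_nhds_zero_of_lt_one (by norm_num) (by norm_num))
  exact ENNReal.toReal_le_of_le_ofReal (by positivity) (hbound k k le_rfl)

end Complete

/-! ### Weak limits of differential operators in coordinates -/

section Weak

variable {n : ℕ}

theorem integral_dirDeriv_coordField_eq_zero {W : Type*} [NormedAddCommGroup W] [NormedSpace ℝ W]
    {f : EuclideanSpace ℝ (Fin n) → W} (hf : ContDiff ℝ ∞ f) (hs : HasCompactSupport f)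
    (i : Fin n) : ∫ y, dirDeriv (coordField i) f y = 0 := by
  have h1 : Continuous fun y => fderiv ℝ f y (EuclideanSpace.single i 1) :=
    (hf.continuous_fderiv (by simp)).clm_apply continuous_const
  have h := integral_smul_fderiv_eq_neg_fderiv_smul_of_integrable (μ := volume)
    (f := fun _ : EuclideanSpace ℝ (Fin n) => (1 : ℝ)) (g := f) (v := EuclideanSpace.single i 1)
    (by simp) (by simpa using h1.integrable_of_hasCompactSupport (hs.fderiv_apply ℝ _))
    (by simpa using hf.continuous.integrable_of_hasCompactSupport hs)
    (fun _ _ => differentiableAt_const _) (fun y _ => (hf.differentiable (by simp)) y)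
  simpa [dirDeriv, coordField] using h

/-- Integration by parts moves one letter at a time from `v` onto the coefficient, whose support
stays in `K`. In the end only the L¹ norm of `v` itself is needed. -/
theorem exists_norm_integral_wordOp_le {V W : Type*} [NormedAddCommGroup V] [NormedSpace ℝ V]
    [NormedAddCommGroup W] [NormedSpace ℝ W] {U K : Set (EuclideanSpace ℝ (Fin n))} (hU : IsOpen U)
    (hK : IsCompact K) (hKU : K ⊆ U) (w : List (Fin n)) :
    ∀ {b : EuclideanSpace ℝ (Fin n) → V →L[ℝ] W}, ContDiffOn ℝ ∞ b U → tsupport b ⊆ K →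
      ∃ C : ℝ, 0 ≤ C ∧ ∀ v : EuclideanSpace ℝ (Fin n) → V, ContDiffOn ℝ ∞ v U →
        ‖∫ y, b y (wordOp coordField w v y)‖ ≤ C * ∫ y in K, ‖v y‖ := by
  induction w with
  | nil =>
    intro b hb hbK
    obtain ⟨C, hC⟩ := (hK.image_of_continuousOn (hb.continuousOn.mono hKU)).isBounded.exists_norm_le
    refine ⟨max C 0, le_max_right _ _, fun v hv => ?_⟩
    have h0 : ∀ y ∉ K, b y (wordOp coordField [] v y) = 0 := fun y hy => by
      rw [image_eq_zero_of_notMem_tsupport fun h => hy (hbK h)]; rfl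
    rw [← setIntegral_eq_integral_of_forall_compl_eq_zero h0, ← integral_const_mul]
    refine norm_integral_le_of_norm_le
      (((hv.continuousOn.mono hKU).norm.integrableOn_compact hK).const_mul _) ?_
    filter_upwards [ae_restrict_mem hK.measurableSet] with y hy
    refine (ContinuousLinearMap.le_opNorm _ _).trans ?_
    have : ‖b y‖ ≤ max C 0 := (hC _ ⟨y, hy, rfl⟩).trans (le_max_left _ _)
    exact mul_le_mul_of_nonneg_right this (norm_nonneg _)
  | cons i w ih =>
    intro b hb hbK
    have hb' : ContDiffOn ℝ ∞ (dirDeriv (coordField i) b) U :=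
      dirDeriv_contDiffOn hU (coordField_contDiffOn i) hb
    have hts : tsupport (dirDeriv (coordField i) b) ⊆ tsupport b := tsupport_fderiv_apply_subset ℝ _
    obtain ⟨C, hC, h⟩ := ih hb' (hts.trans hbK)
    refine ⟨C, hC, fun v hv => ?_⟩
    set g := wordOp coordField w v
    have hg : ContDiffOn ℝ ∞ g U := wordOp_contDiffOn hU (fun i => coordField_contDiffOn i) w hv
    have hzero : ∀ y ∉ tsupport b, (fun z => b z (g z)) =ᶠ[𝓝 y] fun _ => 0 := fun y hy => by
      filter_upwards [(isClosed_tsupport b).isOpen_compl.mem_nhds hy] with z hz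
      rw [image_eq_zero_of_notMem_tsupport hz]; rfl
    have hF : ContDiff ℝ ∞ fun y => b y (g y) := by
      rw [contDiff_iff_contDiffAt]
      intro y
      by_cases hy : y ∈ tsupport b
      · exact (hb.clm_apply hg).contDiffAt (hU.mem_nhds (hKU (hbK hy)))
      · exact contDiffAt_const.congr_of_eventuallyEq (hzero y hy)
    have hFs : HasCompactSupport fun y => b y (g y) :=
      HasCompactSupport.intro hK fun y hy => (hzero y fun h => hy (hbK h)).self_of_nhds
    have hcont : ∀ {c : EuclideanSpace ℝ (Fin n) → V →L[ℝ] W} {q : EuclideanSpace ℝ (Fin n) → V},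
        ContDiffOn ℝ ∞ c U → tsupport c ⊆ K → ContDiffOn ℝ ∞ q U →
        Integrable fun y => c y (q y) := fun {c q} hc hcK hq => by
      have h0 : ∀ y ∉ K, c y (q y) = 0 := fun y hy => by
        rw [image_eq_zero_of_notMem_tsupport fun h => hy (hcK h)]; rfl
      refine (integrableOn_iff_integrable_of_support_subset fun y hy => ?_).1
        (((hc.clm_apply hq).continuousOn.mono hKU).integrableOn_compact hK)
      by_contra hyK
      exact hy (h0 y hyK)
    have hsum : (fun y => dirDeriv (coordField i) (fun y => b y (g y)) y) =
        fun y => dirDeriv (coordField i) b y (g y) + b y (dirDeriv (coordField i) g y) := by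
      funext y
      by_cases hy : y ∈ tsupport b
      · have hyU := hKU (hbK hy)
        have h1 := fderiv_clm_apply (differentiableAt_of_contDiffOn hU hb hyU)
          (differentiableAt_of_contDiffOn hU hg hyU)
        simp only [dirDeriv, h1]
        simp [add_comm]
      · have h1 : dirDeriv (coordField i) b y = 0 :=
          image_eq_zero_of_notMem_tsupport fun h => hy (hts h)
        rw [h1, image_eq_zero_of_notMem_tsupport hy, dirDeriv, (hzero y hy).fderiv_eq]
        simp
    have hint := integral_dirDeriv_coordField_eq_zero hF hFs i
    rw [hsum, integral_add (hcont hb' (hts.trans hbK) hg)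
      (hcont hb hbK (dirDeriv_contDiffOn hU (coordField_contDiffOn i) hg))] at hint
    change ‖∫ y, b y (dirDeriv (coordField i) g y)‖ ≤ _
    rw [eq_neg_of_add_eq_zero_right hint, norm_neg]
    exact h v hv

variable {V V' : Type*} [NormedAddCommGroup V] [InnerProductSpace ℂ V] [NormedAddCommGroup V']
  [InnerProductSpace ℂ V'] [CompleteSpace V']

/-- A differential operator is closable in coordinates. -/
theorem ae_eq_zero_of_varOp_approx (p d : ℕ) {U : Set (EuclideanSpace ℝ (Fin n))} (hU : IsOpen U)
    {a : (Fin n → ℕ) → EuclideanSpace ℝ (Fin n) → V →L[ℂ] V'} (ha : ∀ α, ContDiffOn ℝ ∞ (a α) U)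
    {K O : Set (EuclideanSpace ℝ (Fin n))} (hK : IsCompact K) (hKU : K ⊆ U) (hO : IsOpen O)
    (hOK : O ⊆ K) {g : EuclideanSpace ℝ (Fin n) → V'} (hg : IntegrableOn g K)
    (h : ∀ ε : ℝ, 0 < ε → ∃ v : EuclideanSpace ℝ (Fin n) → V, ContDiffOn ℝ ∞ v U ∧
      ∫ y in K, ‖v y‖ ≤ ε ∧ ∫ y in K, ‖g y - varOp p d a v y‖ ≤ ε) :
    ∀ᵐ y, y ∈ O → g y = 0 := by
  -- A test function ψ gives ∫ ψ g = ∫ ψ (g - Av) + ∫ ψ Av. The first integral is small by the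
  -- choice of v, the second because all derivatives can be moved off v.
  refine hO.ae_eq_zero_of_integral_contDiff_smul_eq_zero
    (hg.mono_set hOK).locallyIntegrableOn fun ψ hψ hψc hψO => ?_
  have hψK := hψO.trans hOK
  have hb : ∀ α, ContDiffOn ℝ ∞ (fun y => ψ y • (a α y).restrictScalars ℝ) U := fun α =>
    hψ.contDiffOn.smul
      ((ContinuousLinearMap.restrictScalarsL ℂ V V' ℝ ℝ).contDiff.comp_contDiffOn (ha α))
  have hbK : ∀ α, tsupport (fun y => ψ y • (a α y).restrictScalars ℝ) ⊆ K := fun α =>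
    (tsupport_smul_subset_left _ _).trans hψK
  have h1 := fun α => exists_norm_integral_wordOp_le hU hK hKU (sortedWord α) (hb α) (hbK α)
  choose C hC hCb using h1
  obtain ⟨D, hD⟩ := hψ.continuous.bounded_above_of_compact_support hψc
  have hD0 : 0 ≤ D := (norm_nonneg _).trans (hD 0)
  have h0 : ∀ {q : EuclideanSpace ℝ (Fin n) → V'}, ∀ y ∉ K, ψ y • q y = 0 := fun y hy => by
    rw [image_eq_zero_of_notMem_tsupport fun h => hy (hψK h), zero_smul]
  have hest : ∀ ε : ℝ, 0 < ε → ‖∫ y, ψ y • g y‖ ≤ (D + ∑ α ∈ multiIdx n p d, C α) * ε := by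
    intro ε hε
    obtain ⟨v, hv, hv1, hv2⟩ := h ε hε
    have hwc : ∀ w, ContinuousOn (wordOp coordField w v) K := fun w =>
      (wordOp_contDiffOn hU (fun i => coordField_contDiffOn i) w hv).continuousOn.mono hKU
    have hvi : IntegrableOn (varOp p d a v) K :=
      ((varOp_continuousOn p d hU (fun α => (ha α).continuousOn) hv).mono hKU).integrableOn_compact hK
    have hψg : IntegrableOn (fun y => ψ y • (g y - varOp p d a v y)) K := by
      refine Integrable.bdd_smul (𝕜 := ℝ) (φ := ψ) (hg.sub hvi) D
        hψ.continuous.aestronglyMeasurable (.of_forall hD)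
    have hψv : IntegrableOn (fun y => ψ y • varOp p d a v y) K :=
      Integrable.bdd_smul (𝕜 := ℝ) (φ := ψ) hvi D hψ.continuous.aestronglyMeasurable (.of_forall hD)
    have hsplit : ∫ y, ψ y • g y = (∫ y in K, ψ y • (g y - varOp p d a v y)) +
        ∫ y, ψ y • varOp p d a v y := by
      rw [← setIntegral_eq_integral_of_forall_compl_eq_zero (s := K) h0,
        ← setIntegral_eq_integral_of_forall_compl_eq_zero (s := K) (h0 (q := varOp p d a v)),
        ← integral_add hψg hψv]
      congr 1
      funext y
      rw [← smul_add, sub_add_cancel]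
    have hsum : ∫ y, ψ y • varOp p d a v y = ∑ α ∈ multiIdx n p d,
        ∫ y, (ψ y • (a α y).restrictScalars ℝ) (wordOp coordField (sortedWord α) v y) := by
      rw [← integral_finsetSum]
      · congr 1
        funext y
        simp [varOp, Finset.smul_sum]
      · intro α _
        refine (integrableOn_iff_integrable_of_support_subset (s := K) fun y hy => ?_).1
          ((((hb α).continuousOn.mono hKU).clm_apply (hwc _)).integrableOn_compact hK)
        by_contra hyK
        exact hy (h0 (q := fun y => a α y (wordOp coordField (sortedWord α) v y)) y hyK)
    rw [hsplit, add_mul]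
    refine (norm_add_le _ _).trans (add_le_add ?_ ?_)
    · calc _ ≤ ∫ y in K, D * ‖g y - varOp p d a v y‖ := by
            refine norm_integral_le_of_norm_le ((hg.sub hvi).norm.const_mul D) (.of_forall fun y => ?_)
            rw [norm_smul]
            exact mul_le_mul_of_nonneg_right (hD y) (norm_nonneg _)
        _ = D * ∫ y in K, ‖g y - varOp p d a v y‖ := integral_const_mul _ _
        _ ≤ _ := by gcongr
    · rw [hsum, Finset.sum_mul]
      refine (norm_sum_le _ _).trans (Finset.sum_le_sum fun α _ => ?_)
      exact (hCb α v hv).trans (mul_le_mul_of_nonneg_left hv1 (hC α))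
  have hB : 0 ≤ D + ∑ α ∈ multiIdx n p d, C α := add_nonneg hD0 (Finset.sum_nonneg fun α _ => hC α)
  rw [← norm_le_zero_iff]
  refine le_of_forall_pos_le_add fun δ hδ => ?_
  refine (hest (δ / (D + ∑ α ∈ multiIdx n p d, C α + 1)) (by positivity)).trans ?_
  rw [zero_add, mul_div_assoc', div_le_iff₀ (by positivity)]
  nlinarith

end Weak

/-! ### Closability of differential operators -/

section Closable

variable {n k : ℕ} {M : Type*} [TopologicalSpace M] [ChartedSpace (EuclideanSpace ℝ (Fin n)) M]
  [MeasurableSpace M] [BorelSpace M] {μ : Measure M}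
  {φ : OpenPartialHomeomorph M (EuclideanSpace ℝ (Fin n))}
  {G : M → Type*} [∀ x, NormedAddCommGroup (G x)] [∀ x, InnerProductSpace ℂ (G x)]
  [TopologicalSpace (TotalSpace (EuclideanSpace ℂ (Fin k)) G)]
  [FiberBundle (EuclideanSpace ℂ (Fin k)) G] [VectorBundle ℂ (EuclideanSpace ℂ (Fin k)) G]

/-- A measurable section is controlled only up to μ-null sets, so composition with the inverse chart
requires that preimages of null sets be Lebesgue null; the domination of Lebesgue measure ensures
this. -/
theorem aestronglyMeasurable_chartRep {f : Trivialization (EuclideanSpace ℂ (Fin k))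
      (TotalSpace.proj : TotalSpace (EuclideanSpace ℂ (Fin k)) G → M)} [MemTrivializationAtlas f]
    {K : Set (EuclideanSpace ℝ (Fin n))} (hKm : MeasurableSet K)
    (hK : K ⊆ chartDom φ f.baseSet) {c : ENNReal}
    (hc : volume.restrict K ≤ c • ((μ.restrict φ.source).map φ).restrict K)
    {s : (x : M) → G x} (hs : IsMeasSection k μ s) :
    AEStronglyMeasurable (chartRep φ f s) (volume.restrict K) := by
  have hm : AEMeasurable φ.symm (volume.restrict K) :=
    (φ.symm.continuousOn.mono fun y hy => (hK hy).1).aemeasurable hKm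
  refine ((hs f).mono_ac (Measure.AbsolutelyContinuous.mk fun t ht h0 => ?_)).comp_aemeasurable hm
  rw [Measure.restrict_apply ht] at h0
  have h1 := lintegral_comp_symm_le hc ((t ∩ f.baseSet).indicator 1)
  rw [lintegral_indicator_one (ht.inter f.open_baseSet.measurableSet), h0, mul_zero] at h1
  rw [Measure.map_apply_of_aemeasurable hm ht,
    ← lintegral_indicator_one₀ (hm.nullMeasurable ht), ← nonpos_iff_eq_zero]
  refine le_trans (lintegral_mono_ae ?_) h1
  filter_upwards [ae_restrict_mem hKm] with y hy
  refine indicator_apply_le' (fun h => ?_) fun _ => bot_le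
  rw [indicator_of_mem (show φ.symm y ∈ t ∩ f.baseSet from ⟨h, (hK hy).2⟩)]
  rfl

/-- The factor μ(M)^(1/2) comes from Hölder's inequality against the constant 1, in passing from L¹
to L². -/
theorem lintegral_chartRep_le {f : Trivialization (EuclideanSpace ℂ (Fin k))
      (TotalSpace.proj : TotalSpace (EuclideanSpace ℂ (Fin k)) G → M)}
    {K : Set (EuclideanSpace ℝ (Fin n))} (hKm : MeasurableSet K) {c : ENNReal}
    (hc : volume.restrict K ≤ c • ((μ.restrict φ.source).map φ).restrict K)
    {s : (x : M) → G x} {C : ℝ} (hC : 0 ≤ C)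
    (hb : ∀ y ∈ K, ‖comp k f s (φ.symm y)‖ ≤ C * ‖s (φ.symm y)‖)
    (hs : AEStronglyMeasurable (fun x => ‖s x‖) μ) :
    ∫⁻ y in K, ‖chartRep φ f s y‖ₑ ≤
      ENNReal.ofReal C * c * μ univ ^ (1 / 2 : ℝ) * eLpNorm (fun x => ‖s x‖) 2 μ := by
  calc ∫⁻ y in K, ‖chartRep φ f s y‖ₑ
      ≤ ∫⁻ y in K, ENNReal.ofReal C * ‖s (φ.symm y)‖ₑ := by
        refine setLIntegral_mono' hKm fun y hy => ?_
        rw [← ofReal_norm, ← ofReal_norm, ← ENNReal.ofReal_mul hC]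
        exact ENNReal.ofReal_le_ofReal (hb y hy)
    _ = ENNReal.ofReal C * ∫⁻ y in K, ‖s (φ.symm y)‖ₑ :=
        lintegral_const_mul' _ _ ENNReal.ofReal_ne_top
    _ ≤ ENNReal.ofReal C * (c * ∫⁻ x, ‖s x‖ₑ ∂μ) := by
        gcongr
        exact lintegral_comp_symm_le hc fun x => ‖s x‖ₑ
    _ = ENNReal.ofReal C * (c * eLpNorm (fun x => ‖s x‖) 1 μ) := by
        rw [eLpNorm_one_eq_lintegral_enorm]
        simp only [enorm_norm]
    _ ≤ ENNReal.ofReal C * (c * (eLpNorm (fun x => ‖s x‖) 2 μ * μ univ ^ (1 / 2 : ℝ))) := by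
        gcongr
        have := eLpNorm_le_eLpNorm_mul_rpow_measure_univ (p := 1) (q := 2) (by norm_num) hs
        refine this.trans_eq ?_
        norm_num
    _ = _ := by ring

variable {m p d : ℕ} [IsManifold (𝓡 n) ∞ M] [CompactSpace M] [IsFiniteMeasure μ]
  {H : (x : M) → Submodule ℝ (TangentSpace (𝓡 n) x)} [SmoothHermitianBundle n k G]
  {E : M → Type*} [∀ x, NormedAddCommGroup (E x)] [∀ x, InnerProductSpace ℂ (E x)]
  [TopologicalSpace (TotalSpace (EuclideanSpace ℂ (Fin m)) E)]
  [FiberBundle (EuclideanSpace ℂ (Fin m)) E] [VectorBundle ℂ (EuclideanSpace ℂ (Fin m)) E]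
  [SmoothHermitianBundle n m E]

/-- L² control on `M` gives L¹ control in coordinates, which is all that the weak limit argument
asks for. -/
theorem exists_integral_chartRep_le (hμ : IsSmoothDensity n μ)
    (hφ : φ ∈ IsManifold.maximalAtlas (𝓡 n) ∞ M) (f : Trivialization (EuclideanSpace ℂ (Fin k))
      (TotalSpace.proj : TotalSpace (EuclideanSpace ℂ (Fin k)) G → M)) [MemTrivializationAtlas f]
    {x₀ : M} (hx₀ : x₀ ∈ φ.source) (hf : x₀ ∈ f.baseSet) :
    ∃ N ∈ 𝓝 (φ x₀), ∃ D : ℝ, 0 ≤ D ∧ ∀ K ⊆ N, MeasurableSet K →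
      ∀ s ∈ sqIntSections n k G μ, IntegrableOn (chartRep φ f s) K ∧
        ∫ y in K, ‖chartRep φ f s y‖ ≤ D * (eLpNorm (fun x => ‖s x‖) 2 μ).toReal := by
  obtain ⟨N, hN, hNf, C, hC, hb⟩ := exists_norm_comparison n f hf
  obtain ⟨O, hO, hOt, c, hc, hd⟩ := exists_density_bounds hμ hφ (φ.map_source hx₀)
  have hback : φ.symm ⁻¹' N ∈ 𝓝 (φ x₀) :=
    (φ.symm.continuousAt (φ.map_source hx₀)).preimage_mem_nhds (by simpa [φ.left_inv hx₀] using hN)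
  refine ⟨φ.symm ⁻¹' N ∩ O, Filter.inter_mem hback hO,
    (ENNReal.ofReal C * ENNReal.ofReal c * μ univ ^ (1 / 2 : ℝ)).toReal, ENNReal.toReal_nonneg,
    fun K hK hKm s hs => ?_⟩
  have hcK := (hd K (fun y hy => (hK hy).2) hKm).1
  have hm := aestronglyMeasurable_chartRep hKm
    (fun y hy => ⟨hOt (hK hy).2, hNf (hK hy).1⟩ : K ⊆ chartDom φ f.baseSet) hcK hs.1
  have hle := lintegral_chartRep_le hKm hcK hC.le (fun y hy => (hb s _ (hK hy).1).2) hs.2.1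
  have hfin : ENNReal.ofReal C * ENNReal.ofReal c * μ univ ^ (1 / 2 : ℝ) *
      eLpNorm (fun x => ‖s x‖) 2 μ ≠ ⊤ := by
    refine ENNReal.mul_ne_top (ENNReal.mul_ne_top (ENNReal.mul_ne_top ENNReal.ofReal_ne_top
      ENNReal.ofReal_ne_top) ?_) hs.2.eLpNorm_ne_top
    exact ENNReal.rpow_ne_top_of_nonneg (by norm_num) (measure_ne_top _ _)
  refine ⟨⟨hm, hle.trans_lt hfin.lt_top⟩, ?_⟩
  rw [integral_norm_eq_lintegral_enorm hm, ← ENNReal.toReal_mul]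
  exact ENNReal.toReal_mono hfin hle

/-- A differential operator is closable: a limit of `A u` along sections `u` that tend to zero
vanishes. -/
theorem IsDiffOp.ae_eq_zero_of_approx (hH : IsFoliation n p H) (hμ : IsSmoothDensity n μ)
    {A : Sec n m E →ₗ[ℂ] Sec n k G} (hA : IsDiffOp n m k p d H A) {g : (x : M) → G x}
    (hg : g ∈ sqIntSections n k G μ)
    (h : ∀ ε : ℝ, 0 < ε → ∃ u : Sec n m E, (eLpNorm (fun x => ‖u.1 x‖) 2 μ).toReal ≤ ε ∧
      (eLpNorm (fun x => ‖g x - (A u).1 x‖) 2 μ).toReal ≤ ε) :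
    ∀ᵐ x ∂μ, g x = 0 := by
  refine ae_of_locally fun x₀ => ?_
  obtain ⟨φ, hφ, hx₀⟩ := hH.exists_chart x₀
  set e := trivializationAt (EuclideanSpace ℂ (Fin m)) E x₀
  set f := trivializationAt (EuclideanSpace ℂ (Fin k)) G x₀
  have he : x₀ ∈ e.baseSet := mem_baseSet_trivializationAt _ _ x₀
  have hf : x₀ ∈ f.baseSet := mem_baseSet_trivializationAt _ _ x₀
  obtain ⟨a, ha⟩ := hA φ hφ e f
  set U := chartDom φ (e.baseSet ∩ f.baseSet)
  have hU : IsOpen U := isOpen_chartDom (e.open_baseSet.inter f.open_baseSet)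
  have hyU : φ x₀ ∈ U := mem_chartDom hx₀ ⟨he, hf⟩
  obtain ⟨N₁, hN₁, D₁, hD₁, h1⟩ := exists_integral_chartRep_le hμ hφ.1 e hx₀ he
  obtain ⟨N₂, hN₂, D₂, hD₂, h2⟩ := exists_integral_chartRep_le hμ hφ.1 f hx₀ hf
  obtain ⟨O, hO, hOt, c, hc, hd⟩ := exists_density_bounds hμ hφ.1 (φ.map_source hx₀)
  obtain ⟨r, hr, hball⟩ := Metric.nhds_basis_closedBall.mem_iff.1
    (Filter.inter_mem (Filter.inter_mem (Filter.inter_mem hN₁ hN₂) hO) (hU.mem_nhds hyU))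
  set K := Metric.closedBall (φ x₀) r
  set B := Metric.ball (φ x₀) r
  have hBK : B ⊆ K := Metric.ball_subset_closedBall
  have hKm : MeasurableSet K := Metric.isClosed_closedBall.measurableSet
  have hKU : K ⊆ U := fun y hy => (hball hy).2
  have hK1 : K ⊆ N₁ := fun y hy => (hball hy).1.1.1
  have hK2 : K ⊆ N₂ := fun y hy => (hball hy).1.1.2
  have hzero : ∀ᵐ y, y ∈ B → chartRep φ f g y = 0 := by
    refine ae_eq_zero_of_varOp_approx p d hU (fun α => ha.contDiffOn hφ.1 α)
      (isCompact_closedBall _ _) hKU Metric.isOpen_ball hBK (h2 K hK2 hKm g hg).1 fun ε hε => ?_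
    have hQ : 0 < D₁ + D₂ + 1 := by positivity
    obtain ⟨u, hu1, hu2⟩ := h (ε / (D₁ + D₂ + 1)) (by positivity)
    have hsmall : ∀ D t : ℝ, 0 ≤ D → D ≤ D₁ + D₂ + 1 → t ≤ ε / (D₁ + D₂ + 1) → D * t ≤ ε := by
      intro D t hD hD' ht
      calc D * t ≤ D * (ε / (D₁ + D₂ + 1)) := by gcongr
        _ ≤ (D₁ + D₂ + 1) * (ε / (D₁ + D₂ + 1)) := by gcongr
        _ = ε := by field_simp
    refine ⟨chartRep φ e u.1, (chartRep_contDiffOn hφ.1 e u).mono fun y hy => ⟨hy.1, hy.2.1⟩,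
      (h1 K hK1 hKm u.1 (sec_mem_sqInt n m E μ u)).2.trans
        (hsmall _ _ hD₁ (by linarith) hu1), ?_⟩
    have hsub := (h2 K hK2 hKm (g - (A u).1)
      ((sqIntSections n k G μ).sub_mem hg (sec_mem_sqInt n k G μ (A u)))).2.trans
        (hsmall _ _ hD₂ (by linarith) hu2)
    refine le_trans (le_of_eq (setIntegral_congr_fun hKm fun y hy => ?_)) hsub
    rw [← ha.chartRep_eq u (hKU hy)]
    exact congrArg _ (comp_sub f g (A u).1 (hKU hy).2.2).symm
  have hBm : MeasurableSet B := Metric.isOpen_ball.measurableSet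
  -- The upper bound on the density makes the image of μ absolutely continuous on the ball, so the
  -- Lebesgue statement returns to `M`.
  have hmap : ∀ᵐ y ∂((μ.restrict φ.source).map φ), y ∈ B → chartRep φ f g y = 0 := by
    rw [← ae_restrict_iff' hBm] at hzero ⊢
    exact (Measure.absolutelyContinuous_of_le_smul
      (hd B (fun y hy => (hball (hBK hy)).1.2) hBm).2).ae_le hzero
  have hM := ae_of_ae_map aemeasurable_chart hmap
  rw [ae_restrict_iff' φ.open_source.measurableSet] at hM
  refine ⟨φ.source ∩ φ ⁻¹' B ∩ f.baseSet, Filter.inter_mem (Filter.inter_mem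
    (φ.open_source.mem_nhds hx₀) ((φ.continuousAt hx₀).preimage_mem_nhds
      (Metric.ball_mem_nhds _ hr))) (f.open_baseSet.mem_nhds hf), ?_⟩
  filter_upwards [hM] with x hx hxN
  have h3 := hx hxN.1.1 hxN.1.2
  rw [chartRep, φ.left_inv hxN.1.1] at h3
  rw [← symm_comp f g hxN.2, h3, ← f.coe_symmₗ (R := ℂ) hxN.2, map_zero]

end Closable

/-! ### The closure of an operator with an a-priori estimate -/

section Abstract

variable {X A B : Type*} [SeminormedAddCommGroup X] [NormedSpace ℂ X]
  [NormedAddCommGroup A] [NormedSpace ℂ A] [NormedAddCommGroup B] [NormedSpace ℂ B]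

open UniformSpace in
theorem exists_extension_completion [CompleteSpace A] (T : X →ₗ[ℂ] A) {C : ℝ}
    (hT : ∀ u, ‖T u‖ ≤ C * ‖u‖) :
    ∃ T' : Completion X →L[ℂ] A, ∀ u : X, T' (u : Completion X) = T u :=
  ⟨(T.mkContinuous C hT).extend (Completion.toComplL (𝕜 := ℂ)), fun u =>
    ContinuousLinearMap.extend_eq (T.mkContinuous C hT) Completion.denseRange_coe
      (Completion.isUniformInducing_coe X) u⟩

open UniformSpace in
theorem norm_le_completion {T' : Completion X →L[ℂ] A} {Q' : Completion X →L[ℂ] B} {C : ℝ}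
    (h : ∀ u : X, ‖u‖ ≤ C * (‖Q' u‖ + ‖T' u‖)) (w : Completion X) :
    ‖w‖ ≤ C * (‖Q' w‖ + ‖T' w‖) := by
  induction w using Completion.induction_on with
  | hp => exact isClosed_le (by fun_prop) (by fun_prop)
  | ih u => rw [Completion.norm_coe]; exact h u

open UniformSpace in
/-- If the graph norm of `f` dominates the norm of `X`, then the graph of the closure of `f` is
parametrized by the completion of `X`. -/
theorem topologicalClosure_graph_eq {f : A →ₗ.[ℂ] B} {T' : Completion X →L[ℂ] A}
    {Q' : Completion X →L[ℂ] B} {C : ℝ} (hC : 0 ≤ C)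
    (hf : ∀ z : A × B, z ∈ f.graph ↔ ∃ u : X, (T' u, Q' u) = z)
    (hest : ∀ u : X, ‖u‖ ≤ C * (‖Q' u‖ + ‖T' u‖)) :
    f.graph.topologicalClosure = LinearMap.range (T'.prod Q').toLinearMap := by
  -- The estimate persists on the completion and says that the map into the product is bounded
  -- below, so its range is complete and therefore closed.
  have hanti : AntilipschitzWith (Real.toNNReal (2 * C)) (T'.prod Q') := by
    refine AddMonoidHomClass.antilipschitz_of_bound _ fun w => ?_
    rw [Real.coe_toNNReal _ (by positivity)]
    have h1 := norm_le_completion hest w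
    have h2 : ‖T' w‖ ≤ ‖(T'.prod Q') w‖ := norm_fst_le ((T'.prod Q') w)
    have h3 : ‖Q' w‖ ≤ ‖(T'.prod Q') w‖ := norm_snd_le ((T'.prod Q') w)
    nlinarith
  apply le_antisymm
  · refine Submodule.topologicalClosure_minimal _ (fun z hz => ?_)
      (hanti.isClosed_range (T'.prod Q').uniformContinuous)
    obtain ⟨u, rfl⟩ := (hf z).1 hz
    exact ⟨(u : Completion X), rfl⟩
  · rintro _ ⟨w, rfl⟩
    change (T'.prod Q') w ∈ closure (f.graph : Set (A × B))
    induction w using Completion.induction_on with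
    | hp => exact isClosed_closure.preimage (T'.prod Q').continuous
    | ih u => exact subset_closure ((hf _).2 ⟨u, rfl⟩)

-- The estimate identifies the closure of the graph with the range of (T', Q'). The hypothesis `hcl`
-- is closability at zero: it forces Q' w = 0 whenever T' w = 0. This makes the closure a graph, and
-- the estimate then also gives w = 0, so T' is injective.
open UniformSpace in
theorem closure_of_estimate {f : A →ₗ.[ℂ] B} {T' : Completion X →L[ℂ] A}
    {Q' : Completion X →L[ℂ] B} {t : X → A} {q : X → B} (ht : ∀ u : X, T' u = t u)
    (hq : ∀ u : X, Q' u = q u) {C : ℝ} (hC : 0 ≤ C)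
    (hf : ∀ z : A × B, z ∈ f.graph ↔ ∃ u : X, (t u, q u) = z)
    (hest : ∀ u : X, ‖u‖ ≤ C * (‖q u‖ + ‖t u‖))
    (hcl : ∀ b : B, (∀ ε : ℝ, 0 < ε → ∃ u : X, ‖t u‖ ≤ ε ∧ ‖b - q u‖ ≤ ε) → b = 0) :
    f.IsClosable ∧ Function.Injective T' ∧ range T' = (f.closure.domain : Set A) ∧
      ∀ w (v : f.closure.domain), T' w = v →
        f.closure v = Q' w ∧ ‖w‖ ≤ C * (‖Q' w‖ + ‖T' w‖) := by
  simp only [← ht, ← hq] at hf hest hcl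
  have hgr := topologicalClosure_graph_eq hC hf hest
  -- If T' w = 0, then (0, Q' w) is a limit of graph points, which is the situation excluded by
  -- `hcl` unless Q' w = 0.
  have hker : ∀ w, T' w = 0 → Q' w = 0 := by
    intro w hw
    refine hcl _ fun ε hε => ?_
    have hmem : (T'.prod Q') w ∈ closure (f.graph : Set (A × B)) := by
      change (T'.prod Q') w ∈ f.graph.topologicalClosure
      rw [hgr]
      exact ⟨w, rfl⟩
    obtain ⟨z, hz, hd⟩ := Metric.mem_closure_iff.1 hmem ε hε
    obtain ⟨u, rfl⟩ := (hf z).1 hz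
    rw [dist_eq_norm] at hd
    refine ⟨u, ?_, (norm_snd_le ((T'.prod Q') w - (T' u, Q' u))).trans hd.le⟩
    have := (norm_fst_le ((T'.prod Q') w - (T' u, Q' u))).trans hd.le
    simpa [hw] using this
  have hclos : f.IsClosable := by
    refine ⟨f.graph.topologicalClosure.toLinearPMap,
      (Submodule.toLinearPMap_graph_eq _ fun z hz h0 => ?_).symm⟩
    rw [hgr] at hz
    obtain ⟨w, rfl⟩ := hz
    exact hker w h0
  have hgraph : f.closure.graph = LinearMap.range (T'.prod Q').toLinearMap :=
    hclos.graph_closure_eq_closure_graph.symm.trans hgr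
  refine ⟨hclos, (injective_iff_map_eq_zero T').2 fun w hw => ?_, ?_, fun w v hv => ?_⟩
  · have h1 := norm_le_completion hest w
    rw [hw, hker w hw] at h1
    simpa using h1
  · ext a
    rw [SetLike.mem_coe, LinearPMap.mem_domain_iff, hgraph]
    constructor
    · rintro ⟨w, rfl⟩
      exact ⟨Q' w, w, rfl⟩
    · rintro ⟨b, w, hw⟩
      exact ⟨w, congrArg Prod.fst hw⟩
  · refine ⟨?_, norm_le_completion hest w⟩
    refine LinearPMap.mem_graph_snd_inj f.closure (f.closure.mem_graph v)
      (y := T' w) ?_ hv.symm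
    rw [hgraph]
    exact ⟨w, rfl⟩

end Abstract

/-! ### Differential operators as instances of the abstract closure criterion -/

section Application

variable {n m k p d : ℕ} {M : Type*} [TopologicalSpace M]
  [ChartedSpace (EuclideanSpace ℝ (Fin n)) M]
  [IsManifold (𝓡 n) ∞ M] [CompactSpace M] [MeasurableSpace M] [BorelSpace M]
  {H : (x : M) → Submodule ℝ (TangentSpace (𝓡 n) x)}
  {μ : Measure M} [IsFiniteMeasure μ]
  {E : M → Type*} [∀ x, NormedAddCommGroup (E x)] [∀ x, InnerProductSpace ℂ (E x)]
  [TopologicalSpace (TotalSpace (EuclideanSpace ℂ (Fin m)) E)]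
  [FiberBundle (EuclideanSpace ℂ (Fin m)) E] [VectorBundle ℂ (EuclideanSpace ℂ (Fin m)) E]
  [SmoothHermitianBundle n m E]
  {G : M → Type*} [∀ x, NormedAddCommGroup (G x)] [∀ x, InnerProductSpace ℂ (G x)]
  [TopologicalSpace (TotalSpace (EuclideanSpace ℂ (Fin k)) G)]
  [FiberBundle (EuclideanSpace ℂ (Fin k)) G] [VectorBundle ℂ (EuclideanSpace ℂ (Fin k)) G]
  [SmoothHermitianBundle n k G]

theorem IsDiffOp.eq_zero_of_approx (hH : IsFoliation n p H) (hμ : IsSmoothDensity n μ)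
    {A : Sec n m E →ₗ[ℂ] Sec n k G} (hA : IsDiffOp n m k p d H A) (b : L2 n k G μ)
    (h : ∀ ε : ℝ, 0 < ε → ∃ u : Sec n m E, ‖toL2 n m E μ u‖ ≤ ε ∧
      ‖b - toL2 n k G μ (A u)‖ ≤ ε) : b = 0 := by
  obtain ⟨g, rfl⟩ := SeparationQuotient.surjective_mk b
  have h0 := hA.ae_eq_zero_of_approx hH hμ g.2 h
  rw [← norm_eq_zero, SeparationQuotient.norm_mk, L2Fun.norm_def,
    eLpNorm_congr_ae (g := fun _ => (0 : ℝ)) (h0.mono fun x hx => by simp [hx])]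
  simp

theorem mem_graph_unboundedOp [μ.IsOpenPosMeasure] (P : Sec n m E →ₗ[ℂ] Sec n k G)
    (z : L2 n m E μ × L2 n k G μ) : z ∈ (unboundedOp n m k μ P).graph ↔
      ∃ u, (toL2 n m E μ u, toL2 n k G μ (P u)) = z := by
  rw [LinearPMap.mem_graph_iff']
  constructor
  · rintro ⟨⟨_, u, rfl⟩, rfl⟩
    exact ⟨u, by rw [← unboundedOp_apply]⟩
  · rintro ⟨u, rfl⟩
    exact ⟨⟨toL2 n m E μ u, ⟨u, rfl⟩⟩, by rw [unboundedOp_apply]⟩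

theorem IsDiffOp.exists_extension {J : Type*} [Fintype J] (hH : IsFoliation n p H)
    (S : SobolevData n m p E H J) {A : Sec n m E →ₗ[ℂ] Sec n k G}
    (hA : IsDiffOp n m k p d H A) : ∃ A' : SobolevSpace d S μ →L[ℂ] L2 n k G μ,
      ∀ u, A' (toSobolev d S μ u) = toL2 n k G μ (A u) := by
  obtain ⟨C, -, h⟩ := hA.exists_bound (μ := μ) hH S
  let T : SobolevPre S d μ →ₗ[ℂ] L2 n k G μ :=
    { toFun := fun u => toL2 n k G μ (A u)
      map_add' := fun u v => (toL2 n k G μ ∘ₗ A).map_add u v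
      map_smul' := fun c u => (toL2 n k G μ ∘ₗ A).map_smul c u }
  exact exists_extension_completion T h

end Application

end FoliatedSobolev

end

/-! ### The main theorem -/

theorem mainTheorem7
    {n m p d : ℕ}
    {M : Type*} [TopologicalSpace M] [ChartedSpace (EuclideanSpace ℝ (Fin n)) M]
    [IsManifold (𝓡 n) ∞ M] [T2Space M] [CompactSpace M] [MeasurableSpace M] [BorelSpace M]
    (H : (x : M) → Submodule ℝ (TangentSpace (𝓡 n) x)) (hH : FoliatedSobolev.IsFoliation n p H)
    (μ : MeasureTheory.Measure M) [MeasureTheory.IsFiniteMeasure μ] [μ.IsOpenPosMeasure]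
    (hμ : FoliatedSobolev.IsSmoothDensity n μ)
    (E : M → Type*) [∀ x, NormedAddCommGroup (E x)] [∀ x, InnerProductSpace ℂ (E x)]
    [TopologicalSpace (Bundle.TotalSpace (EuclideanSpace ℂ (Fin m)) E)]
    [FiberBundle (EuclideanSpace ℂ (Fin m)) E] [VectorBundle ℂ (EuclideanSpace ℂ (Fin m)) E]
    [FoliatedSobolev.SmoothHermitianBundle n m E]
    (F : M → Type*) [∀ x, NormedAddCommGroup (F x)] [∀ x, InnerProductSpace ℂ (F x)]
    [TopologicalSpace (Bundle.TotalSpace (EuclideanSpace ℂ (Fin m)) F)]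
    [FiberBundle (EuclideanSpace ℂ (Fin m)) F] [VectorBundle ℂ (EuclideanSpace ℂ (Fin m)) F]
    [FoliatedSobolev.SmoothHermitianBundle n m F]
    {J : Type*} [Fintype J] (S : FoliatedSobolev.SobolevData n m p E H J)
    (P : FoliatedSobolev.Sec n m E →ₗ[ℂ] FoliatedSobolev.Sec n m F)
    (hP : FoliatedSobolev.IsDiffOp n m m p d H P)
    (hsymb : FoliatedSobolev.HasInvertibleSymbol n m m p d H P) :
    (FoliatedSobolev.unboundedOp n m m μ P).IsClosable ∧
    ∃ ι : FoliatedSobolev.SobolevSpace d S μ →L[ℂ] FoliatedSobolev.L2 n m E μ,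
      (∀ u, ι (FoliatedSobolev.toSobolev d S μ u) = FoliatedSobolev.toL2 n m E μ u) ∧
      Function.Injective ι ∧
      Set.range ι = ((FoliatedSobolev.unboundedOp n m m μ P).closure.domain :
        Set (FoliatedSobolev.L2 n m E μ)) ∧
      ∀ (k : ℕ) (G : M → Type*) [∀ x, NormedAddCommGroup (G x)] [∀ x, InnerProductSpace ℂ (G x)]
        [TopologicalSpace (Bundle.TotalSpace (EuclideanSpace ℂ (Fin k)) G)]
        [FiberBundle (EuclideanSpace ℂ (Fin k)) G] [VectorBundle ℂ (EuclideanSpace ℂ (Fin k)) G]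
        [FoliatedSobolev.SmoothHermitianBundle n k G]
        (A : FoliatedSobolev.Sec n m E →ₗ[ℂ] FoliatedSobolev.Sec n k G),
        FoliatedSobolev.IsDiffOp n m k p d H A →
        ∃ A' : FoliatedSobolev.SobolevSpace d S μ →L[ℂ] FoliatedSobolev.L2 n k G μ,
          (∀ u, A' (FoliatedSobolev.toSobolev d S μ u) = FoliatedSobolev.toL2 n k G μ (A u)) ∧
          ∃ C : ℝ, 0 < C ∧ ∀ (w : FoliatedSobolev.SobolevSpace d S μ)
            (v : (FoliatedSobolev.unboundedOp n m m μ P).closure.domain), ι w = v →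
            ‖A' w‖ ≤ C * (‖(FoliatedSobolev.unboundedOp n m m μ P).closure v‖ + ‖ι w‖) := by
  -- The embedding ι is the extension of the identity, regarded as an operator of weighted order ≤
  -- d.
  obtain ⟨ι, hι⟩ := (FoliatedSobolev.isDiffOp_id (E := E) p d H).exists_extension (μ := μ) hH S
  obtain ⟨P', hP'⟩ := hP.exists_extension (μ := μ) hH S
  obtain ⟨C, hC, hest⟩ := FoliatedSobolev.exists_apriori_estimate hH hμ S hP hsymb
  obtain ⟨h1, h2, h3, h4⟩ := FoliatedSobolev.closure_of_estimate
    (X := FoliatedSobolev.SobolevPre S d μ) (f := FoliatedSobolev.unboundedOp n m m μ P)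
    (t := fun u => FoliatedSobolev.toL2 n m E μ u) (q := fun u => FoliatedSobolev.toL2 n m F μ (P u))
    hι hP' hC (FoliatedSobolev.mem_graph_unboundedOp P) hest (hP.eq_zero_of_approx hH hμ)
  refine ⟨h1, ι, hι, h2, h3, fun k G _ _ _ _ _ _ A hA => ?_⟩
  obtain ⟨A', hA'⟩ := hA.exists_extension (μ := μ) hH S
  -- The summand 1 makes the constant strictly positive even when `A'` or `C` is zero.
  refine ⟨A', hA', ‖A'‖ * C + 1, by positivity, fun w v hv => ?_⟩
  obtain ⟨h5, h6⟩ := h4 w v hv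
  rw [h5]
  have h7 : 0 ≤ ‖P' w‖ + ‖ι w‖ := by positivity
  calc ‖A' w‖ ≤ ‖A'‖ * ‖w‖ := A'.le_opNorm w
    _ ≤ ‖A'‖ * (C * (‖P' w‖ + ‖ι w‖)) := by gcongr
    _ ≤ (‖A'‖ * C + 1) * (‖P' w‖ + ‖ι w‖) := by linarith
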